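/- Let $F$ be a non-archimedean local field with valuation ring $\mathcal O$, let $\varpi$ be a generator of its maximal ideal and $q$ the number of elements of its residue field. Let $G=\mathrm{PGL}_3(F)$, let $K$ be the image of $\mathrm{GL}_3(\mathcal O)$ in $G$, and let $X$ be the Bruhat–Tits building of $G$. Its vertices are the homothety classes $[\Lambda]$ of $\mathcal O$-lattices $\Lambda$ in $F^3$; two distinct vertices are joined by an edge if they have representatives with $\varpi\Lambda_1\subset\Lambda_2\subset\Lambda_1$. Let $L_j$ ($j=0,1,2$) be the lattice with basis obtained from the standard basis $e_1,e_2,e_3$ of $F^3$ by multiplying the last $j$ vectors by $\varpi$; a vertex has type $j$ if it lies in the $\mathrm{SL}_3(F)$-orbit of $[L_j]$. An edge $(x,y)$ is positively oriented if $y$ has type $j+1 \bmod 3$, where $j$ is the type of $x$. A rank-one geodesic is a straight line in an apartment that runs along edges of $X$. A line segment of length $n$ in $X$ is a sequence $s=(x_0,\dots,x_n)$ of consecutive vertices on a rank-one geodesic; it is positively oriented if all the edges $(x_i,x_{i+1})$ are. Its starting point is $o(s)=x_0$ and its endpoint is $e(s)=x_n$. Let $\Gamma\subset G$ be a discrete,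 cocompact and torsion-free subgroup. The (positively oriented) line segments in $\Gamma\backslash X$ are the images of those in $X$, taken as paths along edges of $\Gamma\backslash X$; that is, they are the $\Gamma$-orbits of (positively oriented) line segments in $X$. For $Y=X$ or $Y=\Gamma\backslash X$ let $C_0(Y)=\bigoplus_{x}\mathbb C x$, where $x$ runs through the vertices of $Y$, and let $A_n$ be the linear operator on $C_0(Y)$ given by $$A_n x=\sum_{s:\ l(s)=n,\ o(s)=x} e(s),$$ where $s$ runs through the positively oriented line segments in $Y$ of length $n$ with starting point $x$. Identify $C_0(X)$ and $C_0(\Gamma\backslash X)$ with the spaces of finitely supported functions on $G/K$ and $\Gamma\backslash G/K$, by means of $gK\mapsto [gL_0]$. Let $\pi_1$ and $\pi_2$ be the operators $\varphi\mapsto\varphi*\mathbf 1_{KaK}$ on these spaces for $a=\mathrm{diag}(1,1,\varpi)$ and $a=\mathrm{diag}(1,\varpi,\varpi)$ respectively, where $(\varphi*f)(x)=\int_G\varphi(y)f(y^{-1}x)\,dy$ and $dy$ is the Haar measure on $G$ that gives $K$ volume $1$. Then, as operators on $C_0(X)$, and likewise as operators on $C_0(\Gamma\backslash X)$: - $A_1=\pi_1$;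 - $A_2=\pi_1^2-(q+1)\pi_2$; - $A_3=\pi_1^3-(2q+1)\pi_1\pi_2+(1+q+q^2)q$; - $A_{n+1}=A_n\pi_1-qA_{n-1}\pi_2+q^3A_{n-2}$ for every $n\ge 3$. -/

import Mathlib

open ValuativeRel MeasureTheory
open scoped MatrixGroups Pointwise

noncomputable section

namespace PGLThree

section Building

variable (F : Type*) [Field F] [ValuativeRel F]

/-- The `𝒪`-lattices in `F³`: the finitely generated `𝒪`-submodules that span `F³`. -/
abbrev Lat : Type _ := {Λ : Submodule 𝒪[F] (Fin 3 → F) // Submodule.IsLattice F Λ}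

/-- Two lattices `Λ, Λ'` are homothetic if `Λ' = α Λ` for some `α ∈ Fˣ`. -/
def homothety : Setoid (Lat F) where
  r Λ Λ' := ∃ α : Fˣ, Λ'.1 = α • Λ.1
  iseqv := ⟨fun Λ => ⟨1, by simp⟩, fun ⟨α, h⟩ => ⟨α⁻¹, by simp [h]⟩,
    fun ⟨α, h⟩ ⟨β, h'⟩ => ⟨β * α, by rw [h', h, mul_smul]⟩⟩

/-- The vertices of the building of `PGL₃(F)`: homothety classes of lattices. -/
def Vertex : Type _ := Quotient (homothety F)

variable {F}

/-- The vertex given by a lattice. -/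
def Lat.vertex (Λ : Lat F) : Vertex F := Quotient.mk (homothety F) Λ

/-- The linear map `v ↦ g v` of `F³`, regarded as `𝒪`-linear. -/
def glMap (g : GL (Fin 3) F) : (Fin 3 → F) →ₗ[𝒪[F]] (Fin 3 → F) :=
  (Matrix.toLin' (g : Matrix (Fin 3) (Fin 3) F)).restrictScalars 𝒪[F]

lemma glMap_mul (g h : GL (Fin 3) F) : glMap (g * h) = glMap g ∘ₗ glMap h := by
  ext v; simp [glMap]

lemma glMap_one : glMap (1 : GL (Fin 3) F) = LinearMap.id := by
  ext v; simp [glMap]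

/-- The action of `GL₃(F)` on lattices: `g Λ = {g v : v ∈ Λ}`. -/
instance : MulAction (GL (Fin 3) F) (Lat F) where
  smul g Λ := ⟨Λ.1.map (glMap g), by
    have := Λ.2
    refine ⟨this.fg.map _, ?_⟩
    have h := this.span_eq_top
    rw [Submodule.map_coe]
    have e : (glMap g : (Fin 3 → F) → (Fin 3 → F)) = Matrix.toLin' g.1 := rfl
    rw [e, ← Submodule.map_span, h, Submodule.map_top, LinearMap.range_eq_top]
    intro v
    refine ⟨Matrix.toLin' (g⁻¹ : GL (Fin 3) F).1 v, ?_⟩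
    rw [← LinearMap.comp_apply, ← Matrix.toLin'_mul, g.mul_inv]; simp⟩
  one_smul Λ := Subtype.ext (by
    change Λ.1.map (glMap 1) = _
    rw [glMap_one, Submodule.map_id])
  mul_smul g h Λ := Subtype.ext (by
    change Λ.1.map (glMap (g * h)) = (Λ.1.map (glMap h)).map (glMap g)
    rw [glMap_mul, Submodule.map_comp])

lemma coe_gl_smul (g : GL (Fin 3) F) (Λ : Lat F) : (g • Λ).1 = Λ.1.map (glMap g) := rfl

lemma coe_scalar_smul (α : Fˣ) (Λ : Lat F) :
    (Matrix.GeneralLinearGroup.scalar (Fin 3) α • Λ).1 = α • Λ.1 := by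
  rw [coe_gl_smul]
  ext v
  change (∃ y ∈ Λ.1, glMap _ y = v) ↔ ∃ y ∈ Λ.1, α • y = v
  refine exists_congr fun w => and_congr_right fun _ => ?_
  have : glMap (Matrix.GeneralLinearGroup.scalar (Fin 3) α) w = α • w := by
    ext i
    simp [glMap, Units.smul_def]
  rw [this]

instance : MulAction (GL (Fin 3) F) (Vertex F) where
  smul g := Quotient.map' (fun Λ => g • Λ) (by
    rintro Λ Λ' ⟨α, h⟩
    refine ⟨α, ?_⟩
    have h' : Λ' = Matrix.GeneralLinearGroup.scalar (Fin 3) α • Λ :=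
      Subtype.ext (by rw [h, coe_scalar_smul])
    have hc : g * Matrix.GeneralLinearGroup.scalar (Fin 3) α =
        Matrix.GeneralLinearGroup.scalar (Fin 3) α * g :=
      (Matrix.GeneralLinearGroup.scalar_commute α g).symm
    rw [h', ← mul_smul, hc, mul_smul, coe_scalar_smul])
  one_smul x := Quotient.inductionOn x fun Λ => congrArg Lat.vertex (one_smul _ Λ)
  mul_smul g h x := Quotient.inductionOn x fun Λ => congrArg Lat.vertex (mul_smul g h Λ)

/-- The action of `PGL₃(F)` on the vertices: `g [Λ] = [g Λ]`. -/
instance : MulAction PGL(3, F) (Vertex F) :=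
  Matrix.ProjGenLinGroup.mulActionOfGL (by
    intro u x
    refine Quotient.inductionOn x fun Λ => Quotient.sound ⟨u⁻¹, ?_⟩
    rw [coe_scalar_smul]; simp)

lemma mk_smul_vertex (g : GL (Fin 3) F) (Λ : Lat F) :
    Matrix.ProjGenLinGroup.mk g • Λ.vertex = (g • Λ).vertex := rfl

/-- The lattice `𝒪 b₁ ⊕ 𝒪 b₂ ⊕ 𝒪 b₃` given by a basis of `F³`. -/
def spanLat (b : Module.Basis (Fin 3) F (Fin 3 → F)) : Lat F :=
  ⟨Submodule.span 𝒪[F] (Set.range b), Submodule.fg_span (Set.finite_range b), by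
    rw [Submodule.span_span_of_tower, b.span_eq]⟩

/-- The lattice `ϖ^{a₁} 𝒪 b₁ ⊕ ϖ^{a₂} 𝒪 b₂ ⊕ ϖ^{a₃} 𝒪 b₃`. For a fixed basis `b` the vertices
given by these lattices are the vertices of the apartment of `b`. -/
def frameLat (ϖ : Fˣ) (b : Module.Basis (Fin 3) F (Fin 3 → F)) (a : Fin 3 → ℤ) : Lat F :=
  spanLat (b.unitsSMul fun i => ϖ ^ a i)

/-- The standard lattice `L₀ = 𝒪 e₁ ⊕ 𝒪 e₂ ⊕ 𝒪 e₃`. -/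
def stdLat (F : Type*) [Field F] [ValuativeRel F] : Lat F := spanLat (Pi.basisFun F (Fin 3))

/-- The vertices `[L₀], [L₁], [L₂]`, where `L₁ = 𝒪 e₁ ⊕ 𝒪 e₂ ⊕ ϖ 𝒪 e₃` and
`L₂ = 𝒪 e₁ ⊕ ϖ 𝒪 e₂ ⊕ ϖ 𝒪 e₃`. -/
def typeVertex (ϖ : Fˣ) : Fin 3 → Vertex F :=
  ![(stdLat F).vertex,
    (frameLat ϖ (Pi.basisFun F (Fin 3)) ![0, 0, 1]).vertex,
    (frameLat ϖ (Pi.basisFun F (Fin 3)) ![0, 1, 1]).vertex]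

/-- The vertex `x` is of type `j` if it lies in the orbit of `[L_j]` under the image of
`SL₃(F)` in `PGL₃(F)`. -/
def HasType (ϖ : Fˣ) (x : Vertex F) (j : Fin 3) : Prop :=
  ∃ g ∈ (Matrix.SpecialLinearGroup.toPGL : SL(3, F) →* PGL(3, F)).range, x = g • typeVertex ϖ j

/-- Two vertices are joined by an edge if they are distinct and have representatives with
`ϖ Λ₁ ⊆ Λ₂ ⊆ Λ₁`. -/
def Adj (ϖ : Fˣ) (x y : Vertex F) : Prop :=
  x ≠ y ∧ ∃ Λ₁ Λ₂ : Lat F, Λ₁.vertex = x ∧ Λ₂.vertex = y ∧ ϖ • Λ₁.1 ≤ Λ₂.1 ∧ Λ₂.1 ≤ Λ₁.1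

/-- `(x, y)` is a positively oriented edge: if `x` has type `j`, then `y` has type `j + 1`
modulo `3`. -/
def PosEdge (ϖ : Fˣ) (x y : Vertex F) : Prop :=
  Adj ϖ x y ∧ ∃ j : Fin 3, HasType ϖ x j ∧ HasType ϖ y (j + 1)

/-- A rank-one geodesic, given by its sequence of vertices: a straight line in an apartment,
in the affine coordinates `a ∈ ℤ³` of the apartment, which runs along edges of the building. -/
def IsRankOneGeodesic (ϖ : Fˣ) (c : ℤ → Vertex F) : Prop :=
  (∃ (b : Module.Basis (Fin 3) F (Fin 3 → F)) (a d : Fin 3 → ℤ),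
    ∀ k : ℤ, c k = (frameLat ϖ b (a + k • d)).vertex) ∧
  ∀ k : ℤ, Adj ϖ (c k) (c (k + 1))

/-- A line segment of length `n`: a sequence `(x₀, …, x_n)` of consecutive vertices on a rank-one
geodesic. -/
def IsLineSegment (ϖ : Fˣ) {n : ℕ} (s : Fin (n + 1) → Vertex F) : Prop :=
  ∃ c : ℤ → Vertex F, IsRankOneGeodesic ϖ c ∧ ∃ m : ℤ, ∀ i, s i = c (m + (i : ℕ))

/-- The positively oriented line segments of length `n` in the building. -/
def PosSegment (ϖ : Fˣ) (n : ℕ) : Type _ :=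
  {s : Fin (n + 1) → Vertex F //
    IsLineSegment ϖ s ∧ ∀ i : Fin n, PosEdge ϖ (s i.castSucc) (s i.succ)}

/-- The starting point of a line segment. -/
def PosSegment.o {ϖ : Fˣ} {n : ℕ} (s : PosSegment ϖ n) : Vertex F := s.1 0

/-- The endpoint of a line segment. -/
def PosSegment.e {ϖ : Fˣ} {n : ℕ} (s : PosSegment ϖ n) : Vertex F := s.1 (Fin.last n)

/-- The vertices of `Γ \ X`. -/
abbrev QuotVertex (Γ : Subgroup PGL(3, F)) : Type _ := MulAction.orbitRel.Quotient Γ (Vertex F)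

/-- The projection from the vertices of `X` to those of `Γ \ X`. -/
def toQuot (Γ : Subgroup PGL(3, F)) (x : Vertex F) : QuotVertex Γ := Quotient.mk _ x

/-- Line segments in `X` have the same image in `Γ \ X` if they are translates of each other by
an element of `Γ`. -/
def segmentSetoid (Γ : Subgroup PGL(3, F)) (ϖ : Fˣ) (n : ℕ) : Setoid (PosSegment (F := F) ϖ n) where
  r s t := ∃ γ ∈ Γ, ∀ i, t.1 i = γ • s.1 i
  iseqv := ⟨fun s => ⟨1, Γ.one_mem, by simp⟩,
    fun ⟨γ, hγ, h⟩ => ⟨γ⁻¹, Γ.inv_mem hγ, by simp [h]⟩,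
    fun ⟨γ, hγ, h⟩ ⟨δ, hδ, h'⟩ => ⟨δ * γ, Γ.mul_mem hδ hγ, by simp [h, h', mul_smul]⟩⟩

/-- The positively oriented line segments of length `n` in `Γ \ X`: the images of those in `X`.
Here the image is taken as a path along edges of `Γ \ X`; its vertices need not determine it. -/
def QuotPosSegment (Γ : Subgroup PGL(3, F)) (ϖ : Fˣ) (n : ℕ) : Type _ :=
  Quotient (segmentSetoid Γ ϖ n)

/-- The starting point of a line segment in `Γ \ X`. -/
def QuotPosSegment.o {Γ : Subgroup PGL(3, F)} {ϖ : Fˣ} {n : ℕ} :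
    QuotPosSegment Γ ϖ n → QuotVertex Γ :=
  Quotient.lift (fun s => toQuot Γ s.o) (by
    rintro s t ⟨γ, hγ, h⟩
    exact Quotient.sound ⟨⟨γ⁻¹, inv_mem hγ⟩, by simp [PosSegment.o, h, Subgroup.smul_def]⟩)

/-- The endpoint of a line segment in `Γ \ X`. -/
def QuotPosSegment.e {Γ : Subgroup PGL(3, F)} {ϖ : Fˣ} {n : ℕ} :
    QuotPosSegment Γ ϖ n → QuotVertex Γ :=
  Quotient.lift (fun s => toQuot Γ s.e) (by
    rintro s t ⟨γ, hγ, h⟩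
    exact Quotient.sound ⟨⟨γ⁻¹, inv_mem hγ⟩, by simp [PosSegment.e, h, Subgroup.smul_def]⟩)

/-- The operator `A_n` on `C₀(X) = ⨁_x ℂ x`: it maps `x` to the sum of the endpoints `e(s)` of the
positively oriented line segments `s` of length `n` with starting point `x`. There are finitely many
of these, as every vertex has finitely many neighbours. -/
def lineOperator (ϖ : Fˣ) (n : ℕ) : Module.End ℂ (Vertex F →₀ ℂ) :=
  Finsupp.linearCombination ℂ fun x =>
    ∑ᶠ s : {s : PosSegment ϖ n // s.o = x}, Finsupp.single s.1.e 1

/-- The operator `A_n` on `C₀(Γ \ X) = ⨁_x ℂ x`: it maps a vertex `x` of `Γ \ X` to the (finite) sum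
of the endpoints of the positively oriented line segments of length `n` in `Γ \ X` with starting
point `x`. -/
def quotLineOperator (Γ : Subgroup PGL(3, F)) (ϖ : Fˣ) (n : ℕ) :
    Module.End ℂ (QuotVertex Γ →₀ ℂ) :=
  Finsupp.linearCombination ℂ fun x =>
    ∑ᶠ s : {s : QuotPosSegment Γ ϖ n // s.o = x}, Finsupp.single s.1.e 1

/-- The class in `PGL₃(F)` of a diagonal matrix. -/
def diagElt (d : Fin 3 → Fˣ) : PGL(3, F) :=
  Matrix.ProjGenLinGroup.mk
    ⟨Matrix.diagonal fun i => (d i : F), Matrix.diagonal fun i => ((d i)⁻¹ : F),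
      by simp, by simp⟩

end Building

section Stab
variable (F : Type*) [Field F] [ValuativeRel F]

/-- The group `K`: the image of `GL₃(𝒪)` in `PGL₃(F)`. -/
def maxCompact : Subgroup PGL(3, F) :=
  (Matrix.ProjGenLinGroup.mk.comp
    (Matrix.GeneralLinearGroup.map (n := Fin 3) (algebraMap 𝒪[F] F))).range
variable {F}

lemma mem_stdLat {v : Fin 3 → F} : v ∈ (stdLat F).1 ↔ ∀ i, v i ∈ 𝒪[F] := by
  have := (Pi.basisFun F (Fin 3)).mem_span_iff_repr_mem 𝒪[F] v
  refine this.trans (forall_congr' fun i => ?_)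
  simp only [Pi.basisFun_repr]
  exact ⟨fun ⟨x, hx⟩ => hx ▸ x.2, fun h => ⟨⟨_, h⟩, rfl⟩⟩

/-- `g` has integral entries if it maps `L₀` into itself. -/
lemma entry_mem {g : GL (Fin 3) F} (h : (g • stdLat F).1 ≤ (stdLat F).1) (i j : Fin 3) :
    g.1 i j ∈ 𝒪[F] := by
  have h1 : Pi.single j (1 : F) ∈ (stdLat F).1 := mem_stdLat.2 fun i => by
    by_cases hij : i = j
    · subst hij; simp [one_mem]
    · simp [hij, zero_mem]
  have h2 := mem_stdLat.1 (h (Submodule.mem_map_of_mem (f := glMap g) h1)) i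
  simpa [glMap] using h2

lemma smul_le_of_entries {g : GL (Fin 3) F} (h : ∀ i j, g.1 i j ∈ 𝒪[F]) :
    (g • stdLat F).1 ≤ (stdLat F).1 := by
  rintro _ ⟨v, hv, rfl⟩
  refine mem_stdLat.2 fun i => ?_
  have hv := mem_stdLat.1 hv
  change ∑ j, g.1 i j * v j ∈ 𝒪[F]
  exact sum_mem fun j _ => mul_mem (h i j) (hv j)

lemma exists_of_entries {g : GL (Fin 3) F} (h : ∀ i j, g.1 i j ∈ 𝒪[F])
    (h' : ∀ i j, (g⁻¹).1 i j ∈ 𝒪[F]) : Matrix.ProjGenLinGroup.mk g ∈ maxCompact F := by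
  refine ⟨⟨Matrix.of fun i j => ⟨g.1 i j, h i j⟩,
    Matrix.of fun i j => ⟨(g⁻¹ : GL (Fin 3) F).1 i j, h' i j⟩, ?_, ?_⟩, ?_⟩
  · ext i j
    have := congrArg (fun A : Matrix (Fin 3) (Fin 3) F => A i j) g.mul_inv
    simpa [Matrix.mul_apply, Matrix.one_apply, apply_ite] using this
  · ext i j
    have := congrArg (fun A : Matrix (Fin 3) (Fin 3) F => A i j) g.inv_mul
    simpa [Matrix.mul_apply, Matrix.one_apply, apply_ite] using this
  · change Matrix.ProjGenLinGroup.mk _ = Matrix.ProjGenLinGroup.mk _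
    congr 1

lemma smul_stdLat_vertex (g : PGL(3, F)) :
    g • (stdLat F).vertex = (stdLat F).vertex ↔ g ∈ maxCompact F := by
  constructor
  · induction g using Matrix.ProjGenLinGroup.induction_on with | mk g =>
    intro h
    rw [mk_smul_vertex] at h
    obtain ⟨α, hα⟩ := Quotient.exact h
    set g' := Matrix.GeneralLinearGroup.scalar (Fin 3) α * g with hg'
    have e : g' • stdLat F = stdLat F := Subtype.ext (by
      rw [mul_smul, coe_scalar_smul, ← hα])
    have e' : g'⁻¹ • stdLat F = stdLat F := by rw [inv_smul_eq_iff, e]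
    have := exists_of_entries (entry_mem (congrArg Subtype.val e).le)
      (entry_mem (congrArg Subtype.val e').le)
    rwa [hg', map_mul, Matrix.ProjGenLinGroup.mk_scalar, one_mul] at this
  · rintro ⟨k, rfl⟩
    set g := Matrix.GeneralLinearGroup.map (n := Fin 3) (algebraMap 𝒪[F] F) k with hg
    change Matrix.ProjGenLinGroup.mk g • _ = _
    rw [mk_smul_vertex]
    congr 1
    apply Subtype.ext
    have h1 : (g • stdLat F).1 ≤ (stdLat F).1 := smul_le_of_entries fun i j => (k.1 i j).2
    have h2 : (g⁻¹ • stdLat F).1 ≤ (stdLat F).1 := smul_le_of_entries fun i j => by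
      rw [hg, ← map_inv]
      exact ((k⁻¹).1 i j).2
    refine le_antisymm h1 ?_
    have := Submodule.map_mono (f := glMap g) h2
    rwa [← coe_gl_smul, ← coe_gl_smul, smul_inv_smul] at this

lemma exists_smul_stdLat [IsPrincipalIdealRing 𝒪[F]] (x : Vertex F) :
    ∃ g : PGL(3, F), g • (stdLat F).vertex = x := by
  refine Quotient.inductionOn x fun Λ => ?_
  have := Λ.2
  have hr : Module.finrank 𝒪[F] Λ.1 = 3 := by
    simpa using Submodule.IsLattice.finrank_of_pi F Λ.1
  have : Module.Free 𝒪[F] Λ.1 := Submodule.IsLattice.free F Λ.1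
  have : Module.Finite 𝒪[F] Λ.1 := Submodule.IsLattice.finite F Λ.1
  let b₀ : Module.Basis (Fin 3) 𝒪[F] Λ.1 := Module.finBasisOfFinrankEq _ _ hr
  let b := b₀.extendOfIsLattice F
  let e := (Pi.basisFun F (Fin 3)).equiv b (Equiv.refl _)
  let g : GL (Fin 3) F := Matrix.GeneralLinearGroup.toLin.symm
    (LinearMap.GeneralLinearGroup.ofLinearEquiv e)
  refine ⟨Matrix.ProjGenLinGroup.mk g, ?_⟩
  rw [mk_smul_vertex]
  refine congrArg Lat.vertex (Subtype.ext ?_)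
  have hg : ∀ v, glMap g v = e v := by
    intro v
    have : Matrix.GeneralLinearGroup.toLin g = LinearMap.GeneralLinearGroup.ofLinearEquiv e :=
      MulEquiv.apply_symm_apply _ _
    exact congrArg (fun f : LinearMap.GeneralLinearGroup F (Fin 3 → F) => f.1 v) this
  rw [coe_gl_smul]
  change Submodule.map _ (Submodule.span _ _) = _
  rw [Submodule.map_span, ← Set.range_comp]
  have h3 : (glMap g ∘ Pi.basisFun F (Fin 3) : Fin 3 → (Fin 3 → F)) = fun i => (b₀ i).1 := by
    funext i
    rw [Function.comp_apply, hg]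
    simp only [e, Module.Basis.equiv_apply, Equiv.refl_apply, b, Module.Basis.extendOfIsLattice_apply]
  rw [h3]
  have := congrArg (Submodule.map Λ.1.subtype) b₀.span_eq
  rw [Submodule.map_span, ← Set.range_comp, Submodule.map_top, Submodule.range_subtype] at this
  exact this

end Stab
/-- The quotient topology on `PGL_n(R)`, which makes it a topological group. -/
instance projGenLinTopology (n R : Type*) [Fintype n] [DecidableEq n] [CommRing R]
    [TopologicalSpace R] : TopologicalSpace PGL(n, R) :=
  inferInstanceAs (TopologicalSpace (GL n R ⧸ Subgroup.center (GL n R)))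

instance projGenLinTopologicalGroup (n R : Type*) [Fintype n] [DecidableEq n] [CommRing R]
    [TopologicalSpace R] [IsTopologicalRing R] : IsTopologicalGroup PGL(n, R) :=
  inferInstanceAs (IsTopologicalGroup (GL n R ⧸ Subgroup.center (GL n R)))

/-- The Borel `σ`-algebra on `PGL_n(R)`. -/
instance projGenLinMeasurable (n R : Type*) [Fintype n] [DecidableEq n] [CommRing R]
    [TopologicalSpace R] : MeasurableSpace PGL(n, R) := borel _

instance projGenLinBorel (n R : Type*) [Fintype n] [DecidableEq n] [CommRing R]
    [TopologicalSpace R] : BorelSpace PGL(n, R) := ⟨rfl⟩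

section Hecke

variable (F : Type*) [Field F] [ValuativeRel F] [TopologicalSpace F] [IsNonarchimedeanLocalField F]

lemma isCompact_maxCompact : IsCompact (maxCompact F : Set PGL(3, F)) := by
  have h1 : Continuous (Matrix.GeneralLinearGroup.map (n := Fin 3) (algebraMap 𝒪[F] F)) :=
    Continuous.generalLinearGroup_map continuous_subtype_val
  have h2 : Continuous (Matrix.ProjGenLinGroup.mk : GL (Fin 3) F →* PGL(3, F)) :=
    QuotientGroup.continuous_mk
  have : CompactSpace (Matrix (Fin 3) (Fin 3) 𝒪[F]) :=
    inferInstanceAs (CompactSpace (Fin 3 → Fin 3 → 𝒪[F]))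
  have : T2Space F := by
    let := IsTopologicalAddGroup.rightUniformSpace F
    have := isUniformAddGroup_of_addCommGroup (G := F)
    infer_instance
  exact isCompact_range (h2.comp h1)

lemma isOpen_maxCompact : IsOpen (maxCompact F : Set PGL(3, F)) := by
  have hO : IsOpen {x : F | x ∈ 𝒪[F]} := by
    let := IsTopologicalAddGroup.rightUniformSpace F
    have := isUniformAddGroup_of_addCommGroup (G := F)
    exact Valued.isOpen_integer F
  have hU : IsOpen {g : GL (Fin 3) F | ∀ i j, (g : Matrix (Fin 3) (Fin 3) F) i j ∈ 𝒪[F] ∧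
      ((g⁻¹ : GL (Fin 3) F) : Matrix (Fin 3) (Fin 3) F) i j ∈ 𝒪[F]} := by
    simp only [Set.ofPred_forall, Set.ofPred_and]
    refine isOpen_iInter_of_finite fun i => isOpen_iInter_of_finite fun j => ?_
    refine IsOpen.inter (hO.preimage ?_) (hO.preimage ?_)
    · exact Units.continuous_val.matrix_elem i j
    · exact (Units.continuous_val.comp continuous_inv).matrix_elem i j
  have := QuotientGroup.isOpenMap_coe (N := Subgroup.center (GL (Fin 3) F)) _ hU
  have e : (maxCompact F : Set PGL(3, F)) = Matrix.ProjGenLinGroup.mk ''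
      {g : GL (Fin 3) F | ∀ i j, (g : Matrix (Fin 3) (Fin 3) F) i j ∈ 𝒪[F] ∧
        ((g⁻¹ : GL (Fin 3) F) : Matrix (Fin 3) (Fin 3) F) i j ∈ 𝒪[F]} := by
    ext x
    constructor
    · rintro ⟨g, rfl⟩
      refine ⟨Matrix.GeneralLinearGroup.map (algebraMap 𝒪[F] F) g,
        fun i j => ⟨(g.1 i j).2, ?_⟩, rfl⟩
      rw [← map_inv]
      exact ((g⁻¹ : GL (Fin 3) 𝒪[F]).1 i j).2
    · rintro ⟨g, hg, rfl⟩
      exact exists_of_entries (fun i j => (hg i j).1) fun i j => (hg i j).2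
  rw [e]
  exact this

/-- The Haar measure on `PGL₃(F)` that gives the maximal compact subgroup volume one. -/
def haarK : Measure PGL(3, F) :=
  Measure.haarMeasure
    { carrier := maxCompact F
      isCompact' := isCompact_maxCompact F
      interior_nonempty' := by
        rw [(isOpen_maxCompact F).interior_eq]; exact ⟨1, (maxCompact F).one_mem⟩ }

variable {F}

/-- The convolution `φ * f` of functions on `PGL₃(F)`. -/
def convolve (φ f : PGL(3, F) → ℂ) : PGL(3, F) → ℂ :=
  fun x => ∫ y, φ y * f (y⁻¹ * x) ∂(haarK F)

/-- The indicator function of the double coset `K a K`. -/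
def doubleCosetFun (a : PGL(3, F)) : PGL(3, F) → ℂ :=
  Set.indicator (DoubleCoset.doubleCoset a (maxCompact F) (maxCompact F)) 1

lemma isLocallyConstant_of_right_inv {Y : Type*} (f : PGL(3, F) → Y)
    (hf : ∀ g, ∀ k ∈ maxCompact F, f (g * k) = f g) : IsLocallyConstant f := by
  rw [IsLocallyConstant.iff_exists_open]
  intro x
  refine ⟨x • (maxCompact F : Set PGL(3, F)), (isOpen_maxCompact F).smul x,
    ⟨1, (maxCompact F).one_mem, by simp⟩, ?_⟩
  rintro _ ⟨k, hk, rfl⟩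
  exact hf x k hk

lemma isCompact_doubleCoset (a : PGL(3, F)) :
    IsCompact (DoubleCoset.doubleCoset a (maxCompact F) (maxCompact F)) :=
  ((isCompact_maxCompact F).mul isCompact_singleton).mul (isCompact_maxCompact F)

set_option linter.unusedSectionVars false in
lemma doubleCosetFun_mul_left (a g : PGL(3, F)) {k} (hk : k ∈ maxCompact F) :
    doubleCosetFun a (k * g) = doubleCosetFun a g := by
  have : k * g ∈ DoubleCoset.doubleCoset a (maxCompact F) (maxCompact F : Set PGL(3, F)) ↔
      g ∈ DoubleCoset.doubleCoset a (maxCompact F) (maxCompact F : Set PGL(3, F)) := by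
    simp only [DoubleCoset.mem_doubleCoset]
    constructor
    · rintro ⟨x, hx, y, hy, h⟩
      exact ⟨k⁻¹ * x, mul_mem (inv_mem hk) hx, y, hy, by
        rw [mul_assoc, mul_assoc, ← mul_assoc x, ← h]; group⟩
    · rintro ⟨x, hx, y, hy, rfl⟩
      exact ⟨k * x, mul_mem hk hx, y, hy, by group⟩
  by_cases h : g ∈ DoubleCoset.doubleCoset a (maxCompact F) (maxCompact F : Set PGL(3, F)) <;>
  simp [doubleCosetFun, h, this]

section Convolution

variable {V : Type*} {p : PGL(3, F) → V}

lemma integrable_convolve (hp : ∀ g, ∀ k ∈ maxCompact F, p (g * k) = p g) (a x : PGL(3, F))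
    (v : V → ℂ) :
    Integrable (fun y => v (p y) * doubleCosetFun a (y⁻¹ * x)) (haarK F) := by
  have : IsFiniteMeasureOnCompacts (haarK F) := by unfold haarK; infer_instance
  apply Continuous.integrable_of_hasCompactSupport
  · apply IsLocallyConstant.continuous
    apply isLocallyConstant_of_right_inv
    intro g k hk
    rw [hp g k hk, mul_inv_rev, mul_assoc, doubleCosetFun_mul_left a _ (inv_mem hk)]
  · apply HasCompactSupport.of_support_subset_isCompact
      ((isCompact_doubleCoset a).inv.smul x)
    intro y hy
    have h2 : doubleCosetFun a (y⁻¹ * x) ≠ 0 := right_ne_zero_of_mul hy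
    have := Set.mem_of_indicator_ne_zero h2
    rw [Set.mem_smul_set_iff_inv_smul_mem]
    simpa using this

lemma finite_support_convolve {Γ : Subgroup PGL(3, F)} (hs : Function.Surjective p)
    (hp : ∀ g g', p g = p g' ↔ ∃ γ ∈ Γ, ∃ k ∈ maxCompact F, g = γ * g' * k) (a : PGL(3, F))
    (v : V →₀ ℂ) :
    {y : V | convolve (v ∘ p) (doubleCosetFun a) (Function.surjInv hs y) ≠ 0}.Finite := by
  have hpK : ∀ g, ∀ k ∈ maxCompact F, p (g * k) = p g := fun g k hk =>
    (hp _ _).2 ⟨1, one_mem _, k, hk, by simp⟩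
  have hfin : ∀ w : V, (p '' (Function.surjInv hs w •
      DoubleCoset.doubleCoset a (maxCompact F) (maxCompact F))).Finite := by
    intro w
    let _ : TopologicalSpace V := ⊥
    have : DiscreteTopology V := ⟨rfl⟩
    exact (((isCompact_doubleCoset a).smul _).image
      (isLocallyConstant_of_right_inv p hpK).continuous).finite_of_discrete
  refine (v.hasFiniteSupport.biUnion fun w _ => hfin w).subset ?_
  intro y hy
  obtain ⟨z, hz⟩ : ∃ z, (v ∘ p) z * doubleCosetFun a (z⁻¹ * Function.surjInv hs y) ≠ 0 := by
    by_contra! h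
    exact hy (by simp only [convolve, h, integral_zero])
  have h1 : v (p z) ≠ 0 := left_ne_zero_of_mul hz
  have h2 := Set.mem_of_indicator_ne_zero (right_ne_zero_of_mul hz)
  obtain ⟨γ, hγ, k, hk, hzk⟩ := (hp z (Function.surjInv hs (p z))).1
    (Function.surjInv_eq hs (p z)).symm
  obtain ⟨k₁, hk₁, k₂, hk₂, h3⟩ := DoubleCoset.mem_doubleCoset.1 h2
  refine Set.mem_biUnion (x := p z) h1 ?_
  refine ⟨Function.surjInv hs (p z) * (k * k₁ * a * k₂), ?_, ?_⟩
  · exact Set.smul_mem_smul_set (DoubleCoset.mem_doubleCoset.2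
      ⟨k * k₁, mul_mem hk hk₁, k₂, hk₂, rfl⟩)
  · rw [← Function.surjInv_eq hs y]
    symm
    refine (hp _ _).2 ⟨γ, hγ, 1, one_mem _, ?_⟩
    have : Function.surjInv hs y = z * (k₁ * a * k₂) := by
      rw [← h3]; group
    rw [this]
    nth_rewrite 1 [hzk]
    group

/-- Let `p` identify `Γ \ PGL₃(F) / K` with `V`, so that the finitely supported functions on `V`
are the functions `φ` on `Γ \ PGL₃(F) / K` with finite support. This is the operator
`φ ↦ φ * 1_{K a K}` on them. -/
def heckeOperator {Γ : Subgroup PGL(3, F)} (hs : Function.Surjective p)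
    (hp : ∀ g g', p g = p g' ↔ ∃ γ ∈ Γ, ∃ k ∈ maxCompact F, g = γ * g' * k) (a : PGL(3, F)) :
    Module.End ℂ (V →₀ ℂ) where
  toFun v := Finsupp.ofSupportFinite
    (fun y => convolve (v ∘ p) (doubleCosetFun a) (Function.surjInv hs y))
    (finite_support_convolve hs hp a v)
  map_add' v w := by
    have hpK : ∀ g, ∀ k ∈ maxCompact F, p (g * k) = p g := fun g k hk =>
      (hp _ _).2 ⟨1, one_mem _, k, hk, by simp⟩
    ext y
    simp only [Finsupp.ofSupportFinite_coe, convolve, Finsupp.coe_add, Function.comp_apply,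
      Pi.add_apply, add_mul]
    exact integral_add (integrable_convolve hpK a _ v) (integrable_convolve hpK a _ w)
  map_smul' c v := by
    ext y
    simp only [Finsupp.ofSupportFinite_coe, convolve, Finsupp.coe_smul, Function.comp_apply,
      Pi.smul_apply, smul_eq_mul, mul_assoc, RingHom.id_apply]
    exact integral_const_mul _ _

/-- The value of the operator at `p g` is the value of the convolution at `g`. -/
lemma heckeOperator_apply {Γ : Subgroup PGL(3, F)} (hs : Function.Surjective p)
    (hp : ∀ g g', p g = p g' ↔ ∃ γ ∈ Γ, ∃ k ∈ maxCompact F, g = γ * g' * k) (a : PGL(3, F))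
    (v : V →₀ ℂ) (g : PGL(3, F)) :
    heckeOperator hs hp a v (p g) = convolve (v ∘ p) (doubleCosetFun a) g := by
  have hinv : (haarK F).IsMulLeftInvariant := by unfold haarK; infer_instance
  obtain ⟨γ, hγ, k, hk, h⟩ := (hp (Function.surjInv hs (p g)) g).1 (Function.surjInv_eq hs (p g))
  have hK : ∀ x, doubleCosetFun a (x * k) = doubleCosetFun a x := by
    intro x
    have : x * k ∈ DoubleCoset.doubleCoset a (maxCompact F) (maxCompact F : Set PGL(3, F)) ↔
        x ∈ DoubleCoset.doubleCoset a (maxCompact F) (maxCompact F : Set PGL(3, F)) := by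
      simp only [DoubleCoset.mem_doubleCoset]
      constructor
      · rintro ⟨u, hu, y, hy, h⟩
        exact ⟨u, hu, y * k⁻¹, mul_mem hy (inv_mem hk), by rw [← mul_assoc, ← h]; group⟩
      · rintro ⟨u, hu, y, hy, rfl⟩
        exact ⟨u, hu, y * k, mul_mem hy hk, by group⟩
    by_cases h : x ∈ DoubleCoset.doubleCoset a (maxCompact F) (maxCompact F : Set PGL(3, F)) <;>
    simp [doubleCosetFun, h, this]
  change convolve (v ∘ p) (doubleCosetFun a) (Function.surjInv hs (p g)) = _
  rw [h]
  simp only [convolve]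
  rw [← integral_mul_left_eq_self _ γ]
  congr 1
  ext y
  have e1 : p (γ * y) = p y := (hp _ _).2 ⟨γ, hγ, 1, one_mem _, by simp⟩
  have e2 : (γ * y)⁻¹ * (γ * g * k) = y⁻¹ * g * k := by group
  simp only [Function.comp_apply, e1, e2, hK]

end Convolution

section Operators

/-- The Hecke operator of `K a K` on `C₀(X)`, where `X₀ = PGL₃(F) / K` through `g K ↦ g [L₀]`. -/
def heckeX (a : PGL(3, F)) : Module.End ℂ (Vertex F →₀ ℂ) :=
  heckeOperator (Γ := ⊥) (p := fun g : PGL(3, F) => g • (stdLat F).vertex) exists_smul_stdLat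
    (by
      intro g g'
      rw [← inv_smul_eq_iff, ← mul_smul, smul_stdLat_vertex]
      constructor
      · intro h
        exact ⟨1, one_mem _, g'⁻¹ * g, h, by group⟩
      · rintro ⟨γ, hγ, k, hk, rfl⟩
        rw [Subgroup.mem_bot] at hγ
        subst hγ
        simpa using hk) a

/-- The Hecke operator of `K a K` on `C₀(Γ \ X)`, where `Γ \ X₀ = Γ \ PGL₃(F) / K` through
`Γ g K ↦ Γ g [L₀]`. -/
def heckeQuot (Γ : Subgroup PGL(3, F)) (a : PGL(3, F)) : Module.End ℂ (QuotVertex Γ →₀ ℂ) :=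
  heckeOperator (Γ := Γ) (p := fun g : PGL(3, F) => toQuot Γ (g • (stdLat F).vertex))
    (by
      intro x
      obtain ⟨y, rfl⟩ := Quotient.exists_rep x
      obtain ⟨g, rfl⟩ := exists_smul_stdLat y
      exact ⟨g, rfl⟩)
    (by
      intro g g'
      constructor
      · intro h
        obtain ⟨⟨γ, hγ⟩, h⟩ := Quotient.exact h
        have h : γ • g' • (stdLat F).vertex = g • (stdLat F).vertex := h
        rw [eq_comm, ← mul_smul, ← inv_smul_eq_iff, ← mul_smul, smul_stdLat_vertex] at h
        exact ⟨γ, hγ, _, h, by group⟩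
      · rintro ⟨γ, hγ, k, hk, rfl⟩
        refine Quotient.sound ⟨⟨γ, hγ⟩, ?_⟩
        change γ • g' • (stdLat F).vertex = _
        rw [mul_smul (γ * g') k, (smul_stdLat_vertex k).2 hk, mul_smul]) a

end Operators

end Hecke

end PGLThree

end

/-! The relations already hold for lattices, before passing to homothety classes. On the free space
on lattices let T_n send L to the sum of the P ⊆ L with L/P ≅ 𝒪/ϖⁿ, let E do the same for (𝒪/ϖ)²,
H_m for 𝒪/ϖ^(m+1) ⊕ 𝒪/ϖ, and let S send L to ϖL (`cyclicOp`, `planeOp`, `hookOp`, `scaleOp`). The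
coefficient of P in a product applied to L is the number of intermediate lattices of prescribed
type, which is a count of lines or planes over the residue field. The counts `ncard_cyclicStep`,
`ncard_planeStep` and `ncard_stepPlane` say that

T_(m+1) T_1 = T_(m+2) + q H_m, with q + 1 instead of q if m = 0; T_(m+1) E = H_(m+1) + q² T_m S,
with q² + q + 1 instead of q² if m = 0; E T_1 = H_1 + (q² + q + 1) S.

For m > 0 the requirement that L'/P be cyclic excludes the L' inside one sublattice of index q
(`exists_hyperplane`), which is why the constants drop. The last two lines show that E and T_1
commute, and eliminating the H_m gives the asserted formulas with S in the constant terms.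

On classes S becomes the identity, and homothetic sublattices of equal index in L coincide
(`eq_of_vertex_eq`), so no multiplicity is lost. Since K is the stabilizer of [L₀] and has volume
one, convolution with 1_{KaK} is a finite sum over vertices in relative position a
(`convolve_eq_sum`), so T_1 and E induce π₁ and π₂. A positively oriented segment from [L] moves
along one vector of a frame of L and is determined by its endpoint (`exists_posSegment_bijective`),
so T_n induces A_n.

A discrete torsion-free Γ acts freely on vertices, because their stabilizers are compact. Hence
segments lift uniquely to a given starting point, and the Hecke operators of Γ\X are induced by
those of X (`quotPosSegment_bijective`, `heckeQuot_lmapDomain`). `relations_of_intertwining`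
transports the relations to both spaces. -/

namespace PGLThree

/-! ### Lattices in a common frame, and elementary divisors. -/

section Frames

variable {F : Type*} [Field F] [ValuativeRel F]

/-- `ϖ` generates the maximal ideal of `𝒪`. -/
def IsUniformizer (ϖ : Fˣ) : Prop :=
  ∃ h : (ϖ : F) ∈ 𝒪[F], 𝓂[F] = Ideal.span {(⟨(ϖ : F), h⟩ : 𝒪[F])}

lemma mem_integer_or_inv_mem (x : F) : x ∈ 𝒪[F] ∨ x⁻¹ ∈ 𝒪[F] := by
  rcases le_total (valuation F x) 1 with h | h
  · exact Or.inl h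
  · refine Or.inr ?_
    change valuation F x⁻¹ ≤ 1
    rw [map_inv₀]
    exact inv_le_one_of_one_le₀ h

lemma mem_spanLat {b : Module.Basis (Fin 3) F (Fin 3 → F)} {v : Fin 3 → F} :
    v ∈ (spanLat b).1 ↔ ∀ i, b.repr v i ∈ 𝒪[F] := by
  have := b.mem_span_iff_repr_mem 𝒪[F] v
  refine this.trans (forall_congr' fun i => ?_)
  exact ⟨fun ⟨x, hx⟩ => hx ▸ x.2, fun h => ⟨⟨_, h⟩, rfl⟩⟩

lemma mem_frameLat {ϖ : Fˣ} {b : Module.Basis (Fin 3) F (Fin 3 → F)} {a : Fin 3 → ℤ}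
    {v : Fin 3 → F} :
    v ∈ (frameLat ϖ b a).1 ↔ ∀ i, ((ϖ ^ (-a i) : Fˣ) : F) * b.repr v i ∈ 𝒪[F] := by
  rw [frameLat, mem_spanLat]
  refine forall_congr' fun i => ?_
  rw [Module.Basis.repr_unitsSMul, Units.smul_def, smul_eq_mul, zpow_neg]

lemma frameLat_zero (ϖ : Fˣ) (b : Module.Basis (Fin 3) F (Fin 3 → F)) :
    frameLat ϖ b 0 = spanLat b := by
  apply Subtype.ext; ext v
  simp [mem_frameLat, mem_spanLat]

lemma mem_units_smul {α : Fˣ} {L : Submodule 𝒪[F] (Fin 3 → F)} {v : Fin 3 → F} :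
    v ∈ α • L ↔ α⁻¹ • v ∈ L := by
  change (∃ y ∈ L, α • y = v) ↔ _
  constructor
  · rintro ⟨w, hw, rfl⟩; simpa using hw
  · intro h; exact ⟨_, h, by simp⟩

lemma units_smul_le_iff {α : Fˣ} {L L' : Submodule 𝒪[F] (Fin 3 → F)} :
    α • L ≤ L' ↔ ∀ v ∈ L, α • v ∈ L' := by
  constructor
  · intro h v hv; exact h (by rw [mem_units_smul]; simpa using hv)
  · intro h v hv
    rw [mem_units_smul] at hv
    simpa using h _ hv

lemma units_smul_le_smul_iff {α : Fˣ} {L L' : Submodule 𝒪[F] (Fin 3 → F)} :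
    α • L ≤ α • L' ↔ L ≤ L' := by
  rw [units_smul_le_iff]
  refine forall₂_congr fun v _ => ?_
  rw [mem_units_smul, inv_smul_smul]

lemma zpow_smul_frameLat (ϖ : Fˣ) (b : Module.Basis (Fin 3) F (Fin 3 → F)) (a : Fin 3 → ℤ)
    (k : ℤ) : ϖ ^ k • (frameLat ϖ b a).1 = (frameLat ϖ b (fun i => a i + k)).1 := by
  ext v
  rw [mem_units_smul, mem_frameLat, mem_frameLat]
  refine forall_congr' fun i => ?_
  rw [Units.smul_def, map_smul, Finsupp.smul_apply, smul_eq_mul, ← mul_assoc, ← Units.val_mul,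
    ← zpow_neg, ← zpow_add, neg_add]

lemma smul_frameLat (ϖ : Fˣ) (b : Module.Basis (Fin 3) F (Fin 3 → F)) (a : Fin 3 → ℤ) :
    ϖ • (frameLat ϖ b a).1 = (frameLat ϖ b (fun i => a i + 1)).1 := by
  simpa using zpow_smul_frameLat ϖ b a 1

lemma frameLat_unitsSMul (ϖ : Fˣ) (b : Module.Basis (Fin 3) F (Fin 3 → F)) (a a' : Fin 3 → ℤ) :
    frameLat ϖ (b.unitsSMul fun i => ϖ ^ a i) a' = frameLat ϖ b (a + a') := by
  apply Subtype.ext; ext v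
  rw [mem_frameLat, mem_frameLat]
  refine forall_congr' fun i => ?_
  rw [Module.Basis.repr_unitsSMul, Units.smul_def, smul_eq_mul, ← mul_assoc, ← Units.val_mul,
    ← zpow_neg, ← zpow_add, Pi.add_apply, neg_add_rev]

lemma spanLat_unitsSMul_const (b : Module.Basis (Fin 3) F (Fin 3 → F)) (α : Fˣ) :
    (spanLat (b.unitsSMul fun _ => α)).1 = α • (spanLat b).1 := by
  ext v
  rw [mem_units_smul, mem_spanLat, mem_spanLat]
  refine forall_congr' fun i => ?_
  rw [Module.Basis.repr_unitsSMul, Units.smul_def (α⁻¹) v, map_smul, Finsupp.smul_apply,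
    Units.smul_def]

lemma frameLat_unitsSMul_const (ϖ : Fˣ) (b : Module.Basis (Fin 3) F (Fin 3 → F)) (α : Fˣ)
    (a : Fin 3 → ℤ) :
    (frameLat ϖ (b.unitsSMul fun _ => α) a).1 = α • (frameLat ϖ b a).1 := by
  ext v
  rw [mem_units_smul, mem_frameLat, mem_frameLat]
  refine forall_congr' fun i => ?_
  rw [Module.Basis.repr_unitsSMul, Units.smul_def (α⁻¹) v, map_smul, Finsupp.smul_apply,
    Units.smul_def]

lemma frameLat_reindex (ϖ : Fˣ) (b : Module.Basis (Fin 3) F (Fin 3 → F)) (e : Fin 3 ≃ Fin 3)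
    (a : Fin 3 → ℤ) : frameLat ϖ (b.reindex e) a = frameLat ϖ b (a ∘ e) := by
  apply Subtype.ext; ext v
  rw [mem_frameLat, mem_frameLat]
  rw [← e.forall_congr_right]
  simp [Module.Basis.repr_reindex]


lemma IsUniformizer.mem {ϖ : Fˣ} (hϖ : IsUniformizer ϖ) : (ϖ : F) ∈ 𝒪[F] := hϖ.1

lemma IsUniformizer.inv_notMem {ϖ : Fˣ} (hϖ : IsUniformizer ϖ) :
    ((ϖ⁻¹ : Fˣ) : F) ∉ 𝒪[F] := by
  obtain ⟨h, hm⟩ := hϖ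
  intro h'
  have h1 : (⟨(ϖ : F), h⟩ : 𝒪[F]) ∈ 𝓂[F] := by rw [hm]; exact Ideal.mem_span_singleton_self _
  rw [IsLocalRing.mem_maximalIdeal, mem_nonunits_iff] at h1
  exact h1 (IsUnit.of_mul_eq_one ⟨_, h'⟩ (Subtype.ext (by simp)))

lemma IsUniformizer.zpow_mem_iff {ϖ : Fˣ} (hϖ : IsUniformizer ϖ) {t : ℤ} :
    ((ϖ ^ t : Fˣ) : F) ∈ 𝒪[F] ↔ 0 ≤ t := by
  constructor
  · intro h
    by_contra! ht
    apply hϖ.inv_notMem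
    -- Multiplying by `ϖ ^ n` raises a negative exponent to exactly `-1`, which is excluded.
    obtain ⟨n, rfl⟩ : ∃ n : ℕ, t = -1 - n := ⟨(-1 - t).toNat, by lia⟩
    have := mul_mem (pow_mem hϖ.mem n) h
    rwa [← Units.val_pow_eq_pow_val, ← Units.val_mul, ← zpow_natCast, ← zpow_add,
      show (n : ℤ) + (-1 - n) = -1 by lia, zpow_neg_one] at this
  · intro h
    obtain ⟨n, rfl⟩ := Int.eq_ofNat_of_zero_le h
    simpa using pow_mem hϖ.mem n

lemma frameLat_le_iff {ϖ : Fˣ} (hϖ : IsUniformizer ϖ) (b : Module.Basis (Fin 3) F (Fin 3 → F))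
    {a a' : Fin 3 → ℤ} : (frameLat ϖ b a).1 ≤ (frameLat ϖ b a').1 ↔ ∀ i, a' i ≤ a i := by
  constructor
  · intro h i
    have h1 : ((ϖ ^ a i : Fˣ) : F) • b i ∈ (frameLat ϖ b a).1 := by
      rw [mem_frameLat]
      intro j
      rw [map_smul, b.repr_self, Finsupp.smul_apply, smul_eq_mul, Finsupp.single_apply]
      split_ifs with hij
      · subst hij
        rw [mul_one, ← Units.val_mul, ← zpow_add, neg_add_cancel]
        simp [one_mem]
      · simp [zero_mem]
    have h2 := mem_frameLat.1 (h h1) i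
    rw [map_smul, b.repr_self, Finsupp.smul_apply, smul_eq_mul, Finsupp.single_eq_same, mul_one,
      ← Units.val_mul, ← zpow_add, hϖ.zpow_mem_iff] at h2
    lia
  · intro h v hv
    rw [mem_frameLat] at hv ⊢
    intro i
    have := mul_mem (hϖ.zpow_mem_iff.2 (sub_nonneg.2 (h i))) (hv i)
    rwa [← mul_assoc, ← Units.val_mul, ← zpow_add,
      show a i - a' i + -a i = -a' i by ring] at this

/-- In each coordinate the smaller exponent gives the larger module, so each component of a vector
can be assigned to one of the two summands. -/
lemma frameLat_sup {ϖ : Fˣ} (hϖ : IsUniformizer ϖ) (b : Module.Basis (Fin 3) F (Fin 3 → F))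
    (a a' : Fin 3 → ℤ) :
    (frameLat ϖ b a).1 ⊔ (frameLat ϖ b a').1 = (frameLat ϖ b (fun i => min (a i) (a' i))).1 := by
  apply le_antisymm
  · exact sup_le ((frameLat_le_iff hϖ b).2 fun i => min_le_left _ _)
      ((frameLat_le_iff hϖ b).2 fun i => min_le_right _ _)
  · intro v hv
    rw [mem_frameLat] at hv
    rw [← b.sum_repr v]
    refine sum_mem fun i _ => ?_
    rcases le_total (a i) (a' i) with h | h
    · refine Submodule.mem_sup_left (mem_frameLat.2 fun j => ?_)
      rw [map_smul, b.repr_self, Finsupp.smul_apply, smul_eq_mul, Finsupp.single_apply]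
      split_ifs with hij
      · subst hij
        simpa [min_eq_left h] using hv i
      · simp [zero_mem]
    · refine Submodule.mem_sup_right (mem_frameLat.2 fun j => ?_)
      rw [map_smul, b.repr_self, Finsupp.smul_apply, smul_eq_mul, Finsupp.single_apply]
      split_ifs with hij
      · subst hij
        simpa [min_eq_right h] using hv i
      · simp [zero_mem]

lemma unit_smul_eq {u : Fˣ} (hu : (u : F) ∈ 𝒪[F]) (hu' : ((u⁻¹ : Fˣ) : F) ∈ 𝒪[F])
    (L : Submodule 𝒪[F] (Fin 3 → F)) : u • L = L := by
  apply le_antisymm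
  · rw [units_smul_le_iff]
    intro v hv
    exact L.smul_mem (⟨u, hu⟩ : 𝒪[F]) hv
  · intro v hv
    rw [mem_units_smul]
    exact L.smul_mem (⟨_, hu'⟩ : 𝒪[F]) hv

lemma eq_spanLat_extendOfIsLattice (L : Lat F) [Submodule.IsLattice F L.1]
    (b : Module.Basis (Fin 3) 𝒪[F] L.1) : L = spanLat (b.extendOfIsLattice F) := by
  apply Subtype.ext
  have := congrArg (Submodule.map L.1.subtype) b.span_eq
  rw [Submodule.map_span, ← Set.range_comp, Submodule.map_top, Submodule.range_subtype] at this
  refine this.symm.trans ?_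
  change _ = Submodule.span _ _
  congr 2
  ext i : 1
  simp

variable [IsDiscreteValuationRing 𝒪[F]]

lemma IsUniformizer.irreducible {ϖ : Fˣ} (hϖ : IsUniformizer ϖ) :
    Irreducible (⟨(ϖ : F), hϖ.mem⟩ : 𝒪[F]) :=
  (IsDiscreteValuationRing.irreducible_iff_uniformizer _).2 hϖ.2

lemma IsUniformizer.exists_of_mem {ϖ : Fˣ} (hϖ : IsUniformizer ϖ) {x : F} (hx : x ∈ 𝒪[F])
    (h0 : x ≠ 0) : ∃ (n : ℕ) (u : Fˣ), (u : F) ∈ 𝒪[F] ∧ ((u⁻¹ : Fˣ) : F) ∈ 𝒪[F] ∧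
      x = u * (ϖ : F) ^ n := by
  obtain ⟨n, u, h⟩ := IsDiscreteValuationRing.eq_unit_mul_pow_irreducible (x := (⟨x, hx⟩ : 𝒪[F]))
    (fun h => h0 (congrArg Subtype.val h)) hϖ.irreducible
  refine ⟨n, Units.map (algebraMap 𝒪[F] F).toMonoidHom u, u.1.2, ?_, congrArg Subtype.val h⟩
  rw [← map_inv]
  exact (u⁻¹).1.2

lemma IsUniformizer.exists_unit_mul_zpow {ϖ : Fˣ} (hϖ : IsUniformizer ϖ) (α : Fˣ) :
    ∃ (t : ℤ) (u : Fˣ), (u : F) ∈ 𝒪[F] ∧ ((u⁻¹ : Fˣ) : F) ∈ 𝒪[F] ∧ α = u * ϖ ^ t := by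
  rcases mem_integer_or_inv_mem (α : F) with h | h
  · obtain ⟨n, u, hu, hu', e⟩ := hϖ.exists_of_mem h α.ne_zero
    exact ⟨n, u, hu, hu', Units.ext (by simpa using e)⟩
  · obtain ⟨n, u, hu, hu', e⟩ := hϖ.exists_of_mem h (inv_ne_zero α.ne_zero)
    refine ⟨-n, u⁻¹, hu', by simpa using hu, Units.ext ?_⟩
    rw [← inv_inv (α : F), e]
    simp [mul_comm]

/-- Every homothety acts on submodules as a power of `ϖ`. -/
lemma IsUniformizer.exists_zpow_smul {ϖ : Fˣ} (hϖ : IsUniformizer ϖ) (α : Fˣ) :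
    ∃ t : ℤ, ∀ L : Submodule 𝒪[F] (Fin 3 → F), α • L = ϖ ^ t • L := by
  obtain ⟨t, u, hu, hu', rfl⟩ := hϖ.exists_unit_mul_zpow α
  exact ⟨t, fun L => by rw [mul_smul, unit_smul_eq hu hu']⟩

lemma exists_eq_spanLat (L : Lat F) : ∃ b, L = spanLat b := by
  have := L.2
  have hr : Module.finrank 𝒪[F] L.1 = 3 := by
    simpa using Submodule.IsLattice.finrank_of_pi F L.1
  have : Module.Free 𝒪[F] L.1 := Submodule.IsLattice.free F L.1
  have : Module.Finite 𝒪[F] L.1 := Submodule.IsLattice.finite F L.1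
  exact ⟨_, eq_spanLat_extendOfIsLattice L (Module.finBasisOfFinrankEq _ _ hr)⟩

/-- Elementary divisors: two lattices `P ⊆ L` have a common frame. -/
lemma exists_frame_of_le {ϖ : Fˣ} (hϖ : IsUniformizer ϖ) {L P : Lat F} (h : P.1 ≤ L.1) :
    ∃ (b : Module.Basis (Fin 3) F (Fin 3 → F)) (m : Fin 3 → ℕ),
      L = spanLat b ∧ P = frameLat ϖ b (fun i => m i) := by
  have := L.2
  have := P.2
  have hr : Module.finrank 𝒪[F] L.1 = 3 := by
    simpa using Submodule.IsLattice.finrank_of_pi F L.1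
  have hr' : Module.finrank 𝒪[F] P.1 = 3 := by
    simpa using Submodule.IsLattice.finrank_of_pi F P.1
  have : Module.Free 𝒪[F] L.1 := Submodule.IsLattice.free F L.1
  have : Module.Finite 𝒪[F] L.1 := Submodule.IsLattice.finite F L.1
  let b₀ : Module.Basis (Fin 3) 𝒪[F] L.1 := Module.finBasisOfFinrankEq _ _ hr
  -- Full rank guarantees that the Smith normal form has three nonzero invariants.
  have hP : Module.finrank 𝒪[F] (P.1.submoduleOf L.1) = Module.finrank 𝒪[F] L.1 := by
    exact ((Submodule.submoduleOfEquivOfLe h).finrank_eq.trans hr').trans hr.symm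
  obtain ⟨b', a, c, hc⟩ := Submodule.exists_smith_normal_form_of_rank_eq b₀ hP
  have ha : ∀ i, (a i : F) ≠ 0 := by
    intro i h0
    have : a i = 0 := Subtype.ext h0
    apply c.ne_zero i
    apply Subtype.ext
    rw [hc, this, zero_smul]; rfl
  -- Only the powers of `ϖ` matter: the unit factors of the invariants do not change the span.
  choose m u hu hu' e using fun i => hϖ.exists_of_mem (a i).2 (ha i)
  refine ⟨b'.extendOfIsLattice F, m, eq_spanLat_extendOfIsLattice L b', ?_⟩
  apply Subtype.ext
  have hP' : P.1 = Submodule.span 𝒪[F] (Set.range fun i => (a i : F) • b'.extendOfIsLattice F i) := by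
    have := congrArg (Submodule.map (L.1.subtype ∘ₗ (P.1.submoduleOf L.1).subtype)) c.span_eq
    rw [Submodule.map_span, ← Set.range_comp, Submodule.map_comp, Submodule.map_top,
      Submodule.range_subtype] at this
    have hm : (P.1.submoduleOf L.1).map L.1.subtype = P.1 :=
      (Submodule.map_comap_subtype _ _).trans (inf_eq_right.2 h)
    refine (this.trans hm).symm.trans ?_
    congr 2
    ext i : 1
    simp [hc]
    rfl
  have hP'' : P = spanLat ((b'.extendOfIsLattice F).unitsSMul fun i => u i * ϖ ^ m i) := by
    apply Subtype.ext
    rw [hP']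
    change _ = Submodule.span _ _
    congr 2
    ext i : 1
    rw [Module.Basis.unitsSMul_apply, e, Units.smul_def]
    simp
  rw [hP'']
  ext v
  rw [mem_spanLat, mem_frameLat]
  refine forall_congr' fun i => ?_
  rw [Module.Basis.repr_unitsSMul, mul_inv, mul_smul, Units.smul_def, Units.smul_def, smul_eq_mul,
    smul_eq_mul, zpow_neg, zpow_natCast]
  constructor
  · intro h
    simpa using mul_mem (hu i) h
  · intro h
    exact mul_mem (hu' i) h

end Frames

/-! ### Indices of lattices. -/

section Index

variable {F : Type*} [Field F] [ValuativeRel F]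

/-- The index of `P ∩ L` in `L`, as additive groups. -/
noncomputable def idx (P L : Submodule 𝒪[F] (Fin 3 → F)) : ℕ :=
  P.toAddSubgroup.relIndex L.toAddSubgroup

lemma idx_mul_idx {P L M : Submodule 𝒪[F] (Fin 3 → F)} (h : P ≤ L) (h' : L ≤ M) :
    idx P L * idx L M = idx P M :=
  AddSubgroup.relIndex_mul_relIndex _ _ _ (Submodule.toAddSubgroup_le _ _ |>.2 h)
    (Submodule.toAddSubgroup_le _ _ |>.2 h')

lemma idx_eq_one_iff {P L : Submodule 𝒪[F] (Fin 3 → F)} : idx P L = 1 ↔ L ≤ P :=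
  AddSubgroup.relIndex_eq_one.trans (Submodule.toAddSubgroup_le _ _)

lemma idx_self (P : Submodule 𝒪[F] (Fin 3 → F)) : idx P P = 1 := idx_eq_one_iff.2 le_rfl

lemma idx_sup_right (P L : Submodule 𝒪[F] (Fin 3 → F)) : idx P (P ⊔ L) = idx P L := by
  unfold idx
  rw [Submodule.sup_toAddSubgroup, AddSubgroup.relIndex_sup_left]

lemma idx_inf_right (P L : Submodule 𝒪[F] (Fin 3 → F)) : idx (P ⊓ L) L = idx P L := by
  have h : (P ⊓ L).toAddSubgroup = P.toAddSubgroup ⊓ L.toAddSubgroup := rfl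
  unfold idx
  rw [h, AddSubgroup.inf_relIndex_right]

lemma idx_units_smul (α : Fˣ) (P L : Submodule 𝒪[F] (Fin 3 → F)) :
    idx (α • P) (α • L) = idx P L := by
  let f : (Fin 3 → F) →+ (Fin 3 → F) := DistribSMul.toAddMonoidHom (Fin 3 → F) α
  have hf : Function.Injective f := MulAction.injective α
  have h : ∀ M : Submodule 𝒪[F] (Fin 3 → F), (α • M).toAddSubgroup =
      M.toAddSubgroup.map f := by
    intro M; ext v; exact Iff.rfl
  change AddSubgroup.relIndex _ _ = AddSubgroup.relIndex _ _
  rw [h P, h L]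
  exact AddSubgroup.relIndex_map_map_of_injective _ _ hf

lemma idx_dvd_of_le {P P' L : Submodule 𝒪[F] (Fin 3 → F)} (h : P ≤ P') : idx P' L ∣ idx P L :=
  AddSubgroup.relIndex_dvd_of_le_left _ (Submodule.toAddSubgroup_le _ _ |>.2 h)

/-- Comparable submodules with the same finite index in a third one are equal. -/
lemma eq_of_idx_eq {P L M : Submodule 𝒪[F] (Fin 3 → F)} (h : P ≤ L) (h' : L ≤ M)
    (e : idx P M = idx L M) (h0 : idx P M ≠ 0) : P = L := by
  have := idx_mul_idx h h'
  rw [e] at this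
  have h1 : idx P L = 1 := by
    rw [e] at h0
    exact Nat.eq_of_mul_eq_mul_right (Nat.pos_of_ne_zero h0) (by rw [this, one_mul])
  exact le_antisymm h (idx_eq_one_iff.1 h1)

lemma eq_of_idx_eq' {P L M : Submodule 𝒪[F] (Fin 3 → F)} (h : P ≤ L) (h' : L ≤ M)
    (e : idx P L = idx P M) (h0 : idx P M ≠ 0) : L = M := by
  have := idx_mul_idx h h'
  rw [← e] at this h0
  have h1 : idx L M = 1 :=
    Nat.eq_of_mul_eq_mul_left (Nat.pos_of_ne_zero h0) (by rw [this, mul_one])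
  exact le_antisymm h' (idx_eq_one_iff.1 h1)

lemma IsUniformizer.smul_le {ϖ : Fˣ} (hϖ : IsUniformizer ϖ) (L : Submodule 𝒪[F] (Fin 3 → F)) :
    ϖ • L ≤ L :=
  units_smul_le_iff.2 fun _ hv => L.smul_mem (⟨_, hϖ.mem⟩ : 𝒪[F]) hv

/-- There are finitely many submodules between `P` and `L` if the index is finite. -/
lemma finite_between {P L : Submodule 𝒪[F] (Fin 3 → F)} (h : idx P L ≠ 0) :
    {L' | P ≤ L' ∧ L' ≤ L}.Finite := by
  have : Finite (L ⧸ P.submoduleOf L) := Nat.finite_of_card_ne_zero h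
  have : Finite (Set (L ⧸ P.submoduleOf L)) := inferInstance
  refine Set.Finite.of_injOn (f := fun L' => ((L'.submoduleOf L).map (P.submoduleOf L).mkQ :
    Set (L ⧸ P.submoduleOf L))) (t := Set.univ) (fun _ _ => Set.mem_univ _) ?_ Set.finite_univ
  -- A submodule between `P` and `L` is recovered from its image in the finite set `L / P`.
  have key : ∀ A B : Submodule 𝒪[F] (Fin 3 → F), A ≤ L → P ≤ B →
      ((A.submoduleOf L).map (P.submoduleOf L).mkQ : Set (L ⧸ P.submoduleOf L)) =
      (B.submoduleOf L).map (P.submoduleOf L).mkQ → A ≤ B := by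
    intro A B hA hB e v hv
    have h1 : (P.submoduleOf L).mkQ ⟨v, hA hv⟩ ∈
        ((B.submoduleOf L).map (P.submoduleOf L).mkQ : Set (L ⧸ P.submoduleOf L)) := by
      rw [← e]; exact ⟨⟨v, hA hv⟩, hv, rfl⟩
    obtain ⟨w, hw, e'⟩ := h1
    have h4 : w.1 - v ∈ B := hB ((Submodule.Quotient.eq (P.submoduleOf L)).1 e')
    have h5 : w.1 ∈ B := hw
    simpa using sub_mem h5 h4
  intro A hA B hB e
  exact le_antisymm (key A B hA.2 hB.1 e) (key B A hB.2 hA.1 e.symm)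

variable [IsDiscreteValuationRing 𝒪[F]]

lemma card_quotient_maximalIdeal_pow (n : ℕ) :
    Nat.card (𝒪[F] ⧸ 𝓂[F] ^ n) = Nat.card 𝓀[F] ^ n := by
  have := cardQuot_pow_of_prime (P := 𝓂[F])
    (IsDiscreteValuationRing.not_a_field 𝒪[F]) (i := n)
  rw [Submodule.cardQuot_apply, Submodule.cardQuot_apply] at this
  exact this

lemma IsUniformizer.mem_maximalIdeal_pow {ϖ : Fˣ} (hϖ : IsUniformizer ϖ) (n : ℕ) (x : 𝒪[F]) :
    x ∈ 𝓂[F] ^ n ↔ ((ϖ ^ (-(n : ℤ)) : Fˣ) : F) * x ∈ 𝒪[F] := by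
  obtain ⟨h, hm⟩ := hϖ
  rw [hm, Ideal.span_singleton_pow, Ideal.mem_span_singleton]
  constructor
  · rintro ⟨y, rfl⟩
    have : ((ϖ ^ (-(n : ℤ)) : Fˣ) : F) * ((⟨(ϖ : F), h⟩ ^ n * y : 𝒪[F]) : F) = y := by
      simp
    rw [this]
    exact y.2
  · intro hy
    refine ⟨⟨_, hy⟩, Subtype.ext ?_⟩
    simp

/-- The coordinates in the frame map the big lattice onto the product of the `𝒪 / 𝔪 ^ m i`, and the
kernel is the small lattice. -/
lemma idx_frameLat_spanLat {ϖ : Fˣ} (hϖ : IsUniformizer ϖ)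
    (b : Module.Basis (Fin 3) F (Fin 3 → F)) (m : Fin 3 → ℕ) :
    idx (frameLat ϖ b fun i => m i).1 (spanLat b).1 = Nat.card 𝓀[F] ^ ∑ i, m i := by
  let f : (spanLat b).1.toAddSubgroup →+ ∀ i, 𝒪[F] ⧸ 𝓂[F] ^ m i :=
    { toFun := fun v i => Ideal.Quotient.mk _ ⟨b.repr v.1 i, mem_spanLat.1 v.2 i⟩
      map_zero' := by
        funext i
        rw [Pi.zero_apply, Ideal.Quotient.eq_zero_iff_mem]
        have : (⟨b.repr (0 : Fin 3 → F) i, by simp [zero_mem]⟩ : 𝒪[F]) = 0 := Subtype.ext (by simp)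
        exact this ▸ zero_mem _
      map_add' := by
        intro v w
        funext i
        rw [Pi.add_apply, ← map_add]
        congr 1
        exact Subtype.ext (by simp) }
  have hf : Function.Surjective f := by
    intro y
    choose x hx using fun i => Ideal.Quotient.mk_surjective (y i)
    have hr : ∀ i, b.repr (∑ i, (x i : F) • b i) i = x i := 
      fun i => by rw [b.repr_sum_self]
    refine ⟨⟨∑ i, (x i : F) • b i, mem_spanLat.2 fun i => by rw [hr]; exact (x i).2⟩, ?_⟩
    funext i
    rw [← hx i]
    change Ideal.Quotient.mk _ _ = _
    congr 1
    exact Subtype.ext (hr i)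
  have hk : f.ker = (frameLat ϖ b fun i => m i).1.toAddSubgroup.addSubgroupOf
      (spanLat b).1.toAddSubgroup := by
    ext v
    rw [AddMonoidHom.mem_ker, AddSubgroup.mem_addSubgroupOf, Submodule.mem_toAddSubgroup,
      mem_frameLat, funext_iff]
    refine forall_congr' fun i => ?_
    change Ideal.Quotient.mk _ _ = 0 ↔ _
    rw [Ideal.Quotient.eq_zero_iff_mem, hϖ.mem_maximalIdeal_pow]
  unfold idx AddSubgroup.relIndex
  rw [← hk, AddSubgroup.index_ker, AddMonoidHom.range_eq_top.2 hf,
    Nat.card_congr AddSubgroup.topEquiv.toEquiv, Nat.card_pi, ← Finset.prod_pow_eq_pow_sum]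
  exact Finset.prod_congr rfl fun i _ => card_quotient_maximalIdeal_pow _

lemma idx_frameLat {ϖ : Fˣ} (hϖ : IsUniformizer ϖ)
    (b : Module.Basis (Fin 3) F (Fin 3 → F)) (a : Fin 3 → ℤ) (m : Fin 3 → ℕ) :
    idx (frameLat ϖ b (a + fun i => (m i : ℤ))).1 (frameLat ϖ b a).1 =
      Nat.card 𝓀[F] ^ ∑ i, m i := by
  rw [← frameLat_unitsSMul]
  exact idx_frameLat_spanLat hϖ _ m

lemma exists_idx_eq_pow {ϖ : Fˣ} (hϖ : IsUniformizer ϖ) {P L : Lat F} (h : P.1 ≤ L.1) :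
    ∃ k : ℕ, idx P.1 L.1 = Nat.card 𝓀[F] ^ k := by
  obtain ⟨b, m, rfl, rfl⟩ := exists_frame_of_le hϖ h
  exact ⟨_, idx_frameLat_spanLat hϖ b m⟩

lemma idx_uniformizer_smul {ϖ : Fˣ} (hϖ : IsUniformizer ϖ) (L : Lat F) :
    idx (ϖ • L.1) L.1 = Nat.card 𝓀[F] ^ 3 := by
  obtain ⟨b, rfl⟩ := exists_eq_spanLat L
  rw [← frameLat_zero ϖ, smul_frameLat]
  simpa using idx_frameLat hϖ b 0 (fun _ => 1)

/-- A submodule between two lattices is a lattice. -/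
lemma isLattice_of_le_of_le {P M L : Submodule 𝒪[F] (Fin 3 → F)} (hP : Submodule.IsLattice F P)
    (hL : Submodule.IsLattice F L) (h : P ≤ M) (h' : M ≤ L) : Submodule.IsLattice F M :=
  Submodule.IsLattice.of_le_of_isLattice_of_fg F h
    (by
      have : Module.Finite 𝒪[F] L := Submodule.IsLattice.finite F L
      have : IsNoetherian 𝒪[F] L := inferInstance
      exact (isNoetherian_submodule.1 this) M h')

end Index

/-! ### Lines and planes over a finite field. -/

section Counting

variable {k W : Type*} [Field k] [Finite k] [AddCommGroup W] [Module k W]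

lemma ncard_finrank_one {d : ℕ} (h : Module.finrank k W = d) :
    {U : Submodule k W | Module.finrank k U = 1}.ncard = ∑ i ∈ Finset.range d, Nat.card k ^ i := by
  rw [← Projectivization.card_of_finrank k W h,
    Nat.card_congr (Projectivization.equivSubmodule k W)]
  rfl

/-- Annihilators match the planes of `W` with the lines of its dual. -/
lemma ncard_finrank_two [Module.Finite k W] (h : Module.finrank k W = 3) :
    {U : Submodule k W | Module.finrank k U = 2}.ncard = ∑ i ∈ Finset.range 3, Nat.card k ^ i := by
  have h' : Module.finrank k (Module.Dual k W) = 3 := by rw [Subspace.dual_finrank_eq, h]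
  rw [← ncard_finrank_one h']
  refine Set.ncard_congr (fun U _ => U.dualAnnihilator) ?_ ?_ ?_
  · intro U hU
    have := Subspace.finrank_add_finrank_dualAnnihilator_eq U
    simp only [Set.mem_ofPred_eq] at hU ⊢
    lia
  · intro U U' _ _ hU
    exact (Subspace.orderIsoFiniteDimensional (K := k) (V := W)).injective hU
  · intro U hU
    refine ⟨U.dualCoannihilator, ?_, ?_⟩
    · have := Subspace.finrank_add_finrank_dualCoannihilator_eq U
      simp only [Set.mem_ofPred_eq] at hU ⊢
      lia
    · exact Subspace.dualCoannihilator_dualAnnihilator_eq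

end Counting

/-! ### Lattices between `P` and `L` as subspaces of `L / P`. -/

section Intermediate

universe u
variable {F : Type u} [Field F] [ValuativeRel F] [IsDiscreteValuationRing 𝒪[F]] [Finite 𝓀[F]]

/-- Let `ϖ L ⊆ P ⊆ L`. The submodules between `P` and `L` are the subspaces of `L / P`. -/
lemma exists_vectorSpace {ϖ : Fˣ} (hϖ : IsUniformizer ϖ) {P L : Submodule 𝒪[F] (Fin 3 → F)}
    (hPL : P ≤ L) (h : ϖ • L ≤ P) {d : ℕ} (hd : idx P L = Nat.card 𝓀[F] ^ d) (r : ℕ) :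
    ∃ (W : Type u) (_ : AddCommGroup W) (_ : Module 𝓀[F] W), Module.Finite 𝓀[F] W ∧
      Module.finrank 𝓀[F] W = d ∧
      {L' | P ≤ L' ∧ L' ≤ L ∧ idx P L' = Nat.card 𝓀[F] ^ r}.ncard =
        {U : Submodule 𝓀[F] W | Module.finrank 𝓀[F] U = r}.ncard := by
  have hq : 1 < Nat.card 𝓀[F] := Finite.one_lt_card
  let P' := P.submoduleOf L
  -- Since `ϖ L ⊆ P`, the maximal ideal kills `L / P`, which makes the quotient a vector space over
  -- the residue field.
  have htors : Module.IsTorsionBySet 𝒪[F] (L ⧸ P') (𝓂[F] : Set 𝒪[F]) := by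
    intro x ⟨a, ha⟩
    obtain ⟨v, rfl⟩ := Submodule.Quotient.mk_surjective _ x
    obtain ⟨h0, hm⟩ := hϖ
    rw [SetLike.mem_coe, hm, Ideal.mem_span_singleton] at ha
    obtain ⟨c, rfl⟩ := ha
    rw [← Submodule.Quotient.mk_smul, Submodule.Quotient.mk_eq_zero]
    change ((⟨(ϖ : F), h0⟩ : 𝒪[F]) * c) • v.1 ∈ P
    rw [mul_smul]
    exact units_smul_le_iff.1 h _ (L.smul_mem c v.2)
  let inst : Module 𝓀[F] (L ⧸ P') := htors.module
  have tower : ∀ (a : 𝒪[F]) (w : L ⧸ P'), (IsLocalRing.residue 𝒪[F] a) • w = a • w :=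
    fun a w => let _ : Module (𝒪[F] ⧸ 𝓂[F]) (L ⧸ P') := inst; rfl
  have hcardW : Nat.card (L ⧸ P') = Nat.card 𝓀[F] ^ d := hd
  have : Finite (L ⧸ P') := Nat.finite_of_card_ne_zero (by rw [hcardW]; positivity)
  have hfin : Module.Finite 𝓀[F] (L ⧸ P') := Module.Finite.of_finite
  refine ⟨L ⧸ P', inferInstance, inst, hfin, ?_, ?_⟩
  · rw [Module.natCard_eq_pow_finrank (K := 𝓀[F])] at hcardW
    exact Nat.pow_right_injective hq hcardW
  let res : Submodule 𝓀[F] (L ⧸ P') → Submodule 𝒪[F] (L ⧸ P') := fun U =>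
    { U.toAddSubmonoid with
      smul_mem' := fun a w hw => by rw [← tower]; exact U.smul_mem _ hw }
  -- The bijection sends a subspace to its preimage in `L`; the index over `P` is then the
  -- cardinality of the subspace.
  let Φ : Submodule 𝓀[F] (L ⧸ P') → Submodule 𝒪[F] (Fin 3 → F) := fun U =>
    ((res U).comap P'.mkQ).map L.subtype
  have hΦ : ∀ U (v : Fin 3 → F), v ∈ Φ U ↔ ∃ hv : v ∈ L, P'.mkQ ⟨v, hv⟩ ∈ U := by
    intro U v
    constructor
    · rintro ⟨w, hw, rfl⟩; exact ⟨w.2, hw⟩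
    · rintro ⟨hv, hw⟩; exact ⟨⟨v, hv⟩, hw, rfl⟩
  have hidx : ∀ U, idx P (Φ U) = Nat.card 𝓀[F] ^ Module.finrank 𝓀[F] U := by
    intro U
    rw [← Module.natCard_eq_pow_finrank (K := 𝓀[F]) (V := U)]
    have e1 := AddSubgroup.relIndex_map_map_of_injective P'.toAddSubgroup
      ((res U).comap P'.mkQ).toAddSubgroup (f := L.subtype.toAddMonoidHom) L.injective_subtype
    have e2 : P'.toAddSubgroup.map L.subtype.toAddMonoidHom = P.toAddSubgroup := by
      ext v
      constructor
      · rintro ⟨w, hw, rfl⟩; exact hw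
      · intro hv; exact ⟨⟨v, hPL hv⟩, hv, rfl⟩
    rw [e2] at e1
    refine e1.trans ?_
    have e3 : P'.toAddSubgroup = P'.mkQ.toAddMonoidHom.ker := by
      ext v
      exact (Submodule.Quotient.mk_eq_zero P').symm
    rw [e3, AddSubgroup.relIndex_ker]
    refine Nat.card_congr (Equiv.subtypeEquivRight fun w => ?_)
    constructor
    · rintro ⟨v, hv, rfl⟩; exact hv
    · intro hw
      obtain ⟨v, rfl⟩ := P'.mkQ_surjective w
      exact ⟨v, hw, rfl⟩
  symm
  refine Set.ncard_congr (fun U _ => Φ U) ?_ ?_ ?_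
  · intro U hU
    refine ⟨fun v hv => (hΦ U v).2 ⟨hPL hv, ?_⟩, fun v hv => ((hΦ U v).1 hv).1, ?_⟩
    · have : P'.mkQ ⟨v, hPL hv⟩ = 0 := (Submodule.Quotient.mk_eq_zero P').2 hv
      rw [this]; exact U.zero_mem
    · rw [hidx, hU]
  · intro U U' _ _ hUU
    ext w
    obtain ⟨v, rfl⟩ := P'.mkQ_surjective w
    have h1 := hΦ U v
    have h2 := hΦ U' v
    rw [show Φ U = Φ U' from hUU, h2] at h1
    exact ⟨fun hw => (h1.2 ⟨v.2, hw⟩).2, fun hw => (h1.1 ⟨v.2, hw⟩).2⟩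
  · rintro L' ⟨h1, h2, h3⟩
    let U : Submodule 𝓀[F] (L ⧸ P') :=
      { ((L'.submoduleOf L).map P'.mkQ).toAddSubmonoid with
        smul_mem' := fun a w hw => by
          obtain ⟨a, rfl⟩ := IsLocalRing.residue_surjective a
          rw [tower]
          exact ((L'.submoduleOf L).map P'.mkQ).smul_mem a hw }
    have hU : Φ U = L' := by
      ext v
      rw [hΦ]
      constructor
      · rintro ⟨hv, w, hw, e⟩
        have := (Submodule.Quotient.eq P').1 e
        have h4 : w.1 - v ∈ L' := h1 this
        have h5 : w.1 ∈ L' := hw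
        simpa using sub_mem h5 h4
      · intro hv
        exact ⟨h2 hv, ⟨v, h2 hv⟩, hv, rfl⟩
    refine ⟨U, ?_, hU⟩
    have := hidx U
    rw [hU, h3] at this
    exact (Nat.pow_right_injective hq this).symm

lemma ncard_lines {ϖ : Fˣ} (hϖ : IsUniformizer ϖ) {P L : Submodule 𝒪[F] (Fin 3 → F)}
    (hPL : P ≤ L) (h : ϖ • L ≤ P) {d : ℕ} (hd : idx P L = Nat.card 𝓀[F] ^ d) :
    {L' | P ≤ L' ∧ L' ≤ L ∧ idx P L' = Nat.card 𝓀[F]}.ncard =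
      ∑ i ∈ Finset.range d, Nat.card 𝓀[F] ^ i := by
  obtain ⟨W, _, _, _, hW, e⟩ := exists_vectorSpace hϖ hPL h hd 1
  rw [pow_one] at e
  rw [e, ncard_finrank_one hW]

lemma ncard_planes {ϖ : Fˣ} (hϖ : IsUniformizer ϖ) {P L : Submodule 𝒪[F] (Fin 3 → F)}
    (hPL : P ≤ L) (h : ϖ • L ≤ P) (hd : idx P L = Nat.card 𝓀[F] ^ 3) :
    {L' | P ≤ L' ∧ L' ≤ L ∧ idx L' L = Nat.card 𝓀[F]}.ncard =
      ∑ i ∈ Finset.range 3, Nat.card 𝓀[F] ^ i := by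
  obtain ⟨W, _, _, _, hW, e⟩ := exists_vectorSpace hϖ hPL h hd 2
  rw [← ncard_finrank_two hW, ← e]
  congr 1
  ext L'
  refine and_congr_right fun h1 => and_congr_right fun h2 => ?_
  have hq : 0 < Nat.card 𝓀[F] := Nat.card_pos
  have := idx_mul_idx h1 h2
  rw [hd] at this
  constructor
  · intro h3
    rw [h3] at this
    exact Nat.eq_of_mul_eq_mul_right hq (by rw [this]; ring)
  · intro h3
    rw [h3] at this
    exact Nat.eq_of_mul_eq_mul_left (pow_pos hq 2) (by rw [this]; ring)

end Intermediate

/-! ### The isomorphism types of `L / P`. -/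

section Relative

variable {F : Type*} [Field F] [ValuativeRel F]

/-- The lattice `ϖ L`. -/
noncomputable def Lat.scale (ϖ : Fˣ) (L : Lat F) : Lat F := ⟨ϖ • L.1, have := L.2; inferInstance⟩

/-- The lattice `P + ϖ L`. -/
noncomputable def Lat.addScale (ϖ : Fˣ) (P L : Lat F) : Lat F :=
  ⟨P.1 ⊔ ϖ • L.1, have := L.2; have := P.2; inferInstance⟩

lemma Lat.coe_addScale (ϖ : Fˣ) (P L : Lat F) : (Lat.addScale ϖ P L).1 = P.1 ⊔ ϖ • L.1 := rfl

/-- `P ⊆ L`, and `L / P` is isomorphic to `𝒪 / ϖⁿ`. -/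
def CyclicIn (ϖ : Fˣ) (n : ℕ) (L P : Lat F) : Prop :=
  P.1 ≤ L.1 ∧ idx P.1 L.1 = Nat.card 𝓀[F] ^ n ∧
    idx (Lat.addScale ϖ P L).1 L.1 = Nat.card 𝓀[F] ^ min n 1

/-- `P ⊆ L`, and `L / P` is isomorphic to `(𝒪 / ϖ)²`. -/
def PlaneIn (ϖ : Fˣ) (L P : Lat F) : Prop :=
  ϖ • L.1 ≤ P.1 ∧ P.1 ≤ L.1 ∧ idx P.1 L.1 = Nat.card 𝓀[F] ^ 2

/-- `P ⊆ L`, and `L / P` is isomorphic to `𝒪 / ϖ ^ (m + 1) ⊕ 𝒪 / ϖ`. -/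
def HookIn (ϖ : Fˣ) (m : ℕ) (L P : Lat F) : Prop :=
  P.1 ≤ L.1 ∧ idx (Lat.addScale ϖ P L).1 L.1 = Nat.card 𝓀[F] ^ 2 ∧ CyclicIn ϖ m (Lat.addScale ϖ P L) P

/-- This turns a condition on `ϖ M` into containment of `M` in one fixed sublattice of `L`, so that
the solutions can be counted. -/
lemma le_inv_smul_inf_iff {ϖ : Fˣ} {A L M : Submodule 𝒪[F] (Fin 3 → F)} (h : M ≤ L) :
    M ≤ ϖ⁻¹ • A ⊓ L ↔ ϖ • M ≤ A := by
  rw [le_inf_iff, ← units_smul_le_smul_iff (α := ϖ), smul_inv_smul]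
  exact and_iff_left h

/-- Multiplication by `ϖ` identifies the quotient of `L` with `ϖ L / (A ∩ ϖ L)`, which is `(A + ϖ L)
/ A`. -/
lemma idx_inv_smul_inf (ϖ : Fˣ) (A L : Submodule 𝒪[F] (Fin 3 → F)) :
    idx (ϖ⁻¹ • A ⊓ L) L = idx A (A ⊔ ϖ • L) := by
  rw [idx_inf_right, idx_sup_right, ← idx_units_smul ϖ, smul_inv_smul]

/-- Truncating the exponents at 1 makes the index of `P + ϖ L` in `L` count the nonzero elementary
divisors, that is, the minimal number of generators of `L / P`. -/
lemma frameLat_sup_smul {ϖ : Fˣ} (hϖ : IsUniformizer ϖ) (b : Module.Basis (Fin 3) F (Fin 3 → F))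
    (m : Fin 3 → ℕ) : (frameLat ϖ b fun i => m i).1 ⊔ ϖ • (spanLat b).1 =
      (frameLat ϖ b fun i => (min (m i) 1 : ℕ)).1 := by
  rw [← frameLat_zero ϖ b, smul_frameLat, frameLat_sup hϖ]
  simp

lemma cyclicIn_zero_iff {ϖ : Fˣ} (hϖ : IsUniformizer ϖ) {L P : Lat F} :
    CyclicIn ϖ 0 L P ↔ P = L := by
  constructor
  · rintro ⟨h, h1, -⟩
    rw [pow_zero, idx_eq_one_iff] at h1
    exact Subtype.ext (le_antisymm h h1)
  · rintro rfl
    refine ⟨le_rfl, idx_self _, ?_⟩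
    rw [Lat.coe_addScale, sup_eq_left.2 (hϖ.smul_le _)]
    exact idx_self _

variable [IsDiscreteValuationRing 𝒪[F]] [Finite 𝓀[F]]

lemma one_lt_card_residue : 1 < Nat.card 𝓀[F] := Finite.one_lt_card

/-- The first index makes the exponents add up to `n`, and the second makes at most one of them
nonzero. A permutation of the frame moves that one to the last place. -/
lemma cyclicIn_iff {ϖ : Fˣ} (hϖ : IsUniformizer ϖ) {n : ℕ} {L P : Lat F} :
    CyclicIn ϖ n L P ↔ ∃ b, L = spanLat b ∧ P = frameLat ϖ b ![0, 0, n] := by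
  have hq := one_lt_card_residue (F := F)
  constructor
  · rintro ⟨h, h1, h2⟩
    obtain ⟨b, m, rfl, rfl⟩ := exists_frame_of_le hϖ h
    rw [idx_frameLat_spanLat hϖ] at h1
    rw [Lat.coe_addScale, frameLat_sup_smul hϖ, idx_frameLat_spanLat hϖ] at h2
    replace h1 := Nat.pow_right_injective hq h1
    replace h2 := Nat.pow_right_injective hq h2
    rw [Fin.sum_univ_three] at h1 h2
    obtain ⟨e, he⟩ : ∃ e : Fin 3 ≃ Fin 3, m = ![0, 0, n] ∘ e := by
      rcases Nat.eq_zero_or_pos (m 2) with h3 | h3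
      · rcases Nat.eq_zero_or_pos (m 1) with h4 | h4
        · refine ⟨Equiv.swap 0 2, ?_⟩
          funext i
          fin_cases i <;> simp [Equiv.swap_apply_def] <;> lia
        · refine ⟨Equiv.swap 1 2, ?_⟩
          funext i
          fin_cases i <;> simp [Equiv.swap_apply_def] <;> lia
      · refine ⟨Equiv.refl _, ?_⟩
        funext i
        fin_cases i <;> simp <;> lia
    refine ⟨b.reindex e, ?_, ?_⟩
    · rw [← frameLat_zero ϖ, ← frameLat_zero ϖ, frameLat_reindex]; rfl
    · rw [frameLat_reindex, he]
      congr 1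
      funext i
      simp only [Function.comp_apply]
      generalize e i = j
      fin_cases j <;> rfl
  · rintro ⟨b, rfl, rfl⟩
    have e : (![0, 0, (n : ℤ)] : Fin 3 → ℤ) = fun i => ((![0, 0, n] : Fin 3 → ℕ) i : ℤ) := by
      funext i; fin_cases i <;> rfl
    rw [e]
    refine ⟨?_, ?_, ?_⟩
    · rw [← frameLat_zero ϖ, frameLat_le_iff hϖ]
      intro i; simp
    · rw [idx_frameLat_spanLat hϖ, Fin.sum_univ_three]; simp
    · rw [Lat.coe_addScale, frameLat_sup_smul hϖ, idx_frameLat_spanLat hϖ, Fin.sum_univ_three]; simp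

/-- The inclusion of `ϖ L` bounds the exponents by 1, and their sum is 2; a permutation puts the
zero first. -/
lemma planeIn_iff {ϖ : Fˣ} (hϖ : IsUniformizer ϖ) {L P : Lat F} :
    PlaneIn ϖ L P ↔ ∃ b, L = spanLat b ∧ P = frameLat ϖ b ![0, 1, 1] := by
  have hq := one_lt_card_residue (F := F)
  constructor
  · rintro ⟨h, h1, h2⟩
    obtain ⟨b, m, rfl, rfl⟩ := exists_frame_of_le hϖ h1
    rw [idx_frameLat_spanLat hϖ] at h2
    replace h2 := Nat.pow_right_injective hq h2
    rw [← frameLat_zero ϖ, smul_frameLat, frameLat_le_iff hϖ] at h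
    simp only [Fin.sum_univ_three] at h2
    have h3 : ∀ i, m i ≤ 1 := fun i => by simpa using h i
    have h30 := h3 0
    have h31 := h3 1
    have h32 := h3 2
    obtain ⟨e, he⟩ : ∃ e : Fin 3 ≃ Fin 3, m = ![0, 1, 1] ∘ e := by
      rcases Nat.eq_zero_or_pos (m 0) with h4 | h4
      · refine ⟨Equiv.refl _, ?_⟩
        funext i
        fin_cases i <;> simp <;> lia
      · rcases Nat.eq_zero_or_pos (m 1) with h5 | h5
        · refine ⟨Equiv.swap 0 1, ?_⟩
          funext i
          fin_cases i <;> simp [Equiv.swap_apply_def] <;> lia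
        · refine ⟨Equiv.swap 0 2, ?_⟩
          funext i
          fin_cases i <;> simp [Equiv.swap_apply_def] <;> lia
    refine ⟨b.reindex e, ?_, ?_⟩
    · rw [← frameLat_zero ϖ, ← frameLat_zero ϖ, frameLat_reindex]; rfl
    · rw [frameLat_reindex, he]
      congr 1
      funext i
      simp only [Function.comp_apply]
      generalize e i = j
      fin_cases j <;> rfl
  · rintro ⟨b, rfl, rfl⟩
    have e : (![0, 1, 1] : Fin 3 → ℤ) = fun i => ((![0, 1, 1] : Fin 3 → ℕ) i : ℤ) := by
      funext i; fin_cases i <;> rfl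
    refine ⟨?_, ?_, ?_⟩
    · rw [← frameLat_zero ϖ, smul_frameLat, frameLat_le_iff hϖ]
      intro i; fin_cases i <;> simp
    · rw [← frameLat_zero ϖ, frameLat_le_iff hϖ]
      intro i; fin_cases i <;> simp
    · rw [e, idx_frameLat_spanLat hϖ, Fin.sum_univ_three]; simp

lemma cyclicIn_one_iff {ϖ : Fˣ} (hϖ : IsUniformizer ϖ) {L P : Lat F} :
    CyclicIn ϖ 1 L P ↔ P.1 ≤ L.1 ∧ ϖ • L.1 ≤ P.1 ∧ idx P.1 L.1 = Nat.card 𝓀[F] := by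
  have hq := one_lt_card_residue (F := F)
  constructor
  · rintro ⟨h, h1, h2⟩
    simp only [pow_one, min_self] at h1 h2
    refine ⟨h, ?_, h1⟩
    rw [← sup_eq_left]
    exact (eq_of_idx_eq le_sup_left (sup_le h (hϖ.smul_le _)) (h1.trans h2.symm) (by lia)).symm
  · rintro ⟨h, h1, h2⟩
    exact ⟨h, by simpa using h2, by simpa [Lat.coe_addScale, sup_eq_left.2 h1] using h2⟩

lemma cyclicIn_one_of_idx {ϖ : Fˣ} (hϖ : IsUniformizer ϖ) {L P : Lat F} (h : P.1 ≤ L.1)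
    (h1 : idx P.1 L.1 = Nat.card 𝓀[F]) : CyclicIn ϖ 1 L P := by
  have hq := one_lt_card_residue (F := F)
  obtain ⟨b, m, rfl, rfl⟩ := exists_frame_of_le hϖ h
  refine ⟨h, by simpa using h1, ?_⟩
  rw [Lat.coe_addScale, frameLat_sup_smul hϖ, idx_frameLat_spanLat hϖ]
  rw [idx_frameLat_spanLat hϖ] at h1
  have h2 : ∑ i, m i = 1 := Nat.pow_right_injective hq (by simpa using h1)
  congr 1
  rw [Fin.sum_univ_three] at h2 ⊢
  lia

/-- If `L / P` is cyclic, then so is `(P + ϖ L) / P`. -/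
lemma CyclicIn.addScale {ϖ : Fˣ} (hϖ : IsUniformizer ϖ) {n : ℕ} {L P : Lat F}
    (h : CyclicIn ϖ (n + 1) L P) : CyclicIn ϖ n (Lat.addScale ϖ P L) P := by
  obtain ⟨b, rfl, rfl⟩ := (cyclicIn_iff hϖ).1 h
  -- A frame of `P + ϖ L` arises by multiplying the third vector by `ϖ`, which uses up one of the `n
  -- + 1` steps.
  refine (cyclicIn_iff hϖ).2 ⟨b.unitsSMul fun i => ϖ ^ (![0, 0, 1] : Fin 3 → ℤ) i, ?_, ?_⟩
  · apply Subtype.ext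
    rw [← frameLat_zero ϖ (b.unitsSMul _), frameLat_unitsSMul]
    change _ ⊔ ϖ • (spanLat b).1 = _
    rw [← frameLat_zero ϖ b, smul_frameLat, frameLat_sup hϖ]
    congr 2
    funext i
    fin_cases i <;> simp
  · rw [frameLat_unitsSMul]
    congr 1
    funext i
    fin_cases i <;> simp [add_comm]

/-- The residue cardinality need not be prime, but lattice indices are powers of it, which excludes
proper divisors. -/
lemma idx_eq_one_or_of_dvd {ϖ : Fˣ} (hϖ : IsUniformizer ϖ) {L P : Lat F} (h : P.1 ≤ L.1)
    (hd : idx P.1 L.1 ∣ Nat.card 𝓀[F]) : idx P.1 L.1 = 1 ∨ idx P.1 L.1 = Nat.card 𝓀[F] := by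
  have hq := one_lt_card_residue (F := F)
  obtain ⟨k, hk⟩ := exists_idx_eq_pow hϖ h
  rw [hk] at hd ⊢
  have hk1 : k ≤ 1 := (Nat.pow_dvd_pow_iff_le_right hq).1 (by simpa using hd)
  interval_cases k <;> simp

/-- All these lattices lie between `ϖ ^ n L` and `L`. -/
lemma finite_cyclicIn {ϖ : Fˣ} (hϖ : IsUniformizer ϖ) (n : ℕ) (L : Lat F) :
    {P | CyclicIn ϖ n L P}.Finite := by
  have hq := one_lt_card_residue (F := F)
  obtain ⟨b, rfl⟩ := exists_eq_spanLat L
  have h0 : idx (ϖ ^ (n : ℤ) • (spanLat b).1) (spanLat b).1 ≠ 0 := by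
    rw [← frameLat_zero ϖ, zpow_smul_frameLat]
    have := idx_frameLat hϖ b 0 (fun _ => n)
    rw [show (fun i : Fin 3 => (0 : Fin 3 → ℤ) i + (n : ℤ)) = 0 + fun _ => (n : ℤ) from rfl, this]
    positivity
  refine Set.Finite.of_injOn (f := Subtype.val) ?_ Subtype.val_injective.injOn (finite_between h0)
  rintro P hP
  refine ⟨?_, hP.1⟩
  obtain ⟨b', h, rfl⟩ := (cyclicIn_iff hϖ).1 hP
  rw [h, ← frameLat_zero ϖ, zpow_smul_frameLat, frameLat_le_iff hϖ]
  intro i; fin_cases i <;> simp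

lemma finite_planeIn {ϖ : Fˣ} (hϖ : IsUniformizer ϖ) (L : Lat F) :
    {P | PlaneIn ϖ L P}.Finite := by
  have h0 : idx (ϖ • L.1) L.1 ≠ 0 := by
    have hq := one_lt_card_residue (F := F)
    rw [idx_uniformizer_smul hϖ]
    positivity
  refine Set.Finite.of_injOn (f := Subtype.val) ?_ Subtype.val_injective.injOn (finite_between h0)
  exact fun P hP => ⟨hP.1, hP.2.1⟩

end Relative

/-! ### Counting factorizations of `L ⊇ P` through a sublattice of index `q`. -/

section LatticeCounts

variable {F : Type*} [Field F] [ValuativeRel F]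

lemma ncard_lat_eq {s : Set (Submodule 𝒪[F] (Fin 3 → F))}
    (hs : ∀ M ∈ s, Submodule.IsLattice F M) : {L : Lat F | L.1 ∈ s}.ncard = s.ncard := by
  rw [← Set.ncard_image_of_injective _ Subtype.val_injective]
  congr 1
  ext M
  exact ⟨fun ⟨L, hL, e⟩ => e ▸ hL, fun hM => ⟨⟨M, hs M hM⟩, hM, rfl⟩⟩

lemma finite_lat_between {P L : Lat F} (h : idx P.1 L.1 ≠ 0) :
    {L' : Lat F | P.1 ≤ L'.1 ∧ L'.1 ≤ L.1}.Finite :=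
  Set.Finite.of_injOn (f := Subtype.val) (fun _ h => h) Subtype.val_injective.injOn
    (finite_between h)

lemma Lat.addScale_le {ϖ : Fˣ} (hϖ : IsUniformizer ϖ) {P L : Lat F} (h : P.1 ≤ L.1) :
    (Lat.addScale ϖ P L).1 ≤ L.1 := sup_le h (hϖ.smul_le _)

lemma Lat.addScale_mono {ϖ : Fˣ} {P L L' : Lat F} (h : L'.1 ≤ L.1) :
    (Lat.addScale ϖ P L').1 ≤ (Lat.addScale ϖ P L).1 :=
  sup_le_sup_left (units_smul_le_smul_iff.2 h) _

variable [IsDiscreteValuationRing 𝒪[F]] [Finite 𝓀[F]]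

lemma ncard_lat_lines {ϖ : Fˣ} (hϖ : IsUniformizer ϖ) {P L : Lat F}
    (hPL : P.1 ≤ L.1) (h : ϖ • L.1 ≤ P.1) {d : ℕ} (hd : idx P.1 L.1 = Nat.card 𝓀[F] ^ d) :
    {L' : Lat F | P.1 ≤ L'.1 ∧ L'.1 ≤ L.1 ∧ idx P.1 L'.1 = Nat.card 𝓀[F]}.ncard =
      ∑ i ∈ Finset.range d, Nat.card 𝓀[F] ^ i := by
  rw [← ncard_lines hϖ hPL h hd]
  exact ncard_lat_eq (s := {M | P.1 ≤ M ∧ M ≤ L.1 ∧ idx P.1 M = Nat.card 𝓀[F]})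
    fun M hM => isLattice_of_le_of_le P.2 L.2 hM.1 hM.2.1

lemma ncard_lat_planes {ϖ : Fˣ} (hϖ : IsUniformizer ϖ) {P L : Lat F}
    (hPL : P.1 ≤ L.1) (h : ϖ • L.1 ≤ P.1) (hd : idx P.1 L.1 = Nat.card 𝓀[F] ^ 3) :
    {L' : Lat F | P.1 ≤ L'.1 ∧ L'.1 ≤ L.1 ∧ idx L'.1 L.1 = Nat.card 𝓀[F]}.ncard =
      ∑ i ∈ Finset.range 3, Nat.card 𝓀[F] ^ i := by
  rw [← ncard_planes hϖ hPL h hd]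
  exact ncard_lat_eq (s := {M | P.1 ≤ M ∧ M ≤ L.1 ∧ idx M L.1 = Nat.card 𝓀[F]})
    fun M hM => isLattice_of_le_of_le P.2 L.2 hM.1 hM.2.1

/-- If `L' / P` is cyclic, then so is the quotient of `L'` by any lattice `M ⊇ P + ϖ L'`. -/
lemma CyclicIn.eq_or_idx_eq {ϖ : Fˣ} (hϖ : IsUniformizer ϖ) {m : ℕ} {L' P M : Lat F}
    (h : CyclicIn ϖ (m + 1) L' P) (h1 : (Lat.addScale ϖ P L').1 ≤ M.1) (h2 : M.1 ≤ L'.1) :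
    M = L' ∨ (M = Lat.addScale ϖ P L' ∧ idx M.1 L'.1 = Nat.card 𝓀[F]) := by
  have hq := one_lt_card_residue (F := F)
  have h3 : idx (Lat.addScale ϖ P L').1 L'.1 = Nat.card 𝓀[F] := by
    simpa using h.2.2
  rcases idx_eq_one_or_of_dvd hϖ h2 (h3 ▸ idx_dvd_of_le h1) with h4 | h4
  · exact Or.inl (Subtype.ext (le_antisymm h2 (idx_eq_one_iff.1 h4)))
  · exact Or.inr ⟨(Subtype.ext (eq_of_idx_eq h1 h2 (h3.trans h4.symm) (by lia))).symm, h4⟩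

/-- The set of `L'` with `L / L'` of length one and `L' / P` cyclic. -/
def cyclicStep (ϖ : Fˣ) (m : ℕ) (L P : Lat F) : Set (Lat F) :=
  {L' | CyclicIn ϖ 1 L L' ∧ CyclicIn ϖ (m + 1) L' P}

/-- The lattice `P + ϖ L` lies between `P + ϖ L'` and `L'`, and cyclicity of `L' / P` leaves only
the two ends. At the upper end `L / P` has one generator, at the lower end two. -/
lemma cyclicIn_or_hookIn {ϖ : Fˣ} (hϖ : IsUniformizer ϖ) {m : ℕ} {L L' P : Lat F}
    (h : L' ∈ cyclicStep ϖ m L P) :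
    (CyclicIn ϖ (m + 2) L P ∧ L' = Lat.addScale ϖ P L) ∨
      (HookIn ϖ m L P ∧ Lat.addScale ϖ P L' = Lat.addScale ϖ P L ∧
        idx (Lat.addScale ϖ P L).1 L'.1 = Nat.card 𝓀[F]) := by
  obtain ⟨h1, h2⟩ := h
  obtain ⟨h3, h4, h5⟩ := (cyclicIn_one_iff hϖ).1 h1
  rcases h2.eq_or_idx_eq hϖ (Lat.addScale_mono h3) (sup_le h2.1 h4) with e | ⟨e, e'⟩
  · refine Or.inl ⟨⟨h2.1.trans h3, ?_, ?_⟩, e.symm⟩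
    · rw [← idx_mul_idx h2.1 h3, h2.2.1, h5, ← pow_succ]
    · rw [e, h5]; simp
  · refine Or.inr ⟨⟨h2.1.trans h3, ?_, ?_⟩, e.symm, e'⟩
    · have h6 : (Lat.addScale ϖ P L).1 ≤ L'.1 := sup_le h2.1 h4
      rw [← idx_mul_idx h6 h3, h5, e', sq]
    · rw [e]; exact h2.addScale hϖ

/-- The number of generators of `L / P` differs: two against at most one. -/
lemma not_cyclicIn_of_hookIn {ϖ : Fˣ} {m k : ℕ} {L P : Lat F}
    (h : HookIn ϖ m L P) : ¬ CyclicIn ϖ k L P := by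
  have hq := one_lt_card_residue (F := F)
  intro h'
  have := Nat.pow_right_injective hq (h.2.1.symm.trans h'.2.2)
  lia

lemma cyclicStep_of_cyclicIn {ϖ : Fˣ} (hϖ : IsUniformizer ϖ) {m : ℕ} {L P : Lat F}
    (h : CyclicIn ϖ (m + 2) L P) : cyclicStep ϖ m L P = {Lat.addScale ϖ P L} := by
  apply Set.eq_singleton_iff_unique_mem.2
  refine ⟨⟨?_, h.addScale hϖ⟩, fun L' hL' => ?_⟩
  · refine cyclicIn_one_of_idx hϖ (Lat.addScale_le hϖ h.1) ?_
    simpa using h.2.2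
  · rcases cyclicIn_or_hookIn hϖ hL' with ⟨-, e⟩ | ⟨h', -⟩
    · exact e
    · exact absurd h (not_cyclicIn_of_hookIn h')

/-- With `M = P + ϖ L`, the candidates are the lines of the two-dimensional space `L / M`; the
second set expresses that `L' / P` stays cyclic. -/
lemma cyclicStep_of_hookIn {ϖ : Fˣ} (hϖ : IsUniformizer ϖ) {m : ℕ} {L P : Lat F}
    (h : HookIn ϖ m L P) : cyclicStep ϖ m L P =
      {L' | (Lat.addScale ϖ P L).1 ≤ L'.1 ∧ L'.1 ≤ L.1 ∧
        idx (Lat.addScale ϖ P L).1 L'.1 = Nat.card 𝓀[F]} ∩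
      {L' | Lat.addScale ϖ P L' = Lat.addScale ϖ P L} := by
  have hq := one_lt_card_residue (F := F)
  ext L'
  constructor
  · intro hL'
    rcases cyclicIn_or_hookIn hϖ hL' with ⟨h', -⟩ | ⟨-, e, e'⟩
    · exact absurd h' (not_cyclicIn_of_hookIn h)
    · refine ⟨⟨?_, hL'.1.1, e'⟩, e⟩
      rw [← e]
      exact Lat.addScale_le hϖ hL'.2.1
  · rintro ⟨⟨h1, h2, h3⟩, h4⟩
    have h5 : idx L'.1 L.1 = Nat.card 𝓀[F] := by
      have := idx_mul_idx h1 h2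
      rw [h3, h.2.1, sq] at this
      exact Nat.eq_of_mul_eq_mul_left (by lia) this
    refine ⟨cyclicIn_one_of_idx hϖ h2 h5, ⟨le_sup_left.trans h1, ?_, ?_⟩⟩
    · rw [← idx_mul_idx h.2.2.1 h1, h3, h.2.2.2.1, pow_succ]
    · rw [h4, h3]; simp

/-- If `M / P` is cyclic and nonzero and `M = P + ϖ L`, then the `L' ⊆ L` with `ϖ L' ⊆ P + ϖ M` are
those contained in one sublattice of `L` of index `q`. -/
lemma exists_hyperplane {ϖ : Fˣ} (hϖ : IsUniformizer ϖ) {m : ℕ} {L P M : Lat F}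
    (hM : CyclicIn ϖ (m + 1) M P) (e : P.1 ⊔ ϖ • L.1 = M.1) (hML : M.1 ≤ L.1) :
    ∃ H : Lat F, M.1 ≤ H.1 ∧ H.1 ≤ L.1 ∧ idx H.1 L.1 = Nat.card 𝓀[F] ∧
      ∀ L' : Lat F, M.1 ≤ L'.1 → L'.1 ≤ L.1 → (Lat.addScale ϖ P L' = M ↔ ¬ L'.1 ≤ H.1) := by
  -- The sublattice `H` consists of the `v ∈ L` with `ϖ v ∈ P + ϖ M`. Its index in `L` is that of `P
  -- + ϖ M` in `(P + ϖ M) + ϖ L = M`.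
  have hMH : M.1 ≤ ϖ⁻¹ • (Lat.addScale ϖ P M).1 ⊓ L.1 :=
    (le_inv_smul_inf_iff hML).2 le_sup_right
  refine ⟨⟨ϖ⁻¹ • (Lat.addScale ϖ P M).1 ⊓ L.1, isLattice_of_le_of_le M.2 L.2 hMH inf_le_right⟩,
    hMH, inf_le_right, ?_, ?_⟩
  · have e1 : (Lat.addScale ϖ P M).1 ⊔ ϖ • L.1 = M.1 := by
      change (P.1 ⊔ ϖ • M.1) ⊔ ϖ • L.1 = M.1
      rw [sup_right_comm, e, sup_eq_left]
      exact hϖ.smul_le _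
    refine (idx_inv_smul_inf ϖ _ _).trans ?_
    rw [e1]
    simpa using hM.2.2
  · intro L' h1 h2
    rw [le_inv_smul_inf_iff h2]
    have h3 : (Lat.addScale ϖ P M).1 ≤ (Lat.addScale ϖ P L').1 := Lat.addScale_mono h1
    have h4 : (Lat.addScale ϖ P L').1 ≤ M.1 := by
      rw [← e]
      exact sup_le_sup_left (units_smul_le_smul_iff.2 h2) _
    -- Here the length `m + 1` of `M / P` must be positive.
    have hne : Lat.addScale ϖ P M ≠ M := by
      intro h5
      have hq := one_lt_card_residue (F := F)
      have h6 := hM.2.2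
      rw [h5, idx_self, Nat.min_eq_right (by lia)] at h6
      lia
    constructor
    · intro h5 h6
      apply hne
      apply Subtype.ext
      refine le_antisymm (Lat.addScale_le hϖ hM.1) ?_
      rw [← h5] at h6 ⊢
      exact sup_le le_sup_left h6
    · intro h5
      -- Between `P + ϖ M` and `M` there is nothing else, and the lower end would put `L'` inside
      -- `H`.
      rcases hM.eq_or_idx_eq hϖ h3 h4 with h6 | ⟨h6, -⟩
      · exact h6
      · refine absurd ?_ h5
        rw [← h6]
        exact le_sup_right

open scoped Classical in
-- If `L / P` is cyclic, only `P + ϖ L` qualifies. In the hook case the plane `L / (P + ϖ L)` has `q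
-- + 1` lines; all of them qualify if `m = 0`, and all but one if `m > 0`.
lemma ncard_cyclicStep {ϖ : Fˣ} (hϖ : IsUniformizer ϖ) (m : ℕ) (L P : Lat F) :
    (cyclicStep ϖ m L P).ncard = (if CyclicIn ϖ (m + 2) L P then 1 else 0) +
      (if m = 0 then Nat.card 𝓀[F] + 1 else Nat.card 𝓀[F]) *
        (if HookIn ϖ m L P then 1 else 0) := by
  have hq := one_lt_card_residue (F := F)
  by_cases h1 : CyclicIn ϖ (m + 2) L P
  · rw [if_pos h1, if_neg fun h2 => not_cyclicIn_of_hookIn h2 h1, cyclicStep_of_cyclicIn hϖ h1]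
    simp
  by_cases h2 : HookIn ϖ m L P
  · rw [if_neg h1, if_pos h2, cyclicStep_of_hookIn hϖ h2, zero_add, mul_one]
    have hM : (Lat.addScale ϖ P L).1 ≤ L.1 := Lat.addScale_le hϖ h2.1
    have hcount := ncard_lat_lines hϖ hM le_sup_right h2.2.1
    rw [Finset.sum_range_succ, Finset.sum_range_one, pow_zero, pow_one] at hcount
    rcases m with _ | m
    · rw [if_pos rfl, Set.inter_eq_left.2, hcount, add_comm]
      rintro L' ⟨h3, h4, h5⟩
      -- For `m = 0` one has `P = P + ϖ L`, so the cyclicity condition is automatic.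
      have h6 := (cyclicIn_zero_iff hϖ).1 h2.2.2
      refine Subtype.ext (le_antisymm (Lat.addScale_mono h4) ?_)
      rw [← h6]
      exact le_sup_left
    · rw [if_neg (by lia)]
      obtain ⟨H, h3, h4, h5, h6⟩ := exists_hyperplane hϖ h2.2.2 rfl hM
      have hidx : ∀ L' : Lat F, (Lat.addScale ϖ P L).1 ≤ L'.1 → L'.1 ≤ L.1 →
          idx L'.1 L.1 = Nat.card 𝓀[F] → idx (Lat.addScale ϖ P L).1 L'.1 = Nat.card 𝓀[F] := by
        intro L' h7 h8 h9
        have := idx_mul_idx h7 h8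
        rw [h9, h2.2.1, sq] at this
        exact Nat.eq_of_mul_eq_mul_right (by lia) this
      have e : {L' : Lat F | (Lat.addScale ϖ P L).1 ≤ L'.1 ∧ L'.1 ≤ L.1 ∧
          idx (Lat.addScale ϖ P L).1 L'.1 = Nat.card 𝓀[F]} ∩
          {L' | Lat.addScale ϖ P L' = Lat.addScale ϖ P L} =
          {L' : Lat F | (Lat.addScale ϖ P L).1 ≤ L'.1 ∧ L'.1 ≤ L.1 ∧
            idx (Lat.addScale ϖ P L).1 L'.1 = Nat.card 𝓀[F]} \ {H} := by
        ext L'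
        refine and_congr_right fun ⟨h7, h8, h9⟩ => ?_
        -- Both `L'` and `H` have index `q` over `P + ϖ L`, so containment in `H` means equality.
        refine (h6 L' h7 h8).trans (not_congr ?_)
        constructor
        · intro h10
          exact Subtype.ext (eq_of_idx_eq' h7 h10
            (h9.trans (hidx H h3 h4 h5).symm) (by rw [hidx H h3 h4 h5]; lia))
        · rintro rfl; exact le_rfl
      have hH : H ∈ {L' : Lat F | (Lat.addScale ϖ P L).1 ≤ L'.1 ∧ L'.1 ≤ L.1 ∧
            idx (Lat.addScale ϖ P L).1 L'.1 = Nat.card 𝓀[F]} := ⟨h3, h4, hidx H h3 h4 h5⟩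
      rw [e, Set.ncard_sdiff_singleton_of_mem hH, hcount]
      lia
  · rw [if_neg h1, if_neg h2]
    have : cyclicStep ϖ m L P = ∅ := by
      ext L'
      simp only [Set.mem_empty_iff_false, iff_false]
      intro h3
      rcases cyclicIn_or_hookIn hϖ h3 with h | h
      · exact h1 h.1
      · exact h2 h.1
    rw [this]; simp

end LatticeCounts

/-! ### Counting factorizations that involve a quotient `(𝒪 / ϖ)²`. -/

section LatticeCounts

variable {F : Type*} [Field F] [ValuativeRel F]

/-- The set of `L'` with `L / L'` isomorphic to `(𝒪 / ϖ)²` and `L' / P` cyclic. -/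
def planeStep (ϖ : Fˣ) (m : ℕ) (L P : Lat F) : Set (Lat F) :=
  {L' | PlaneIn ϖ L L' ∧ CyclicIn ϖ (m + 1) L' P}

/-- The set of `L'` with `L / L'` of length one and `L' / P` isomorphic to `(𝒪 / ϖ)²`. -/
def stepPlane (ϖ : Fˣ) (L P : Lat F) : Set (Lat F) :=
  {L' | CyclicIn ϖ 1 L L' ∧ PlaneIn ϖ L' P}

lemma Lat.addScale_eq_scale {ϖ : Fˣ} {P L : Lat F} (h : P.1 ≤ (L.scale ϖ).1) :
    Lat.addScale ϖ P L = L.scale ϖ :=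
  Subtype.ext (sup_eq_right.2 h)

variable [IsDiscreteValuationRing 𝒪[F]]

lemma Lat.idx_scale {ϖ : Fˣ} (hϖ : IsUniformizer ϖ) (L : Lat F) :
    idx (L.scale ϖ).1 L.1 = Nat.card 𝓀[F] ^ 3 := idx_uniformizer_smul hϖ L

variable [Finite 𝓀[F]]

/-- Again `P + ϖ L` must be `L'` or `P + ϖ L'`. In the second case its index in `L` is `q ^ 3`, the
index of `ϖ L`, so `P ⊆ ϖ L` and one step of the cyclic chain is already used. -/
lemma hookIn_or_cyclicIn_scale {ϖ : Fˣ} (hϖ : IsUniformizer ϖ) {m : ℕ} {L L' P : Lat F}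
    (h : L' ∈ planeStep ϖ m L P) :
    (HookIn ϖ (m + 1) L P ∧ L' = Lat.addScale ϖ P L) ∨
      (CyclicIn ϖ m (L.scale ϖ) P ∧ Lat.addScale ϖ P L' = L.scale ϖ ∧
        idx (L.scale ϖ).1 L'.1 = Nat.card 𝓀[F]) := by
  have hq := one_lt_card_residue (F := F)
  obtain ⟨⟨h3, h4, h5⟩, h2⟩ := h
  have h6 : (Lat.addScale ϖ P L).1 ≤ L'.1 := sup_le h2.1 h3
  rcases h2.eq_or_idx_eq hϖ (Lat.addScale_mono h4) h6 with e | ⟨e, e'⟩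
  · exact Or.inl ⟨⟨h2.1.trans h4, by rw [e, h5], by rwa [e]⟩, e.symm⟩
  · have h7 : L.scale ϖ = Lat.addScale ϖ P L := by
      apply Subtype.ext
      refine eq_of_idx_eq (M := L.1) le_sup_right (h6.trans h4) ?_ ?_
      · rw [Lat.idx_scale hϖ, ← idx_mul_idx h6 h4, e', h5]; ring
      · rw [Lat.idx_scale hϖ]; positivity
    refine Or.inr ⟨?_, ?_, ?_⟩
    · rw [h7, e]; exact h2.addScale hϖ
    · rw [h7, e]
    · rw [h7, e']

lemma not_hookIn_of_le_scale {ϖ : Fˣ} (hϖ : IsUniformizer ϖ) {m : ℕ} {L P : Lat F}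
    (h : P.1 ≤ (L.scale ϖ).1) : ¬ HookIn ϖ m L P := by
  have hq := one_lt_card_residue (F := F)
  intro h'
  have h1 := h'.2.1
  rw [Lat.addScale_eq_scale h, Lat.idx_scale hϖ] at h1
  have := Nat.pow_right_injective hq h1
  lia

lemma planeStep_of_hookIn {ϖ : Fˣ} (hϖ : IsUniformizer ϖ) {m : ℕ} {L P : Lat F}
    (h : HookIn ϖ (m + 1) L P) : planeStep ϖ m L P = {Lat.addScale ϖ P L} := by
  apply Set.eq_singleton_iff_unique_mem.2
  refine ⟨⟨⟨le_sup_right, Lat.addScale_le hϖ h.1, h.2.1⟩, h.2.2⟩, fun L' hL' => ?_⟩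
  rcases hookIn_or_cyclicIn_scale hϖ hL' with ⟨-, e⟩ | ⟨h', -⟩
  · exact e
  · exact absurd h (not_hookIn_of_le_scale hϖ h'.1)

lemma planeStep_of_cyclicIn_scale {ϖ : Fˣ} (hϖ : IsUniformizer ϖ) {m : ℕ} {L P : Lat F}
    (h : CyclicIn ϖ m (L.scale ϖ) P) : planeStep ϖ m L P =
      {L' | (L.scale ϖ).1 ≤ L'.1 ∧ L'.1 ≤ L.1 ∧ idx (L.scale ϖ).1 L'.1 = Nat.card 𝓀[F]} ∩
      {L' | Lat.addScale ϖ P L' = L.scale ϖ} := by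
  have hq := one_lt_card_residue (F := F)
  ext L'
  constructor
  · intro hL'
    rcases hookIn_or_cyclicIn_scale hϖ hL' with ⟨h', -⟩ | ⟨-, e, e'⟩
    · exact absurd h' (not_hookIn_of_le_scale hϖ h.1)
    · exact ⟨⟨hL'.1.1, hL'.1.2.1, e'⟩, e⟩
  · rintro ⟨⟨h1, h2, h3⟩, h4⟩
    refine ⟨⟨h1, h2, ?_⟩, ⟨h.1.trans h1, ?_, ?_⟩⟩
    · have := idx_mul_idx h1 h2
      rw [h3, Lat.idx_scale hϖ, pow_succ'] at this
      exact Nat.eq_of_mul_eq_mul_left (by lia) this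
    · rw [← idx_mul_idx h.1 h1, h3, h.2.1, pow_succ]
    · rw [h4, h3]; simp

open scoped Classical in
-- In the hook case only `P + ϖ L` qualifies. If `P ⊆ ϖ L`, the candidates are the `q² + q + 1`
-- lines of `L / ϖ L`; for `m > 0` the `q + 1` lines in the plane `H / ϖ L` drop out.
lemma ncard_planeStep {ϖ : Fˣ} (hϖ : IsUniformizer ϖ) (m : ℕ) (L P : Lat F) :
    (planeStep ϖ m L P).ncard = (if HookIn ϖ (m + 1) L P then 1 else 0) +
      (if m = 0 then Nat.card 𝓀[F] ^ 2 + Nat.card 𝓀[F] + 1 else Nat.card 𝓀[F] ^ 2) *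
        (if CyclicIn ϖ m (L.scale ϖ) P then 1 else 0) := by
  have hq := one_lt_card_residue (F := F)
  by_cases h1 : HookIn ϖ (m + 1) L P
  · rw [if_pos h1, if_neg fun h2 : CyclicIn ϖ m (L.scale ϖ) P => not_hookIn_of_le_scale hϖ h2.1 h1,
      planeStep_of_hookIn hϖ h1]
    simp
  by_cases h2 : CyclicIn ϖ m (L.scale ϖ) P
  · rw [if_neg h1, if_pos h2, planeStep_of_cyclicIn_scale hϖ h2, zero_add, mul_one]
    have hM : (L.scale ϖ).1 ≤ L.1 := hϖ.smul_le _
    have hcount := ncard_lat_lines hϖ hM le_rfl (Lat.idx_scale hϖ L)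
    rw [Finset.sum_range_succ, Finset.sum_range_succ, Finset.sum_range_one, pow_zero, pow_one]
      at hcount
    rcases m with _ | m
    · rw [if_pos rfl, Set.inter_eq_left.2, hcount]
      · ring
      rintro L' ⟨h3, h4, h5⟩
      have h6 := (cyclicIn_zero_iff hϖ).1 h2
      apply Subtype.ext
      change P.1 ⊔ ϖ • L'.1 = ϖ • L.1
      rw [h6]
      exact sup_eq_left.2 (units_smul_le_smul_iff.2 h4)
    · rw [if_neg (by lia)]
      -- The hyperplane lemma applies with `M = ϖ L`, because `P + ϖ L = ϖ L`.
      obtain ⟨H, h3, h4, h5, h6⟩ := exists_hyperplane hϖ h2 (sup_eq_right.2 h2.1) hM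
      have hidx : idx (L.scale ϖ).1 H.1 = Nat.card 𝓀[F] ^ 2 := by
        have := idx_mul_idx h3 h4
        rw [h5, Lat.idx_scale hϖ, pow_succ _ 2] at this
        exact Nat.eq_of_mul_eq_mul_right (by lia) this
      have hcount' := ncard_lat_lines hϖ h3 (units_smul_le_smul_iff.2 h4) hidx
      rw [Finset.sum_range_succ, Finset.sum_range_one, pow_zero, pow_one] at hcount'
      have e : {L' : Lat F | (L.scale ϖ).1 ≤ L'.1 ∧ L'.1 ≤ L.1 ∧
          idx (L.scale ϖ).1 L'.1 = Nat.card 𝓀[F]} ∩ {L' | Lat.addScale ϖ P L' = L.scale ϖ} =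
          {L' : Lat F | (L.scale ϖ).1 ≤ L'.1 ∧ L'.1 ≤ L.1 ∧
            idx (L.scale ϖ).1 L'.1 = Nat.card 𝓀[F]} \
          {L' : Lat F | (L.scale ϖ).1 ≤ L'.1 ∧ L'.1 ≤ H.1 ∧
            idx (L.scale ϖ).1 L'.1 = Nat.card 𝓀[F]} := by
        ext L'
        refine and_congr_right fun ⟨h7, h8, h9⟩ => ?_
        refine (h6 L' h7 h8).trans (not_congr ?_)
        exact ⟨fun h => ⟨h7, h, h9⟩, fun h => h.2.1⟩
      have hsub : {L' : Lat F | (L.scale ϖ).1 ≤ L'.1 ∧ L'.1 ≤ H.1 ∧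
            idx (L.scale ϖ).1 L'.1 = Nat.card 𝓀[F]} ⊆
          {L' : Lat F | (L.scale ϖ).1 ≤ L'.1 ∧ L'.1 ≤ L.1 ∧
            idx (L.scale ϖ).1 L'.1 = Nat.card 𝓀[F]} :=
        fun L' h => ⟨h.1, h.2.1.trans h4, h.2.2⟩
      have hfin : {L' : Lat F | (L.scale ϖ).1 ≤ L'.1 ∧ L'.1 ≤ H.1 ∧
          idx (L.scale ϖ).1 L'.1 = Nat.card 𝓀[F]}.Finite :=
        (finite_lat_between (P := L.scale ϖ) (L := H) (by rw [hidx]; positivity)).subset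
          fun L' h => ⟨h.1, h.2.1⟩
      rw [e, Set.ncard_sdiff hsub hfin, hcount, hcount']
      lia
  · rw [if_neg h1, if_neg h2]
    have : planeStep ϖ m L P = ∅ := by
      ext L'
      simp only [Set.mem_empty_iff_false, iff_false]
      intro h3
      rcases hookIn_or_cyclicIn_scale hϖ h3 with h | h
      · exact h1 h.1
      · exact h2 h.1
    rw [this]; simp

/-- Since `ϖ L' ⊆ P`, the group `(P + ϖ L) / P` is a quotient of `ϖ L / ϖ L'`, which has order `q`.
If it is trivial, `P` contains `ϖ L` and has the same index in `L`. -/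
lemma hookIn_or_eq_scale {ϖ : Fˣ} (hϖ : IsUniformizer ϖ) {L L' P : Lat F}
    (h : L' ∈ stepPlane ϖ L P) : HookIn ϖ 1 L P ∨ P = L.scale ϖ := by
  have hq := one_lt_card_residue (F := F)
  obtain ⟨h1, h2, h3, h4⟩ := h
  obtain ⟨h5, h6, h7⟩ := (cyclicIn_one_iff hϖ).1 h1
  have hM : (Lat.addScale ϖ P L).1 ≤ L.1 := Lat.addScale_le hϖ (h3.trans h5)
  have h8 : idx P.1 L.1 = Nat.card 𝓀[F] ^ 3 := by
    rw [← idx_mul_idx h3 h5, h4, h7, ← pow_succ]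
  have h9 : idx P.1 (Lat.addScale ϖ P L).1 ∣ Nat.card 𝓀[F] := by
    have h10 : idx (ϖ • L'.1) (ϖ • L.1) = Nat.card 𝓀[F] := (idx_units_smul ϖ _ _).trans h7
    rw [Lat.coe_addScale, idx_sup_right, ← h10]
    exact idx_dvd_of_le h2
  rcases idx_eq_one_or_of_dvd hϖ (P := P) (L := Lat.addScale ϖ P L) le_sup_left h9 with h10 | h10
  · have h11 : (L.scale ϖ).1 ≤ P.1 := le_sup_right.trans (idx_eq_one_iff.1 h10)
    refine Or.inr (Subtype.ext (eq_of_idx_eq h11 (h3.trans h5) ?_ ?_).symm)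
    · rw [h8, Lat.idx_scale hϖ]
    · rw [Lat.idx_scale hϖ]; positivity
  · refine Or.inl ⟨h3.trans h5, ?_, cyclicIn_one_of_idx hϖ le_sup_left h10⟩
    have := idx_mul_idx (L := (Lat.addScale ϖ P L).1) le_sup_left hM
    rw [h10, h8, pow_succ'] at this
    exact Nat.eq_of_mul_eq_mul_left (by lia) this

lemma stepPlane_of_eq_scale {ϖ : Fˣ} (hϖ : IsUniformizer ϖ) (L : Lat F) :
    stepPlane ϖ L (L.scale ϖ) =
      {L' | (L.scale ϖ).1 ≤ L'.1 ∧ L'.1 ≤ L.1 ∧ idx L'.1 L.1 = Nat.card 𝓀[F]} := by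
  have hq := one_lt_card_residue (F := F)
  ext L'
  constructor
  · rintro ⟨h1, h2, h3, h4⟩
    exact ⟨h3, h1.1, by simpa using h1.2.1⟩
  · rintro ⟨h1, h2, h3⟩
    refine ⟨cyclicIn_one_of_idx hϖ h2 h3, units_smul_le_smul_iff.2 h2, h1, ?_⟩
    have := idx_mul_idx h1 h2
    rw [h3, Lat.idx_scale hϖ, pow_succ _ 2] at this
    exact Nat.eq_of_mul_eq_mul_right (by lia) this

/-- The condition `ϖ L' ⊆ P` forces `L'` into `ϖ⁻¹ P ∩ L`, which itself has index `q` in `L`; equal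
indices leave no choice. -/
lemma exists_stepPlane_of_hookIn {ϖ : Fˣ} (hϖ : IsUniformizer ϖ) {L P : Lat F}
    (h : HookIn ϖ 1 L P) : ∃ H, stepPlane ϖ L P = {H} := by
  have hq := one_lt_card_residue (F := F)
  have hPH : P.1 ≤ ϖ⁻¹ • P.1 ⊓ L.1 := (le_inv_smul_inf_iff h.1).2 (hϖ.smul_le _)
  let H : Lat F := ⟨ϖ⁻¹ • P.1 ⊓ L.1, isLattice_of_le_of_le P.2 L.2 hPH inf_le_right⟩
  have hHL : H.1 ≤ L.1 := inf_le_right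
  have h1 : idx P.1 (Lat.addScale ϖ P L).1 = Nat.card 𝓀[F] := by simpa using h.2.2.2.1
  have hH : idx H.1 L.1 = Nat.card 𝓀[F] := (idx_inv_smul_inf ϖ _ _).trans h1
  refine ⟨H, Set.eq_singleton_iff_unique_mem.2 ⟨⟨cyclicIn_one_of_idx hϖ inf_le_right hH,
    (le_inv_smul_inf_iff hHL).1 le_rfl, hPH, ?_⟩, ?_⟩⟩
  · have h2 : idx P.1 L.1 = Nat.card 𝓀[F] ^ 3 := by
      rw [← idx_mul_idx h.2.2.1 (Lat.addScale_le hϖ h.1), h1,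
        h.2.1, ← pow_succ']
    have := idx_mul_idx (L := H.1) hPH hHL
    rw [h2, hH, pow_succ _ 2] at this
    exact Nat.eq_of_mul_eq_mul_right (by lia) this
  · rintro L' ⟨h2, h3, h4, h5⟩
    have h6 : L'.1 ≤ H.1 := (le_inv_smul_inf_iff h2.1).2 h3
    refine Subtype.ext (eq_of_idx_eq h6 hHL ?_ ?_)
    · rw [hH]; simpa using h2.2.1
    · have := h2.2.1
      rw [this]; positivity

open scoped Classical in
lemma ncard_stepPlane {ϖ : Fˣ} (hϖ : IsUniformizer ϖ) (L P : Lat F) :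
    (stepPlane ϖ L P).ncard = (if HookIn ϖ 1 L P then 1 else 0) +
      (Nat.card 𝓀[F] ^ 2 + Nat.card 𝓀[F] + 1) * (if P = L.scale ϖ then 1 else 0) := by
  by_cases h1 : HookIn ϖ 1 L P
  · rw [if_pos h1, if_neg fun h2 => not_hookIn_of_le_scale hϖ (by rw [h2]) h1]
    obtain ⟨H, e⟩ := exists_stepPlane_of_hookIn hϖ h1
    rw [e]; simp
  by_cases h2 : P = L.scale ϖ
  · rw [if_neg h1, if_pos h2, h2, stepPlane_of_eq_scale hϖ,
      ncard_lat_planes hϖ (hϖ.smul_le _) le_rfl (Lat.idx_scale hϖ L), Finset.sum_range_succ,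
      Finset.sum_range_succ, Finset.sum_range_one, pow_zero, pow_one]
    ring
  · rw [if_neg h1, if_neg h2]
    have : stepPlane ϖ L P = ∅ := by
      ext L'
      simp only [Set.mem_empty_iff_false, iff_false]
      intro h3
      rcases hookIn_or_eq_scale hϖ h3 with h | h
      · exact h1 h
      · exact h2 h
    rw [this]; simp

end LatticeCounts

/-! ### Operators defined by relations. -/

section Correspondence

variable {α β : Type*}

/-- The operator of a relation: `x` is mapped to the sum of all `y` with `R x y`. -/
noncomputable def correspondence (R : α → β → Prop) : (α →₀ ℂ) →ₗ[ℂ] (β →₀ ℂ) :=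
  Finsupp.linearCombination ℂ fun x => ∑ᶠ y : {y // R x y}, Finsupp.single y.1 1

/-- Finiteness is essential: a `finsum` with infinite support is 0 by convention. -/
lemma correspondence_single {R : α → β → Prop} {x : α} (h : {y | R x y}.Finite) :
    correspondence R (Finsupp.single x 1) = ∑ y ∈ h.toFinset, Finsupp.single y 1 := by
  rw [correspondence, Finsupp.linearCombination_single, one_smul,
    finsum_subtype_eq_finsum_cond (f := fun y => Finsupp.single y (1 : ℂ)) (fun y => R x y),
    ← finsum_mem_eq_finite_toFinset_sum _ h]
  rfl

open scoped Classical in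
lemma correspondence_single_apply {R : α → β → Prop} {x : α} (h : {y | R x y}.Finite) (y : β) :
    correspondence R (Finsupp.single x 1) y = if R x y then 1 else 0 := by
  rw [correspondence_single h, Finsupp.finsetSum_apply]
  simp [Finsupp.single_apply]

/-- This turns operator identities into counts of intermediate points. The right-hand factor of a
product acts first, so `R` is the first step. -/
lemma correspondence_comp_single_apply {γ : Type*} {R : α → β → Prop} {R' : β → γ → Prop} {x : α}
    (h : {y | R x y}.Finite) (h' : ∀ y, {z | R' y z}.Finite) (z : γ) :
    correspondence R' (correspondence R (Finsupp.single x 1)) z =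
      ({y | R x y ∧ R' y z}.ncard : ℂ) := by
  classical
  rw [correspondence_single h, map_sum, Finsupp.finsetSum_apply]
  simp only [fun y => correspondence_single_apply (h' y) z]
  rw [Finset.sum_boole, ← Set.ncard_coe_finset]
  congr 2
  ext y
  simp

end Correspondence

/-! ### Relations between the operators on lattices. -/

section LatticeOperators

variable {F : Type*} [Field F] [ValuativeRel F]

/-- The operator `L ↦ ∑ P` over the `P ⊆ L` with `L / P` isomorphic to `𝒪 / ϖⁿ`. -/
noncomputable def cyclicOp (ϖ : Fˣ) (n : ℕ) : Module.End ℂ (Lat F →₀ ℂ) :=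
  correspondence (CyclicIn ϖ n)

/-- The operator `L ↦ ∑ P` over the `P ⊆ L` with `L / P` isomorphic to `(𝒪 / ϖ)²`. -/
noncomputable def planeOp (ϖ : Fˣ) : Module.End ℂ (Lat F →₀ ℂ) := correspondence (PlaneIn ϖ)

/-- The operator `L ↦ ∑ P` over the `P ⊆ L` with `L / P` isomorphic to
`𝒪 / ϖ ^ (m + 1) ⊕ 𝒪 / ϖ`. -/
noncomputable def hookOp (ϖ : Fˣ) (m : ℕ) : Module.End ℂ (Lat F →₀ ℂ) :=
  correspondence (HookIn ϖ m)

/-- The operator `L ↦ ϖ L`. -/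
noncomputable def scaleOp (ϖ : Fˣ) : Module.End ℂ (Lat F →₀ ℂ) :=
  Finsupp.lmapDomain ℂ ℂ (Lat.scale ϖ)

lemma hookIn_zero_iff {ϖ : Fˣ} (hϖ : IsUniformizer ϖ) {L P : Lat F} :
    HookIn ϖ 0 L P ↔ PlaneIn ϖ L P := by
  constructor
  · rintro ⟨h, h1, h2⟩
    have h3 := (cyclicIn_zero_iff hϖ).1 h2
    rw [← h3] at h1
    refine ⟨?_, h, h1⟩
    rw [h3]; exact le_sup_right
  · rintro ⟨h, h1, h2⟩
    have h3 : P = Lat.addScale ϖ P L := Subtype.ext (sup_eq_left.2 h).symm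
    exact ⟨h1, h3 ▸ h2, (cyclicIn_zero_iff hϖ).2 h3⟩

lemma hookOp_zero {ϖ : Fˣ} (hϖ : IsUniformizer ϖ) : hookOp (F := F) ϖ 0 = planeOp ϖ := by
  unfold hookOp planeOp
  congr 1
  ext L P
  exact hookIn_zero_iff hϖ

variable [IsDiscreteValuationRing 𝒪[F]] [Finite 𝓀[F]]

/-- There are finitely many choices for `P + ϖ L`, and then finitely many for `P`. -/
lemma finite_hookIn {ϖ : Fˣ} (hϖ : IsUniformizer ϖ) (m : ℕ) (L : Lat F) :
    {P | HookIn ϖ m L P}.Finite := by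
  refine ((finite_planeIn hϖ L).biUnion fun M _ => finite_cyclicIn hϖ m M).subset ?_
  intro P hP
  exact Set.mem_biUnion (x := Lat.addScale ϖ P L)
    ⟨le_sup_right, Lat.addScale_le hϖ hP.1, hP.2.1⟩ hP.2.2

lemma cyclicOp_zero {ϖ : Fˣ} (hϖ : IsUniformizer ϖ) : cyclicOp (F := F) ϖ 0 = 1 := by
  classical
  ext L P
  simp only [cyclicOp, LinearMap.comp_apply, Finsupp.lsingle_apply, Module.End.one_apply]
  rw [correspondence_single_apply (finite_cyclicIn hϖ 0 L), cyclicIn_zero_iff hϖ,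
    Finsupp.single_apply]
  simp only [eq_comm]

lemma cyclicOp_mul_cyclicOp_one {ϖ : Fˣ} (hϖ : IsUniformizer ϖ) (m : ℕ) :
    cyclicOp (F := F) ϖ (m + 1) * cyclicOp ϖ 1 = cyclicOp ϖ (m + 2) +
      (if m = 0 then (Nat.card 𝓀[F] : ℂ) + 1 else (Nat.card 𝓀[F] : ℂ)) • hookOp ϖ m := by
  classical
  ext L P
  simp only [cyclicOp, hookOp, LinearMap.comp_apply, Finsupp.lsingle_apply, Module.End.mul_apply,
    LinearMap.add_apply, LinearMap.smul_apply, Finsupp.add_apply, Finsupp.smul_apply, smul_eq_mul]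
  rw [correspondence_comp_single_apply (finite_cyclicIn hϖ 1 L) (finite_cyclicIn hϖ (m + 1)),
    correspondence_single_apply (finite_cyclicIn hϖ (m + 2) L),
    correspondence_single_apply (finite_hookIn hϖ m L)]
  change ((cyclicStep ϖ m L P).ncard : ℂ) = _
  rw [ncard_cyclicStep hϖ]
  push_cast
  rfl

lemma cyclicOp_mul_planeOp {ϖ : Fˣ} (hϖ : IsUniformizer ϖ) (m : ℕ) :
    cyclicOp (F := F) ϖ (m + 1) * planeOp ϖ = hookOp ϖ (m + 1) +
      (if m = 0 then (Nat.card 𝓀[F] : ℂ) ^ 2 + Nat.card 𝓀[F] + 1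
        else (Nat.card 𝓀[F] : ℂ) ^ 2) • (cyclicOp ϖ m * scaleOp ϖ) := by
  classical
  ext L P
  simp only [cyclicOp, hookOp, planeOp, scaleOp, LinearMap.comp_apply, Finsupp.lsingle_apply,
    Module.End.mul_apply, LinearMap.add_apply, LinearMap.smul_apply, Finsupp.add_apply,
    Finsupp.smul_apply, smul_eq_mul, Finsupp.lmapDomain_apply, Finsupp.mapDomain_single]
  rw [correspondence_comp_single_apply (finite_planeIn hϖ L) (finite_cyclicIn hϖ (m + 1)),
    correspondence_single_apply (finite_cyclicIn hϖ m (L.scale ϖ)),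
    correspondence_single_apply (finite_hookIn hϖ (m + 1) L)]
  change ((planeStep ϖ m L P).ncard : ℂ) = _
  rw [ncard_planeStep hϖ]
  push_cast
  rfl

lemma planeOp_mul_cyclicOp_one {ϖ : Fˣ} (hϖ : IsUniformizer ϖ) :
    planeOp (F := F) ϖ * cyclicOp ϖ 1 = hookOp ϖ 1 +
      ((Nat.card 𝓀[F] : ℂ) ^ 2 + Nat.card 𝓀[F] + 1) • scaleOp ϖ := by
  classical
  ext L P
  simp only [cyclicOp, hookOp, planeOp, scaleOp, LinearMap.comp_apply, Finsupp.lsingle_apply,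
    Module.End.mul_apply, LinearMap.add_apply, LinearMap.smul_apply, Finsupp.add_apply,
    Finsupp.smul_apply, smul_eq_mul, Finsupp.lmapDomain_apply, Finsupp.mapDomain_single]
  rw [correspondence_comp_single_apply (finite_cyclicIn hϖ 1 L) (finite_planeIn hϖ),
    correspondence_single_apply (finite_hookIn hϖ 1 L), Finsupp.single_apply]
  change ((stepPlane ϖ L P).ncard : ℂ) = _
  rw [ncard_stepPlane hϖ]
  push_cast
  simp only [eq_comm]

/-- The two orders of factorization give the same counts, so both products have the same expansion
in `hookOp ϖ 1` and `scaleOp ϖ`. -/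
lemma planeOp_mul_comm {ϖ : Fˣ} (hϖ : IsUniformizer ϖ) :
    planeOp (F := F) ϖ * cyclicOp ϖ 1 = cyclicOp ϖ 1 * planeOp ϖ := by
  rw [planeOp_mul_cyclicOp_one hϖ, cyclicOp_mul_planeOp hϖ 0, if_pos rfl, cyclicOp_zero hϖ,
    one_mul]

lemma cyclicOp_two {ϖ : Fˣ} (hϖ : IsUniformizer ϖ) :
    cyclicOp (F := F) ϖ 2 = cyclicOp ϖ 1 ^ 2 - ((Nat.card 𝓀[F] : ℂ) + 1) • planeOp ϖ := by
  have h1 := cyclicOp_mul_cyclicOp_one (F := F) hϖ 0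
  rw [if_pos rfl, hookOp_zero hϖ] at h1
  rw [sq]
  exact eq_sub_of_add_eq (G := Module.End ℂ (Lat F →₀ ℂ)) h1.symm

/-- The coefficient `2q + 1` is `q + 1` from `cyclicOp_two` plus `q` from eliminating `hookOp ϖ 1`;
commutation merges the two terms. -/
lemma cyclicOp_three {ϖ : Fˣ} (hϖ : IsUniformizer ϖ) :
    cyclicOp (F := F) ϖ 3 = cyclicOp ϖ 1 ^ 3 -
      (2 * (Nat.card 𝓀[F] : ℂ) + 1) • (cyclicOp ϖ 1 * planeOp ϖ) +
      ((1 + (Nat.card 𝓀[F] : ℂ) + (Nat.card 𝓀[F] : ℂ) ^ 2) * Nat.card 𝓀[F]) • scaleOp ϖ := by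
  have h1 := cyclicOp_mul_cyclicOp_one (F := F) hϖ 1
  have h2 := cyclicOp_mul_planeOp (F := F) hϖ 0
  rw [if_neg one_ne_zero] at h1
  rw [if_pos rfl, cyclicOp_zero hϖ, one_mul] at h2
  have h3 := eq_sub_of_add_eq (G := Module.End ℂ (Lat F →₀ ℂ)) h1.symm
  have h4 := eq_sub_of_add_eq (G := Module.End ℂ (Lat F →₀ ℂ)) h2.symm
  have h5 := cyclicOp_two (F := F) hϖ
  simp only [zero_add, Nat.reduceAdd] at h3 h4
  rw [h3, h4, h5, pow_succ _ 2]
  refine LinearMap.ext fun v => ?_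
  have hc : planeOp ϖ (cyclicOp ϖ 1 v) = cyclicOp ϖ 1 (planeOp ϖ v) :=
    LinearMap.congr_fun (planeOp_mul_comm hϖ) v
  simp only [LinearMap.add_apply, LinearMap.sub_apply, LinearMap.smul_apply,
    Module.End.mul_apply, hc]
  module

/-- With `n = k + 3`, eliminate `hookOp ϖ (k + 2)`. The bound on `n` keeps both counts in their
generic case, and `q ^ 3` is `q` times `q ^ 2`. -/
lemma cyclicOp_succ {ϖ : Fˣ} (hϖ : IsUniformizer ϖ) {n : ℕ} (hn : 3 ≤ n) :
    cyclicOp (F := F) ϖ (n + 1) = cyclicOp ϖ n * cyclicOp ϖ 1 -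
      (Nat.card 𝓀[F] : ℂ) • (cyclicOp ϖ (n - 1) * planeOp ϖ) +
      (Nat.card 𝓀[F] : ℂ) ^ 3 • (cyclicOp ϖ (n - 2) * scaleOp ϖ) := by
  obtain ⟨k, rfl⟩ := Nat.exists_eq_add_of_le' hn
  have h1 := cyclicOp_mul_cyclicOp_one (F := F) hϖ (k + 2)
  have h2 := cyclicOp_mul_planeOp (F := F) hϖ (k + 1)
  rw [if_neg (by lia)] at h1 h2
  have h3 := eq_sub_of_add_eq (G := Module.End ℂ (Lat F →₀ ℂ)) h1.symm
  have h4 := eq_sub_of_add_eq (G := Module.End ℂ (Lat F →₀ ℂ)) h2.symm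
  rw [show k + 3 - 1 = k + 1 + 1 by lia, show k + 3 - 2 = k + 1 by lia]
  refine h3.trans ?_
  rw [show k + 2 = k + 1 + 1 by lia, h4]
  module

/-- Operators that are compatible with the operators on lattices satisfy the same relations. -/
theorem relations_of_intertwining {ϖ : Fˣ} (hϖ : IsUniformizer ϖ) {Y : Type*}
    {A : ℕ → Module.End ℂ (Y →₀ ℂ)} {π₁ π₂ : Module.End ℂ (Y →₀ ℂ)}
    {Q : (Lat F →₀ ℂ) →ₗ[ℂ] (Y →₀ ℂ)} (hQ : Function.Surjective Q)
    (hA : ∀ n v, A n (Q v) = Q (cyclicOp ϖ n v)) (h₁ : ∀ v, π₁ (Q v) = Q (cyclicOp ϖ 1 v))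
    (h₂ : ∀ v, π₂ (Q v) = Q (planeOp ϖ v)) (hs : ∀ v, Q (scaleOp ϖ v) = Q v)
    {q : ℕ} (hq : q = Nat.card 𝓀[F]) :
    A 1 = π₁ ∧
    A 2 = π₁ ^ 2 - ((q : ℂ) + 1) • π₂ ∧
    A 3 = π₁ ^ 3 - (2 * (q : ℂ) + 1) • (π₁ * π₂) + ((1 + (q : ℂ) + (q : ℂ) ^ 2) * q) • 1 ∧
    ∀ n : ℕ, 3 ≤ n →
      A (n + 1) = A n * π₁ - (q : ℂ) • (A (n - 1) * π₂) + (q : ℂ) ^ 3 • A (n - 2) := by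
  subst hq
  refine ⟨?_, ?_, ?_, fun n hn => ?_⟩
  · refine LinearMap.ext fun y => ?_
    obtain ⟨v, rfl⟩ := hQ y
    rw [hA, h₁]
  · refine LinearMap.ext fun y => ?_
    obtain ⟨v, rfl⟩ := hQ y
    rw [hA, cyclicOp_two hϖ]
    simp [sq, h₁, h₂]
  · refine LinearMap.ext fun y => ?_
    obtain ⟨v, rfl⟩ := hQ y
    rw [hA, cyclicOp_three hϖ]
    simp [pow_succ, h₁, h₂, hs]
  · refine LinearMap.ext fun y => ?_
    obtain ⟨v, rfl⟩ := hQ y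
    rw [hA, cyclicOp_succ hϖ hn]
    simp only [LinearMap.add_apply, LinearMap.sub_apply, LinearMap.smul_apply,
      Module.End.mul_apply, map_add, map_sub, map_smul, h₁, h₂, ← hA, hs]

end LatticeOperators

/-! ### Convolution as a finite sum over relative positions. -/

section RelativePosition

variable {F : Type*} [Field F] [ValuativeRel F]

/-- The pair `(x, z)` lies in the `PGL₃(F)`-orbit of `([L₀], a [L₀])`. -/
def RelPos (a : PGL(3, F)) (x z : Vertex F) : Prop :=
  ∃ g : PGL(3, F), x = g • (stdLat F).vertex ∧ z = (g * a) • (stdLat F).vertex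

lemma RelPos.smul {a : PGL(3, F)} {x z : Vertex F} (h : RelPos a x z) (γ : PGL(3, F)) :
    RelPos a (γ • x) (γ • z) := by
  obtain ⟨g, rfl, rfl⟩ := h
  exact ⟨γ * g, by rw [mul_smul], by rw [mul_assoc, mul_smul γ]⟩

lemma relPos_smul_iff {a : PGL(3, F)} {x z : Vertex F} (γ : PGL(3, F)) :
    RelPos a (γ • x) (γ • z) ↔ RelPos a x z :=
  ⟨fun h => by simpa using h.smul γ⁻¹, fun h => h.smul γ⟩

/-- `K` is the stabilizer of `[L₀]`, so the two `K`-factors are precisely the freedom in choosing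
representatives of the two vertices. -/
lemma mem_doubleCoset_iff_relPos (a y g : PGL(3, F)) :
    y⁻¹ * g ∈ DoubleCoset.doubleCoset a (maxCompact F) (maxCompact F : Set PGL(3, F)) ↔
      RelPos a (y • (stdLat F).vertex) (g • (stdLat F).vertex) := by
  rw [DoubleCoset.mem_doubleCoset]
  constructor
  · rintro ⟨k, hk, k', hk', h⟩
    refine ⟨y * k, ?_, ?_⟩
    · rw [mul_smul, (smul_stdLat_vertex k).2 hk]
    · have : g = y * k * a * k' := by
        rw [mul_assoc y, mul_assoc y, ← h, mul_inv_cancel_left]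
      rw [this, mul_smul _ k', (smul_stdLat_vertex k').2 hk']
  · rintro ⟨g', h1, h2⟩
    refine ⟨y⁻¹ * g', ?_, (g' * a)⁻¹ * g, ?_, by group⟩
    · rw [SetLike.mem_coe, ← smul_stdLat_vertex, mul_smul, ← h1, inv_smul_smul]
    · rw [SetLike.mem_coe, ← smul_stdLat_vertex, mul_smul, h2, inv_smul_smul]

lemma smul_stdLat_vertex_mul {g k : PGL(3, F)} (hk : k ∈ maxCompact F) :
    (g * k) • (stdLat F).vertex = g • (stdLat F).vertex := by
  rw [mul_smul, (smul_stdLat_vertex k).2 hk]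

lemma setOf_smul_stdLat_eq (g : PGL(3, F)) :
    {y : PGL(3, F) | y • (stdLat F).vertex = g • (stdLat F).vertex} =
      (fun y => g⁻¹ * y) ⁻¹' (maxCompact F : Set PGL(3, F)) := by
  ext y
  rw [Set.mem_preimage, SetLike.mem_coe, ← smul_stdLat_vertex, mul_smul, inv_smul_eq_iff]
  rfl

variable [TopologicalSpace F] [IsNonarchimedeanLocalField F]

/-- `K` is open, so the orbit map is continuous for the discrete topology on vertices, and compact
discrete sets are finite. -/
lemma finite_image_smul_stdLat {C : Set PGL(3, F)} (hC : IsCompact C) :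
    ((fun g : PGL(3, F) => g • (stdLat F).vertex) '' C).Finite := by
  let _ : TopologicalSpace (Vertex F) := ⊥
  have : DiscreteTopology (Vertex F) := ⟨rfl⟩
  exact (hC.image (isLocallyConstant_of_right_inv _
    fun g k hk => smul_stdLat_vertex_mul hk).continuous).finite_of_discrete

lemma finite_relPos_left (a : PGL(3, F)) (z : Vertex F) : {w | RelPos a w z}.Finite := by
  obtain ⟨g, rfl⟩ := exists_smul_stdLat z
  refine (finite_image_smul_stdLat ((isCompact_doubleCoset a).inv.smul g)).subset ?_
  intro w hw
  obtain ⟨y, rfl⟩ := exists_smul_stdLat w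
  refine ⟨y, ?_, rfl⟩
  rw [Set.mem_smul_set_iff_inv_smul_mem, Set.mem_inv]
  simpa using (mem_doubleCoset_iff_relPos a y g).2 hw

lemma finite_relPos_right (a : PGL(3, F)) (x : Vertex F) : {z | RelPos a x z}.Finite := by
  obtain ⟨y, rfl⟩ := exists_smul_stdLat x
  refine (finite_image_smul_stdLat ((isCompact_doubleCoset a).smul y)).subset ?_
  intro z hz
  obtain ⟨g, rfl⟩ := exists_smul_stdLat z
  refine ⟨g, ?_, rfl⟩
  rw [Set.mem_smul_set_iff_inv_smul_mem]
  exact (mem_doubleCoset_iff_relPos a y g).2 hz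

lemma haarK_maxCompact : haarK F (maxCompact F : Set PGL(3, F)) = 1 :=
  Measure.haarMeasure_self

/-- The fibre over `g [L₀]` is the coset `g K`, so left invariance applies. -/
lemma haarK_setOf_smul_stdLat_eq (w : Vertex F) :
    haarK F {y : PGL(3, F) | y • (stdLat F).vertex = w} = 1 := by
  have hinv : (haarK F).IsMulLeftInvariant := by unfold haarK; infer_instance
  obtain ⟨g, rfl⟩ := exists_smul_stdLat w
  rw [setOf_smul_stdLat_eq, measure_preimage_mul, haarK_maxCompact]

lemma measurableSet_setOf_smul_stdLat_eq (w : Vertex F) :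
    MeasurableSet {y : PGL(3, F) | y • (stdLat F).vertex = w} := by
  obtain ⟨g, rfl⟩ := exists_smul_stdLat w
  rw [setOf_smul_stdLat_eq]
  exact ((isOpen_maxCompact F).preimage (continuous_const_mul g⁻¹)).measurableSet

/-- On `G / K` the convolution with `1_{K a K}` is a finite sum. -/
lemma convolve_eq_sum (a : PGL(3, F)) (φ : Vertex F → ℂ) (g : PGL(3, F)) :
    convolve (fun y => φ (y • (stdLat F).vertex)) (doubleCosetFun a) g =
      ∑ w ∈ (finite_relPos_left a (g • (stdLat F).vertex)).toFinset, φ w := by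
  classical
  -- The integrand is constant on the cosets of `K`; each contributing vertex accounts for one coset
  -- of volume 1.
  have h : ∀ y : PGL(3, F), φ (y • (stdLat F).vertex) * doubleCosetFun a (y⁻¹ * g) =
      ∑ w ∈ (finite_relPos_left a (g • (stdLat F).vertex)).toFinset,
        Set.indicator {y : PGL(3, F) | y • (stdLat F).vertex = w} (fun _ => φ w) y := by
    intro y
    simp only [Set.indicator_apply, Set.mem_ofPred_eq]
    rw [Finset.sum_ite_eq]
    simp only [Set.Finite.mem_toFinset, Set.mem_ofPred_eq, ← mem_doubleCoset_iff_relPos,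
      doubleCosetFun, Set.indicator_apply]
    split_ifs <;> simp
  unfold convolve
  simp only [h]
  rw [integral_finsetSum]
  · refine Finset.sum_congr rfl fun w _ => ?_
    rw [integral_indicator (measurableSet_setOf_smul_stdLat_eq w), setIntegral_const, Measure.real,
      haarK_setOf_smul_stdLat_eq]
    simp
  · intro w _
    refine (integrable_indicator_iff (measurableSet_setOf_smul_stdLat_eq w)).2 ?_
    refine integrableOn_const ?_
    rw [haarK_setOf_smul_stdLat_eq]
    exact ENNReal.one_ne_top

/-- The value of the convolution at `z` sums over the `w` with `RelPos a w z`; for the point mass at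
`x` this leaves the sum of the `z` reached from `x`. -/
lemma heckeX_single (a : PGL(3, F)) (x : Vertex F) :
    heckeX a (Finsupp.single x 1) = correspondence (RelPos a) (Finsupp.single x 1) := by
  classical
  ext z
  rw [correspondence_single_apply (finite_relPos_right a x)]
  obtain ⟨g, rfl⟩ := exists_smul_stdLat z
  refine (heckeOperator_apply _ _ a _ g).trans ?_
  refine (convolve_eq_sum a (Finsupp.single x 1) g).trans ?_
  simp [Finsupp.single_apply]

end RelativePosition

/-! ### The action of `GL₃(F)` on frames, and passage to homothety classes. -/

section Frames

/-- The diagonal matrix with entries `ϖ ^ m i`. -/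
def diagGL {F : Type*} [Field F] (ϖ : Fˣ) (m : Fin 3 → ℤ) : GL (Fin 3) F :=
  ⟨Matrix.diagonal fun i => ((ϖ ^ m i : Fˣ) : F), Matrix.diagonal fun i => (((ϖ ^ m i : Fˣ) : F)⁻¹),
    by
      rw [Matrix.diagonal_mul_diagonal, ← Matrix.diagonal_one]
      exact congrArg _ (funext fun i => mul_inv_cancel₀ (Units.ne_zero _)),
    by
      rw [Matrix.diagonal_mul_diagonal, ← Matrix.diagonal_one]
      exact congrArg _ (funext fun i => inv_mul_cancel₀ (Units.ne_zero _))⟩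

lemma det_diagGL {F : Type*} [Field F] (ϖ : Fˣ) (m : Fin 3 → ℤ) :
    Matrix.GeneralLinearGroup.det (diagGL ϖ m) = ϖ ^ ∑ i, m i := by
  apply Units.ext
  change (Matrix.diagonal fun i => ((ϖ ^ m i : Fˣ) : F)).det = _
  rw [Matrix.det_diagonal, Fin.prod_univ_three, Fin.sum_univ_three, zpow_add, zpow_add]
  rfl

lemma diagElt_eq_mk_diagGL {F : Type*} [Field F] {ϖ : Fˣ} {d : Fin 3 → Fˣ} {m : Fin 3 → ℤ}
    (h : ∀ i, d i = ϖ ^ m i) : diagElt d = Matrix.ProjGenLinGroup.mk (diagGL ϖ m) := by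
  obtain rfl : d = fun i => ϖ ^ m i := funext h
  rfl

/-- The linear automorphism of `F³` given by a matrix. -/
noncomputable def glEquiv {F : Type*} [Field F] (g : GL (Fin 3) F) : (Fin 3 → F) ≃ₗ[F] (Fin 3 → F) :=
  LinearMap.GeneralLinearGroup.generalLinearEquiv F _ (Matrix.GeneralLinearGroup.toLin g)

lemma exists_basisFun_map_eq {F : Type*} [Field F]
    (b : Module.Basis (Fin 3) F (Fin 3 → F)) :
    ∃ g : GL (Fin 3) F, b = (Pi.basisFun F (Fin 3)).map (glEquiv g) := by
  let e := (Pi.basisFun F (Fin 3)).equiv b (Equiv.refl _)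
  refine ⟨Matrix.GeneralLinearGroup.toLin.symm
    (LinearMap.GeneralLinearGroup.ofLinearEquiv e), ?_⟩
  ext i : 1
  rw [Module.Basis.map_apply, glEquiv, MulEquiv.apply_symm_apply]
  change _ = e _
  rw [Module.Basis.equiv_apply]
  rfl

variable {F : Type*} [Field F] [ValuativeRel F]

lemma glEquiv_apply (g : GL (Fin 3) F) (v : Fin 3 → F) : glEquiv g v = glMap g v := rfl

lemma gl_smul_spanLat (g : GL (Fin 3) F) (b : Module.Basis (Fin 3) F (Fin 3 → F)) :
    g • spanLat b = spanLat (b.map (glEquiv g)) := by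
  apply Subtype.ext
  rw [coe_gl_smul]
  change Submodule.map _ (Submodule.span _ _) = Submodule.span _ _
  rw [Submodule.map_span, ← Set.range_comp]
  rfl

lemma gl_smul_frameLat (g : GL (Fin 3) F) (ϖ : Fˣ) (b : Module.Basis (Fin 3) F (Fin 3 → F))
    (a : Fin 3 → ℤ) : g • frameLat ϖ b a = frameLat ϖ (b.map (glEquiv g)) a := by
  rw [frameLat, gl_smul_spanLat, frameLat]
  congr 1
  ext i : 1
  simp [Module.Basis.unitsSMul_apply, Units.smul_def]

lemma diagGL_smul_stdLat (ϖ : Fˣ) (m : Fin 3 → ℤ) :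
    diagGL ϖ m • stdLat F = frameLat ϖ (Pi.basisFun F (Fin 3)) m := by
  rw [stdLat, gl_smul_spanLat, frameLat]
  congr 1
  ext i j
  rw [Module.Basis.map_apply, glEquiv_apply, Module.Basis.unitsSMul_apply, Units.smul_def]
  by_cases h : j = i
  · subst h; simp [glMap, diagGL]
  · simp [glMap, diagGL, h]

lemma vertex_eq_iff {L L' : Lat F} : L.vertex = L'.vertex ↔ ∃ α : Fˣ, L'.1 = α • L.1 :=
  ⟨fun h => Quotient.exact h, fun h => Quotient.sound h⟩

/-- An element of `GL₃(F)` amounts to a frame, the image of the standard one. The homothety between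
`g L₀` and `L` is absorbed by rescaling this frame. -/
lemma relPos_mk_diagGL_iff (ϖ : Fˣ) (m : Fin 3 → ℤ) (L : Lat F) (z : Vertex F) :
    RelPos (Matrix.ProjGenLinGroup.mk (diagGL ϖ m)) L.vertex z ↔
      ∃ b, L = spanLat b ∧ (frameLat ϖ b m).vertex = z := by
  constructor
  · rintro ⟨g, h1, rfl⟩
    induction g using Matrix.ProjGenLinGroup.induction_on with | mk g =>
    rw [mk_smul_vertex, eq_comm, vertex_eq_iff] at h1
    obtain ⟨α, h1⟩ := h1
    rw [stdLat, gl_smul_spanLat, ← spanLat_unitsSMul_const] at h1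
    refine ⟨_, Subtype.ext h1, ?_⟩
    rw [← map_mul, mk_smul_vertex, mul_smul, diagGL_smul_stdLat, gl_smul_frameLat, eq_comm,
      vertex_eq_iff]
    exact ⟨α, frameLat_unitsSMul_const ϖ _ α m⟩
  · rintro ⟨b, rfl, rfl⟩
    obtain ⟨g, rfl⟩ := exists_basisFun_map_eq b
    refine ⟨Matrix.ProjGenLinGroup.mk g, ?_, ?_⟩
    · rw [mk_smul_vertex, ← gl_smul_spanLat]; rfl
    · rw [← map_mul, mk_smul_vertex, mul_smul, diagGL_smul_stdLat, gl_smul_frameLat]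

variable [IsDiscreteValuationRing 𝒪[F]]

/-- Homothetic sublattices with the same finite index in a lattice are equal. -/
lemma eq_of_vertex_eq {ϖ : Fˣ} (hϖ : IsUniformizer ϖ) {L P P' : Lat F} (h : P.1 ≤ L.1)
    (h' : P'.1 ≤ L.1) (e : idx P.1 L.1 = idx P'.1 L.1) (h0 : idx P.1 L.1 ≠ 0)
    (hv : P.vertex = P'.vertex) : P = P' := by
  obtain ⟨α, hα⟩ := vertex_eq_iff.1 hv
  obtain ⟨t, ht⟩ := hϖ.exists_zpow_smul α
  rw [ht] at hα
  -- Homothetic lattices are comparable by inclusion, so equal finite index forces equality.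
  have key : ∀ (s : ℤ) (M : Submodule 𝒪[F] (Fin 3 → F)), 0 ≤ s → ϖ ^ s • M ≤ M := fun s M hs =>
    units_smul_le_iff.2 fun v hv => M.smul_mem (⟨_, hϖ.zpow_mem_iff.2 hs⟩ : 𝒪[F]) hv
  rcases le_total 0 t with h1 | h1
  · have h2 : P'.1 ≤ P.1 := hα ▸ key t P.1 h1
    exact (Subtype.ext (eq_of_idx_eq h2 h e.symm (e ▸ h0))).symm
  · have h2 : P.1 ≤ P'.1 := by
      have := key (-t) P'.1 (by lia)
      rwa [hα, ← mul_smul, ← zpow_add, neg_add_cancel, zpow_zero, one_smul, ← hα] at this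
    exact Subtype.ext (eq_of_idx_eq h2 h' e h0)

variable [Finite 𝓀[F]]

lemma CyclicIn.vertex_inj {ϖ : Fˣ} (hϖ : IsUniformizer ϖ) {n : ℕ} {L P P' : Lat F}
    (h : CyclicIn ϖ n L P) (h' : CyclicIn ϖ n L P') (hv : P.vertex = P'.vertex) : P = P' := by
  have hq := one_lt_card_residue (F := F)
  refine eq_of_vertex_eq hϖ h.1 h'.1 (h.2.1.trans h'.2.1.symm) ?_ hv
  rw [h.2.1]; positivity

lemma PlaneIn.vertex_inj {ϖ : Fˣ} (hϖ : IsUniformizer ϖ) {L P P' : Lat F}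
    (h : PlaneIn ϖ L P) (h' : PlaneIn ϖ L P') (hv : P.vertex = P'.vertex) : P = P' := by
  have hq := one_lt_card_residue (F := F)
  refine eq_of_vertex_eq hϖ h.2.1 h'.2.1 (h.2.2.trans h'.2.2.symm) ?_ hv
  rw [h.2.2]; positivity

end Frames

/-! ### The Hecke operators as push-forwards of lattice operators. -/

section Hecke

lemma lmapDomain_correspondence_single {α β γ : Type*} {R : α → β → Prop} {x : α}
    (h : {y | R x y}.Finite) (f : β → γ) :
    Finsupp.lmapDomain ℂ ℂ f (correspondence R (Finsupp.single x 1)) =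
      ∑ᶠ y : {y // R x y}, Finsupp.single (f y.1) 1 := by
  rw [correspondence_single h, map_sum,
    finsum_subtype_eq_finsum_cond (f := fun y => Finsupp.single (f y) (1 : ℂ)) (fun y => R x y)]
  simp only [Finsupp.lmapDomain_apply, Finsupp.mapDomain_single]
  rw [← finsum_mem_eq_finite_toFinset_sum _ h]
  rfl

/-- Push-forward of a correspondence along maps that identify the correspondents of `x`. -/
lemma lmapDomain_correspondence {α β α' β' : Type*} {R : α → β → Prop} {R' : α' → β' → Prop}
    {f : α → α'} {g : β → β'} {x : α} (h : {y | R x y}.Finite)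
    (h' : ∀ z, R' (f x) z ↔ ∃ y, R x y ∧ g y = z) (hinj : Set.InjOn g {y | R x y}) :
    Finsupp.lmapDomain ℂ ℂ g (correspondence R (Finsupp.single x 1)) =
      correspondence R' (Finsupp.single (f x) 1) := by
  rw [lmapDomain_correspondence_single h, correspondence, Finsupp.linearCombination_single,
    one_smul]
  refine finsum_eq_of_bijective
    (fun y => ⟨g y.1, (h' _).2 ⟨y.1, y.2, rfl⟩⟩) ⟨?_, ?_⟩ fun _ => rfl
  · intro y y' e
    exact Subtype.ext (hinj y.2 y'.2 (congrArg Subtype.val e))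
  · rintro ⟨z, hz⟩
    obtain ⟨y, hy, rfl⟩ := (h' z).1 hz
    exact ⟨⟨y, hy⟩, rfl⟩

variable {F : Type*} [Field F] [ValuativeRel F] [TopologicalSpace F]
  [IsNonarchimedeanLocalField F]

lemma heckeX_one_lmapDomain {ϖ : Fˣ} (hϖ : IsUniformizer ϖ) (v : Lat F →₀ ℂ) :
    heckeX (diagElt ![1, 1, ϖ]) (Finsupp.lmapDomain ℂ ℂ Lat.vertex v) =
      Finsupp.lmapDomain ℂ ℂ Lat.vertex (cyclicOp ϖ 1 v) := by
  induction v using Finsupp.induction_linear with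
  | zero => simp
  | add v w hv hw => rw [map_add, map_add, hv, hw, map_add, map_add]
  | single L c =>
    rw [← mul_one c, ← smul_eq_mul, ← Finsupp.smul_single, map_smul, map_smul, map_smul, map_smul]
    congr 1
    rw [Finsupp.lmapDomain_apply, Finsupp.mapDomain_single, heckeX_single, cyclicOp]
    refine (lmapDomain_correspondence (finite_cyclicIn hϖ 1 L) (fun z => ?_)
      fun P hP P' hP' => CyclicIn.vertex_inj hϖ hP hP').symm
    rw [diagElt_eq_mk_diagGL (ϖ := ϖ) (m := ![0, 0, 1]) (by intro i; fin_cases i <;> simp),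
      relPos_mk_diagGL_iff]
    constructor
    · rintro ⟨b, h, rfl⟩
      exact ⟨_, (cyclicIn_iff hϖ).2 ⟨b, h, rfl⟩, rfl⟩
    · rintro ⟨P, hP, rfl⟩
      obtain ⟨b, h, rfl⟩ := (cyclicIn_iff hϖ).1 hP
      exact ⟨b, h, rfl⟩

lemma heckeX_two_lmapDomain {ϖ : Fˣ} (hϖ : IsUniformizer ϖ) (v : Lat F →₀ ℂ) :
    heckeX (diagElt ![1, ϖ, ϖ]) (Finsupp.lmapDomain ℂ ℂ Lat.vertex v) =
      Finsupp.lmapDomain ℂ ℂ Lat.vertex (planeOp ϖ v) := by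
  induction v using Finsupp.induction_linear with
  | zero => simp
  | add v w hv hw => rw [map_add, map_add, hv, hw, map_add, map_add]
  | single L c =>
    rw [← mul_one c, ← smul_eq_mul, ← Finsupp.smul_single, map_smul, map_smul, map_smul, map_smul]
    congr 1
    rw [Finsupp.lmapDomain_apply, Finsupp.mapDomain_single, heckeX_single, planeOp]
    refine (lmapDomain_correspondence (finite_planeIn hϖ L) (fun z => ?_)
      fun P hP P' hP' => PlaneIn.vertex_inj hϖ hP hP').symm
    rw [diagElt_eq_mk_diagGL (ϖ := ϖ) (m := ![0, 1, 1]) (by intro i; fin_cases i <;> simp),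
      relPos_mk_diagGL_iff]
    constructor
    · rintro ⟨b, h, rfl⟩
      exact ⟨_, (planeIn_iff hϖ).2 ⟨b, h, rfl⟩, rfl⟩
    · rintro ⟨P, hP, rfl⟩
      obtain ⟨b, h, rfl⟩ := (planeIn_iff hϖ).1 hP
      exact ⟨b, h, rfl⟩

end Hecke

/-! ### Types of vertices and valuations of determinants. -/

section Types

lemma det_scalar_three {F : Type*} [Field F] (α : Fˣ) :
    Matrix.GeneralLinearGroup.det (Matrix.GeneralLinearGroup.scalar (Fin 3) α) = α ^ 3 := by
  apply Units.ext
  change (Matrix.scalar (Fin 3) (α : F)).det = _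
  simp

variable {F : Type*} [Field F] [ValuativeRel F]

/-- The matrix `g` has integral entries, and so has its inverse, if it fixes `L₀`. Hence its
determinant is a unit. -/
lemma det_mem_of_smul_stdLat {g : GL (Fin 3) F} (h : g • stdLat F = stdLat F) :
    ((Matrix.GeneralLinearGroup.det g : Fˣ) : F) ∈ 𝒪[F] := by
  have h1 := entry_mem (congrArg Subtype.val h).le
  change Matrix.det g.1 ∈ 𝒪[F]
  rw [Matrix.det_fin_three]
  have hm : ∀ i j k l m n, g.1 i j * g.1 k l * g.1 m n ∈ 𝒪[F] := fun i j k l m n =>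
    mul_mem (mul_mem (h1 i j) (h1 k l)) (h1 m n)
  exact sub_mem (add_mem (add_mem (sub_mem (sub_mem (hm _ _ _ _ _ _) (hm _ _ _ _ _ _))
    (hm _ _ _ _ _ _)) (hm _ _ _ _ _ _)) (hm _ _ _ _ _ _)) (hm _ _ _ _ _ _)

/-- The exponents `m` with `L_j = ϖ ^ m L₀`. -/
def typeExp : Fin 3 → Fin 3 → ℤ := ![![0, 0, 0], ![0, 0, 1], ![0, 1, 1]]

lemma sum_typeExp (j : Fin 3) : ∑ i, typeExp j i = (j : ℕ) := by
  fin_cases j <;> simp [typeExp, Fin.sum_univ_three]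

lemma typeVertex_eq (ϖ : Fˣ) (j : Fin 3) :
    typeVertex ϖ j = (diagGL ϖ (typeExp j) • stdLat F).vertex := by
  rw [diagGL_smul_stdLat]
  fin_cases j
  · change (stdLat F).vertex = (frameLat ϖ (Pi.basisFun F (Fin 3)) ![0, 0, 0]).vertex
    rw [show (![0, 0, 0] : Fin 3 → ℤ) = 0 by funext i; fin_cases i <;> rfl, frameLat_zero]
    rfl
  · rfl
  · rfl

lemma zpow_eq_of_unit_mul {ϖ : Fˣ} (hϖ : IsUniformizer ϖ) {u u' : Fˣ} {t t' : ℤ}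
    (hu : (u : F) ∈ 𝒪[F]) (hu' : ((u⁻¹ : Fˣ) : F) ∈ 𝒪[F])
    (hv : (u' : F) ∈ 𝒪[F]) (hv' : ((u'⁻¹ : Fˣ) : F) ∈ 𝒪[F]) (h : u * ϖ ^ t = u' * ϖ ^ t') :
    t = t' := by
  have h1 : ϖ ^ (t - t') = u⁻¹ * u' := by
    rw [zpow_sub, eq_inv_mul_iff_mul_eq, ← mul_assoc, h, mul_inv_cancel_right]
  have h2 : ϖ ^ (t' - t) = u'⁻¹ * u := by
    rw [zpow_sub, eq_inv_mul_iff_mul_eq, ← mul_assoc, ← h, mul_inv_cancel_right]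
  have h3 : ((ϖ ^ (t - t') : Fˣ) : F) ∈ 𝒪[F] := by rw [h1]; exact mul_mem hu' hv
  have h4 : ((ϖ ^ (t' - t) : Fˣ) : F) ∈ 𝒪[F] := by rw [h2]; exact mul_mem hv' hu
  rw [hϖ.zpow_mem_iff] at h3 h4
  lia

variable [IsDiscreteValuationRing 𝒪[F]]

/-- The type of `[g L₀]` is the valuation of the determinant of `g` modulo `3`. -/
lemma hasType_iff {ϖ : Fˣ} (hϖ : IsUniformizer ϖ) {g : GL (Fin 3) F} {u : Fˣ} {t : ℤ}
    (hu : (u : F) ∈ 𝒪[F]) (hu' : ((u⁻¹ : Fˣ) : F) ∈ 𝒪[F])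
    (hg : Matrix.GeneralLinearGroup.det g = u * ϖ ^ t) (j : Fin 3) :
    HasType ϖ (g • stdLat F).vertex j ↔ (3 : ℤ) ∣ t - (j : ℕ) := by
  constructor
  · rintro ⟨_, ⟨h, rfl⟩, e⟩
    rw [typeVertex_eq] at e
    have e' : (g • stdLat F).vertex =
        ((h : GL (Fin 3) F) • diagGL ϖ (typeExp j) • stdLat F).vertex := e
    obtain ⟨α, hα⟩ := vertex_eq_iff.1 e'.symm
    rw [← coe_scalar_smul] at hα
    have hα' := Subtype.ext hα
    set s := Matrix.GeneralLinearGroup.scalar (Fin 3) α with hs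
    rw [← mul_smul, ← mul_smul, mul_assoc, eq_comm] at hα'
    -- The discrepancy `k` fixes `L₀`, so its determinant is a unit. Comparing determinants, `h`
    -- contributes 1 and the scalar a cube, hence the congruence modulo 3.
    set k := (s * ((h : GL (Fin 3) F) * diagGL ϖ (typeExp j)))⁻¹ * g with hk
    have hk1 : k • stdLat F = stdLat F := by
      rw [hk, mul_smul, ← hα', inv_smul_smul]
    have hk2 : k⁻¹ • stdLat F = stdLat F := by rw [inv_smul_eq_iff, hk1]
    have hd1 := det_mem_of_smul_stdLat hk1
    have hd2 := det_mem_of_smul_stdLat hk2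
    rw [map_inv] at hd2
    obtain ⟨r, w, hw, hw', rfl⟩ := hϖ.exists_unit_mul_zpow α
    have hgk : g = s * ((h : GL (Fin 3) F) * diagGL ϖ (typeExp j)) * k := by
      rw [hk, mul_inv_cancel_left]
    have hdet := congrArg Matrix.GeneralLinearGroup.det hgk
    have hh : Matrix.GeneralLinearGroup.det (h : GL (Fin 3) F) = 1 := Units.ext h.2
    rw [map_mul, map_mul, map_mul, hg, hs, det_scalar_three, hh, det_diagGL, one_mul,
      sum_typeExp] at hdet
    have hfin : u * ϖ ^ t =
        (w ^ 3 * Matrix.GeneralLinearGroup.det k) * ϖ ^ (3 * r + (j : ℕ)) := by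
      have h3 : ϖ ^ (3 * r) = (ϖ ^ r) ^ 3 := by rw [zpow_mul', zpow_ofNat]
      rw [hdet, zpow_add, h3, mul_pow]
      simp only [mul_assoc, mul_left_comm, mul_comm]
    have := zpow_eq_of_unit_mul hϖ hu hu'
      (by rw [Units.val_mul, Units.val_pow_eq_pow_val]; exact mul_mem (pow_mem hw 3) hd1)
      (by
        rw [mul_inv, ← inv_pow, Units.val_mul, Units.val_pow_eq_pow_val]
        exact mul_mem (pow_mem hw' 3) hd2) hfin
    exact ⟨r, by lia⟩
  · rintro ⟨r, hr⟩
    -- The diagonal matrix with these entries fixes `L₀` and cancels the unit part of the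
    -- determinant of `g`.
    let c : Fin 3 → Fˣ := ![u⁻¹, 1, 1]
    let D : GL (Fin 3) F := ⟨Matrix.diagonal fun i => (c i : F),
      Matrix.diagonal fun i => (((c i)⁻¹ : Fˣ) : F), by simp, by simp⟩
    have hD : Matrix.GeneralLinearGroup.det D = u⁻¹ := by
      apply Units.ext
      change (Matrix.diagonal fun i => (c i : F)).det = _
      rw [Matrix.det_diagonal, Fin.prod_univ_three]
      simp [c]
    have hc : ∀ i, (c i : F) ∈ 𝒪[F] ∧ (((c i)⁻¹ : Fˣ) : F) ∈ 𝒪[F] := by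
      intro i
      fin_cases i
      · exact ⟨hu', by simpa [c] using hu⟩
      · simp [c, one_mem]
      · simp [c, one_mem]
    have hle : ∀ M : GL (Fin 3) F, (∀ i j, M.1 i j ∈ 𝒪[F]) → (∀ i j, (M⁻¹).1 i j ∈ 𝒪[F]) →
        M • stdLat F = stdLat F := by
      intro M h1 h2
      apply Subtype.ext
      refine le_antisymm (smul_le_of_entries h1) ?_
      have := Submodule.map_mono (f := glMap M) (smul_le_of_entries h2)
      rwa [← coe_gl_smul, ← coe_gl_smul, smul_inv_smul] at this
    have hDL : D • stdLat F = stdLat F := by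
      apply hle
      · intro i j
        change Matrix.diagonal _ i j ∈ _
        rw [Matrix.diagonal_apply]
        split_ifs
        · exact (hc i).1
        · exact zero_mem _
      · intro i j
        change Matrix.diagonal _ i j ∈ _
        rw [Matrix.diagonal_apply]
        split_ifs
        · exact (hc i).2
        · exact zero_mem _
    -- The scalar removes `ϖ ^ (3 * r)` from the determinant, so `h` has determinant 1 without a
    -- change of the vertex.
    let h : GL (Fin 3) F := Matrix.GeneralLinearGroup.scalar (Fin 3) (ϖ ^ (-r)) *
      (g * D * (diagGL ϖ (typeExp j))⁻¹)
    have hdet : Matrix.GeneralLinearGroup.det h = 1 := by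
      simp only [h, map_mul, map_inv, det_scalar_three, hD, det_diagGL, sum_typeExp, hg]
      rw [show t = 3 * r + (j : ℕ) by lia, zpow_add, zpow_mul' ϖ 3 r, zpow_ofNat, zpow_neg,
        inv_pow]
      rw [show u * ((ϖ ^ r) ^ 3 * ϖ ^ ((j : ℕ) : ℤ)) * u⁻¹ = (ϖ ^ r) ^ 3 * ϖ ^ ((j : ℕ) : ℤ) by
        rw [mul_comm u, mul_inv_cancel_right], mul_inv_cancel_right, inv_mul_cancel]
    refine ⟨Matrix.ProjGenLinGroup.mk h, ⟨⟨h.1, congrArg Units.val hdet⟩, ?_⟩, ?_⟩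
    · change Matrix.ProjGenLinGroup.mk _ = _
      congr 1
      exact Units.ext rfl
    · rw [typeVertex_eq, mk_smul_vertex, vertex_eq_iff]
      refine ⟨ϖ ^ (-r), ?_⟩
      rw [← coe_scalar_smul, ← mul_smul, ← mul_smul]
      simp only [h]
      rw [mul_assoc, inv_mul_cancel_right, mul_smul, mul_smul, hDL, mul_smul]

/-- Here `t` is the valuation of the determinant of the frame, so within one apartment the type is a
shift of the coordinate sum. -/
lemma exists_hasType_frameLat_iff {ϖ : Fˣ} (hϖ : IsUniformizer ϖ)
    (b : Module.Basis (Fin 3) F (Fin 3 → F)) :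
    ∃ t : ℤ, ∀ (m : Fin 3 → ℤ) (j : Fin 3),
      HasType ϖ (frameLat ϖ b m).vertex j ↔ (3 : ℤ) ∣ t + ∑ i, m i - (j : ℕ) := by
  obtain ⟨g, rfl⟩ := exists_basisFun_map_eq b
  obtain ⟨t, u, hu, hu', h⟩ := hϖ.exists_unit_mul_zpow (Matrix.GeneralLinearGroup.det g)
  refine ⟨t, fun m j => ?_⟩
  rw [← gl_smul_frameLat, ← diagGL_smul_stdLat, ← mul_smul]
  refine hasType_iff hϖ hu hu' ?_ j
  rw [map_mul, h, det_diagGL, zpow_add, mul_assoc]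

end Types

/-! ### Positively oriented segments and cyclic quotients. -/

section Segments

variable {F : Type*} [Field F] [ValuativeRel F]

lemma adj_frameLat_succ {ϖ : Fˣ} (hϖ : IsUniformizer ϖ) [IsDiscreteValuationRing 𝒪[F]]
    (b : Module.Basis (Fin 3) F (Fin 3 → F)) (k : ℤ) :
    Adj ϖ (frameLat ϖ b ![0, 0, k]).vertex (frameLat ϖ b ![0, 0, k + 1]).vertex := by
  refine ⟨fun h => ?_, _, _, rfl, rfl, ?_, ?_⟩
  · obtain ⟨α, hα⟩ := vertex_eq_iff.1 h
    obtain ⟨t, ht⟩ := hϖ.exists_zpow_smul α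
    rw [ht, zpow_smul_frameLat] at hα
    have h1 := (frameLat_le_iff hϖ b).1 hα.le
    have h2 := (frameLat_le_iff hϖ b).1 hα.ge
    have h3 := h1 0
    have h4 := h2 0
    have h5 := h1 2
    have h6 := h2 2
    simp at h3 h4 h5 h6
    lia
  · rw [smul_frameLat, frameLat_le_iff hϖ]
    intro i; fin_cases i <;> simp
  · rw [frameLat_le_iff hϖ]
    intro i; fin_cases i <;> simp

/-- The intermediate vertices of a segment are determined by its endpoints. -/
lemma frameLat_eq_of_endpoint_eq {ϖ : Fˣ} (hϖ : IsUniformizer ϖ)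
    {b b' : Module.Basis (Fin 3) F (Fin 3 → F)} {n i : ℕ} (hi : i ≤ n)
    (h : spanLat b = spanLat b') (h' : frameLat ϖ b ![0, 0, (n : ℤ)] = frameLat ϖ b' ![0, 0, (n : ℤ)]) :
    frameLat ϖ b ![0, 0, (i : ℤ)] = frameLat ϖ b' ![0, 0, (i : ℤ)] := by
  -- The `i`-th lattice is the endpoint lattice plus `ϖ ^ i L`, an expression that does not involve
  -- the frame.
  have key : ∀ b : Module.Basis (Fin 3) F (Fin 3 → F), (frameLat ϖ b ![0, 0, (i : ℤ)]).1 =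
      (frameLat ϖ b ![0, 0, (n : ℤ)]).1 ⊔ ϖ ^ (i : ℤ) • (spanLat b).1 := by
    intro b
    rw [← frameLat_zero ϖ b, zpow_smul_frameLat, frameLat_sup hϖ]
    congr 2
    funext l
    fin_cases l <;> simp [hi]
  apply Subtype.ext
  rw [key, key, h, h']

variable [IsDiscreteValuationRing 𝒪[F]]

lemma posEdge_frameLat_succ {ϖ : Fˣ} (hϖ : IsUniformizer ϖ)
    (b : Module.Basis (Fin 3) F (Fin 3 → F)) (k : ℤ) :
    PosEdge ϖ (frameLat ϖ b ![0, 0, k]).vertex (frameLat ϖ b ![0, 0, k + 1]).vertex := by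
  refine ⟨adj_frameLat_succ hϖ b k, ?_⟩
  obtain ⟨t, ht⟩ := exists_hasType_frameLat_iff hϖ b
  have h0 : ∑ i, (![0, 0, k] : Fin 3 → ℤ) i = k := by simp [Fin.sum_univ_three]
  have h1 : ∑ i, (![0, 0, k + 1] : Fin 3 → ℤ) i = k + 1 := by simp [Fin.sum_univ_three]
  obtain ⟨j, hj⟩ : ∃ j : Fin 3, (3 : ℤ) ∣ t + k - (j : ℕ) :=
    ⟨⟨((t + k) % 3).toNat, by lia⟩, by lia⟩
  refine ⟨j, (ht _ _).2 (by rwa [h0]), (ht _ _).2 ?_⟩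
  have h9 : (3 : ℤ) ∣ ((j : ℕ) : ℤ) + 1 - ((j + 1 : Fin 3) : ℕ) := by
    fin_cases j <;> simp
  rw [h1]
  lia

lemma isRankOneGeodesic_frameLat {ϖ : Fˣ} (hϖ : IsUniformizer ϖ)
    (b : Module.Basis (Fin 3) F (Fin 3 → F)) :
    IsRankOneGeodesic ϖ fun k => (frameLat ϖ b ![0, 0, k]).vertex := by
  refine ⟨⟨b, 0, ![0, 0, 1], fun k => ?_⟩, adj_frameLat_succ hϖ b⟩
  have : (![0, 0, k] : Fin 3 → ℤ) = 0 + k • ![0, 0, 1] := by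
    funext i; fin_cases i <;> simp
  dsimp only
  rw [this]

lemma posEdge_frameSegment {ϖ : Fˣ} (hϖ : IsUniformizer ϖ)
    (b : Module.Basis (Fin 3) F (Fin 3 → F)) {n : ℕ} (i : Fin n) :
    PosEdge ϖ (frameLat ϖ b ![0, 0, ((i.castSucc : Fin (n + 1)) : ℕ)]).vertex
      (frameLat ϖ b ![0, 0, ((i.succ : Fin (n + 1)) : ℕ)]).vertex := by
  rw [Fin.val_castSucc, Fin.val_succ, Nat.cast_succ]
  exact posEdge_frameLat_succ hϖ b _

/-- The segment from `[⟨b₀, b₁, b₂⟩]` in direction `b₂`. -/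
noncomputable def frameSegment {ϖ : Fˣ} (hϖ : IsUniformizer ϖ)
    (b : Module.Basis (Fin 3) F (Fin 3 → F)) (n : ℕ) : PosSegment (F := F) ϖ n :=
  ⟨fun i => (frameLat ϖ b ![0, 0, ((i : ℕ) : ℤ)]).vertex,
    ⟨_, isRankOneGeodesic_frameLat hϖ b, 0, fun i => by rw [zero_add]⟩,
    posEdge_frameSegment hϖ b⟩

/-- Every positively oriented segment that starts at `[L]` comes from a frame of `L`. -/
lemma PosSegment.exists_eq_frameLat {ϖ : Fˣ} (hϖ : IsUniformizer ϖ) {n : ℕ}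
    (s : PosSegment (F := F) ϖ n) {L : Lat F} (hs : s.o = L.vertex) :
    ∃ b, L = spanLat b ∧ ∀ i, s.1 i = (frameLat ϖ b ![0, 0, ((i : ℕ) : ℤ)]).vertex := by
  replace hs : s.1 0 = L.vertex := hs
  obtain ⟨⟨c, ⟨⟨b₀, a, d, hc⟩, -⟩, k, hk⟩, hpos⟩ := s.2
  generalize s.1 = s at hs hk hpos ⊢
  -- The frame is rescaled so that the segment starts at the origin of the apartment and `L` itself
  -- is the origin.
  obtain ⟨b, hb, hbs⟩ : ∃ b, L = spanLat b ∧
      ∀ i : Fin (n + 1), s i = (frameLat ϖ b (((i : ℕ) : ℤ) • d)).vertex := by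
    rw [hk, hc, vertex_eq_iff] at hs
    obtain ⟨α, hα⟩ := hs
    refine ⟨(b₀.unitsSMul fun i => ϖ ^ (a + k • d) i).unitsSMul fun _ => α, ?_, fun i => ?_⟩
    · apply Subtype.ext
      rw [spanLat_unitsSMul_const, hα]
      simp [frameLat]
    · rw [hk, hc, vertex_eq_iff]
      refine ⟨α, ?_⟩
      rw [frameLat_unitsSMul_const, frameLat_unitsSMul, add_smul, add_assoc]
  -- Without an edge the direction `d` is unconstrained, but then it plays no role.
  rcases n with _ | n
  · refine ⟨b, hb, fun i => ?_⟩
    obtain rfl : i = 0 := Fin.ext (by lia)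
    rw [hbs]
    congr 2
    funext i; fin_cases i <;> simp
  obtain ⟨⟨-, Λ₁, Λ₂, h1, h2, h3, h4⟩, j, h5, h6⟩ := hpos 0
  have e0 : s (Fin.castSucc 0) = L.vertex := by
    rw [hbs, hb, ← frameLat_zero ϖ]
    congr 2
    funext i; simp
  have e1 : s (Fin.succ 0) = (frameLat ϖ b d).vertex := by
    rw [hbs]
    congr 2
    funext i; simp
  rw [e0] at h1 h5
  rw [e1] at h2 h6
  -- Adjacency on the first edge puts `d`, up to a constant shift, into `{0, 1}³`. Positivity makes
  -- the sum congruent to 1 modulo 3, so exactly one entry is 1; straightness handles the later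
  -- edges.
  obtain ⟨t, ht⟩ : ∃ t : ℤ, ∀ i, 0 ≤ d i + t ∧ d i + t ≤ 1 := by
    obtain ⟨β, hβ⟩ := vertex_eq_iff.1 h1.symm
    obtain ⟨γ, hγ⟩ := vertex_eq_iff.1 h2.symm
    obtain ⟨r, hr⟩ := hϖ.exists_zpow_smul β
    obtain ⟨r', hr'⟩ := hϖ.exists_zpow_smul γ
    rw [hr, hb, ← frameLat_zero ϖ, zpow_smul_frameLat] at hβ
    rw [hr', zpow_smul_frameLat] at hγ
    rw [hβ, hγ, smul_frameLat, frameLat_le_iff hϖ] at h3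
    rw [hβ, hγ, frameLat_le_iff hϖ] at h4
    refine ⟨r' - r, fun i => ?_⟩
    have h7 := h3 i
    have h8 := h4 i
    simp only [Pi.zero_apply, zero_add] at h7 h8
    lia
  have hsum : (3 : ℤ) ∣ ∑ i, d i - 1 := by
    obtain ⟨t', ht'⟩ := exists_hasType_frameLat_iff hϖ b
    rw [hb, ← frameLat_zero ϖ, ht'] at h5
    rw [ht'] at h6
    have h9 : (3 : ℤ) ∣ ((j : ℕ) : ℤ) + 1 - ((j + 1 : Fin 3) : ℕ) := by
      fin_cases j <;> simp
    simp only [Pi.zero_apply, Finset.sum_const_zero] at h5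
    lia
  rw [Fin.sum_univ_three] at hsum
  have ht0 := ht 0
  have ht1 := ht 1
  have ht2 := ht 2
  obtain ⟨e, he⟩ : ∃ e : Fin 3 ≃ Fin 3, (fun i => d i + t) = ![0, 0, 1] ∘ e := by
    by_cases h7 : d 0 + t = 1
    · refine ⟨Equiv.swap 0 2, ?_⟩
      funext i
      fin_cases i <;> simp [Equiv.swap_apply_def] <;> lia
    by_cases h8 : d 1 + t = 1
    · refine ⟨Equiv.swap 1 2, ?_⟩
      funext i
      fin_cases i <;> simp [Equiv.swap_apply_def] <;> lia
    · refine ⟨Equiv.refl _, ?_⟩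
      funext i
      fin_cases i <;> simp <;> lia
  refine ⟨b.reindex e, ?_, fun i => ?_⟩
  · rw [hb, ← frameLat_zero ϖ, ← frameLat_zero ϖ, frameLat_reindex]; rfl
  · rw [hbs, frameLat_reindex, vertex_eq_iff]
    -- Replacing `d` by `d + t` shifts the `i`-th point by the constant `i * t`, which is a
    -- homothety.
    refine ⟨ϖ ^ (((i : ℕ) : ℤ) * t), ?_⟩
    rw [zpow_smul_frameLat]
    congr 2
    funext l
    have hl := congrFun he l
    simp only [Function.comp_apply] at hl ⊢
    have : (![0, 0, ((i : ℕ) : ℤ)] : Fin 3 → ℤ) (e l) =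
        ((i : ℕ) : ℤ) * (![0, 0, 1] : Fin 3 → ℤ) (e l) := by
      generalize e l = l'
      fin_cases l' <;> simp
    rw [this, ← hl]
    simp [mul_add]

variable [Finite 𝓀[F]]

/-- A sublattice `P` gives the segment along a chosen frame adapted to `L` and `P`. The endpoint
recovers `P`, by `CyclicIn.vertex_inj`, and the choice of frame does not matter, by
`frameLat_eq_of_endpoint_eq`. -/
lemma exists_posSegment_bijective {ϖ : Fˣ} (hϖ : IsUniformizer ϖ) (n : ℕ) (L : Lat F) :
    ∃ f : {P // CyclicIn ϖ n L P} → {s : PosSegment (F := F) ϖ n // s.o = L.vertex},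
      Function.Bijective f ∧ ∀ P, (f P).1.e = P.1.vertex := by
  choose b hb hb' using fun P : {P // CyclicIn ϖ n L P} => (cyclicIn_iff hϖ).1 P.2
  have he : ∀ P, (frameSegment hϖ (b P) n).e = P.1.vertex := by
    intro P
    rw [hb' P]
    change (frameLat ϖ (b P) ![0, 0, ((Fin.last n : Fin (n + 1)) : ℕ)]).vertex = _
    rw [Fin.val_last]
  refine ⟨fun P => ⟨frameSegment hϖ (b P) n, ?_⟩, ⟨?_, ?_⟩, he⟩
  · conv_rhs => rw [hb P, ← frameLat_zero ϖ]
    change (frameLat ϖ (b P) ![0, 0, ((0 : Fin (n + 1)) : ℕ)]).vertex = _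
    congr 2
    funext i; fin_cases i <;> simp
  · intro P P' h
    have h1 : frameSegment hϖ (b P) n = frameSegment hϖ (b P') n := congrArg Subtype.val h
    apply Subtype.ext
    refine CyclicIn.vertex_inj hϖ P.2 P'.2 ?_
    rw [← he, ← he, h1]
  · rintro ⟨s, hs⟩
    obtain ⟨b', hL, hs'⟩ := s.exists_eq_frameLat hϖ hs
    let P : {P // CyclicIn ϖ n L P} :=
      ⟨frameLat ϖ b' ![0, 0, (n : ℤ)], (cyclicIn_iff hϖ).2 ⟨b', hL, rfl⟩⟩
    refine ⟨P, Subtype.ext (Subtype.ext (funext fun i => ?_))⟩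
    rw [hs' i]
    change (frameLat ϖ (b P) ![0, 0, ((i : ℕ) : ℤ)]).vertex = _
    rw [frameLat_eq_of_endpoint_eq hϖ (Nat.lt_succ_iff.1 i.2) ((hb P).symm.trans hL) (hb' P).symm]

lemma lineOperator_lmapDomain {ϖ : Fˣ} (hϖ : IsUniformizer ϖ) (n : ℕ) (v : Lat F →₀ ℂ) :
    lineOperator ϖ n (Finsupp.lmapDomain ℂ ℂ Lat.vertex v) =
      Finsupp.lmapDomain ℂ ℂ Lat.vertex (cyclicOp ϖ n v) := by
  induction v using Finsupp.induction_linear with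
  | zero => simp
  | add v w hv hw => rw [map_add, map_add, hv, hw, map_add, map_add]
  | single L c =>
    rw [← mul_one c, ← smul_eq_mul, ← Finsupp.smul_single, map_smul, map_smul, map_smul, map_smul]
    congr 1
    rw [cyclicOp, lmapDomain_correspondence_single (finite_cyclicIn hϖ n L),
      Finsupp.lmapDomain_apply, Finsupp.mapDomain_single, lineOperator,
      Finsupp.linearCombination_single, one_smul]
    obtain ⟨f, hf, he⟩ := exists_posSegment_bijective hϖ n L
    exact (finsum_eq_of_bijective f hf fun P => by rw [he]).symm

end Segments

/-! ### Discrete subgroups and compact sets. -/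

section DiscreteSubgroups

/-- A discrete subgroup meets a compact set in finitely many elements. -/
lemma finite_inter_of_isCompact {G : Type*} [Group G] [TopologicalSpace G] [IsTopologicalGroup G]
    (Γ : Subgroup G) [DiscreteTopology Γ] {C : Set G} (hC : IsCompact C) :
    (C ∩ Γ : Set G).Finite := by
  obtain ⟨U, hU, hU1⟩ : ∃ U : Set G, IsOpen U ∧ (Subtype.val : Γ → G) ⁻¹' U = {1} :=
    isOpen_induced_iff.1 (isOpen_discrete ({1} : Set Γ))
  have h1 : (1 : G) ∈ U := by
    have : (1 : Γ) ∈ (Subtype.val : Γ → G) ⁻¹' U := by rw [hU1]; rfl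
    exact this
  have hcont : Continuous fun p : G × G => p.1⁻¹ * p.2 := by fun_prop
  have hnhds : (fun p : G × G => p.1⁻¹ * p.2) ⁻¹' U ∈ nhds ((1 : G), (1 : G)) :=
    (hU.preimage hcont).mem_nhds (by simpa using h1)
  rw [nhds_prod_eq, Filter.mem_prod_self_iff] at hnhds
  obtain ⟨V, hV, hVU⟩ := hnhds
  -- As `V⁻¹ V ⊆ U` and `U` meets `Γ` only in 1, each translate `c V` contains at most one element
  -- of `Γ`.
  obtain ⟨t, -, ht⟩ := hC.elim_nhds_subcover (fun c => c • V) fun c _ => by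
    simpa using smul_mem_nhds_smul c hV
  refine (t.finite_toSet.biUnion fun c _ => (?_ : ((c • V) ∩ Γ : Set G).Finite)).subset ?_
  · refine Set.Subsingleton.finite ?_
    rintro a ⟨⟨v, hv, rfl⟩, ha⟩ b ⟨⟨w, hw, rfl⟩, hb⟩
    have h2 : (⟨_, mul_mem (inv_mem ha) hb⟩ : Γ) ∈ (Subtype.val : Γ → G) ⁻¹' U := by
      have h3 : v⁻¹ * w ∈ U := hVU (Set.mk_mem_prod hv hw)
      change (c * v)⁻¹ * (c * w) ∈ U
      rwa [mul_inv_rev, mul_assoc, inv_mul_cancel_left]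
    rw [hU1] at h2
    exact (inv_mul_eq_one.1 (congrArg Subtype.val h2))
  · rintro y ⟨hy, hy'⟩
    obtain ⟨c, hc, hcy⟩ := Set.mem_iUnion₂.1 (ht hy)
    exact Set.mem_biUnion (x := c) hc ⟨hcy, hy'⟩

end DiscreteSubgroups

/-! ### Descent to `Γ \ X`. -/

section Quotient

variable {F : Type*} [Field F] [ValuativeRel F]

lemma toQuot_eq_iff {Γ : Subgroup PGL(3, F)} {x y : Vertex F} :
    toQuot Γ x = toQuot Γ y ↔ ∃ γ ∈ Γ, γ • y = x := by
  refine ⟨fun h => ?_, fun ⟨γ, hγ, h⟩ => Quotient.sound ⟨⟨γ, hγ⟩, h⟩⟩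
  obtain ⟨⟨γ, hγ⟩, h⟩ := Quotient.exact h
  exact ⟨γ, hγ, h⟩

/-- `PGL₃(F)` may permute the types, but it carries frames to frames, and a segment along the last
vector of any frame is positively oriented. -/
lemma PosSegment.exists_smul [IsDiscreteValuationRing 𝒪[F]] {ϖ : Fˣ} (hϖ : IsUniformizer ϖ)
    {n : ℕ} (s : PosSegment (F := F) ϖ n) (γ : PGL(3, F)) :
    ∃ t : PosSegment (F := F) ϖ n, ∀ i, t.1 i = γ • s.1 i := by
  obtain ⟨L, hL⟩ := Quotient.exists_rep s.o
  obtain ⟨b, -, hb⟩ := s.exists_eq_frameLat hϖ hL.symm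
  induction γ using Matrix.ProjGenLinGroup.induction_on with | mk g =>
  obtain ⟨b', hb'⟩ : ∃ b', ∀ m, g • frameLat ϖ b m = frameLat ϖ b' m := by
    obtain ⟨h, rfl⟩ := exists_basisFun_map_eq b
    refine ⟨(Pi.basisFun F (Fin 3)).map (glEquiv (g * h)), fun m => ?_⟩
    rw [← gl_smul_frameLat, ← gl_smul_frameLat, mul_smul]
  refine ⟨frameSegment hϖ b' n, fun i => ?_⟩
  rw [hb, mk_smul_vertex, hb']
  rfl

variable [TopologicalSpace F] [IsNonarchimedeanLocalField F]

lemma isCompact_stabilizer (x : Vertex F) : IsCompact {g : PGL(3, F) | g • x = x} := by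
  obtain ⟨g, rfl⟩ := exists_smul_stdLat x
  have hc : Continuous fun k : PGL(3, F) => g * k * g⁻¹ := by fun_prop
  convert (isCompact_maxCompact F).image hc using 1
  ext y
  constructor
  · intro h
    refine ⟨g⁻¹ * y * g, ?_, by group⟩
    rw [SetLike.mem_coe, ← smul_stdLat_vertex, mul_smul, mul_smul, inv_smul_eq_iff]
    exact h
  · rintro ⟨k, hk, rfl⟩
    change (g * k * g⁻¹) • g • (stdLat F).vertex = g • (stdLat F).vertex
    rw [← mul_smul, inv_mul_cancel_right, smul_stdLat_vertex_mul hk]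

/-- A discrete and torsion-free subgroup acts freely on the vertices. -/
lemma eq_one_of_smul_eq {Γ : Subgroup PGL(3, F)} [DiscreteTopology Γ]
    (htf : ∀ γ ∈ Γ, γ ≠ 1 → ¬ IsOfFinOrder γ) {γ : PGL(3, F)} (hγ : γ ∈ Γ) {x : Vertex F}
    (h : γ • x = x) : γ = 1 := by
  by_contra hne
  -- The powers of an element of infinite order would be infinitely many points of `Γ` in the
  -- compact stabilizer of `x`.
  refine Set.infinite_of_injective_forall_mem
    (injective_pow_iff_not_isOfFinOrder.2 (htf γ hγ hne)) (fun n => ?_)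
    (finite_inter_of_isCompact Γ (isCompact_stabilizer x))
  exact ⟨pow_mem (S := MulAction.stabilizer PGL(3, F) x) (x := γ) h n, pow_mem hγ n⟩

lemma eq_of_smul_eq_smul {Γ : Subgroup PGL(3, F)} [DiscreteTopology Γ]
    (htf : ∀ γ ∈ Γ, γ ≠ 1 → ¬ IsOfFinOrder γ) {γ γ' : PGL(3, F)} (hγ : γ ∈ Γ) (hγ' : γ' ∈ Γ)
    {x : Vertex F} (h : γ • x = γ' • x) : γ = γ' := by
  refine (inv_mul_eq_one.1 (eq_one_of_smul_eq htf (mul_mem (inv_mem hγ') hγ) (x := x) ?_)).symm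
  rw [mul_smul, h, inv_smul_smul]

variable {Γ : Subgroup PGL(3, F)} [DiscreteTopology Γ]

/-- Translating by `Γ` moves the starting point of a lift to `x`; the lift is then unique, since
only 1 fixes `x`. -/
lemma quotPosSegment_bijective (htf : ∀ γ ∈ Γ, γ ≠ 1 → ¬ IsOfFinOrder γ) {ϖ : Fˣ}
    (hϖ : IsUniformizer ϖ) (n : ℕ) (x : Vertex F) :
    Function.Bijective (fun s => ⟨Quotient.mk _ s.1, congrArg (toQuot Γ) s.2⟩ :
      {s : PosSegment (F := F) ϖ n // s.o = x} →
        {s : QuotPosSegment Γ ϖ n // s.o = toQuot Γ x}) := by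
  constructor
  · rintro ⟨s, hs⟩ ⟨t, ht⟩ h
    obtain ⟨γ, hγ, h⟩ := Quotient.exact (congrArg Subtype.val h)
    have h0 : t.o = γ • s.o := h 0
    rw [hs, ht] at h0
    obtain rfl := eq_one_of_smul_eq htf hγ h0.symm
    refine Subtype.ext (Subtype.ext (funext fun i => ?_))
    rw [h i, one_smul]
  · rintro ⟨s, hs⟩
    obtain ⟨s, rfl⟩ := Quotient.exists_rep s
    obtain ⟨γ, hγ, h⟩ := toQuot_eq_iff.1 (hs : toQuot Γ s.o = toQuot Γ x)
    obtain ⟨t, ht⟩ := s.exists_smul hϖ γ⁻¹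
    refine ⟨⟨t, ?_⟩, Subtype.ext (Quotient.sound ⟨γ, hγ, fun i => ?_⟩)⟩
    · refine (ht 0).trans ?_
      rw [inv_smul_eq_iff, h]
      rfl
    · rw [ht, smul_inv_smul]

lemma quotLineOperator_lmapDomain (htf : ∀ γ ∈ Γ, γ ≠ 1 → ¬ IsOfFinOrder γ) {ϖ : Fˣ}
    (hϖ : IsUniformizer ϖ) (n : ℕ) (v : Lat F →₀ ℂ) :
    quotLineOperator Γ ϖ n (Finsupp.lmapDomain ℂ ℂ (fun L : Lat F => toQuot Γ L.vertex) v) =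
      Finsupp.lmapDomain ℂ ℂ (fun L : Lat F => toQuot Γ L.vertex) (cyclicOp ϖ n v) := by
  induction v using Finsupp.induction_linear with
  | zero => simp
  | add v w hv hw => rw [map_add, map_add, hv, hw, map_add, map_add]
  | single L c =>
    rw [← mul_one c, ← smul_eq_mul, ← Finsupp.smul_single, map_smul, map_smul, map_smul, map_smul]
    congr 1
    rw [cyclicOp, lmapDomain_correspondence_single (finite_cyclicIn hϖ n L),
      Finsupp.lmapDomain_apply, Finsupp.mapDomain_single, quotLineOperator,
      Finsupp.linearCombination_single, one_smul]
    obtain ⟨f, hf, he⟩ := exists_posSegment_bijective hϖ n L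
    refine (finsum_eq_of_bijective _ ((quotPosSegment_bijective htf hϖ n L.vertex).comp hf)
      fun P => ?_).symm
    rw [← he]
    rfl

/-- By freeness `w = γ x` for a unique `γ ∈ Γ`, and `w` corresponds to `y = γ⁻¹ z`. The left side
arises from convolution on the quotient, the right side from pushing forward the operator on `X`. -/
lemma ncard_relPos_quot (htf : ∀ γ ∈ Γ, γ ≠ 1 → ¬ IsOfFinOrder γ) (a : PGL(3, F))
    (x z : Vertex F) :
    {w | RelPos a w z ∧ toQuot Γ w = toQuot Γ x}.ncard =
      {y | RelPos a x y ∧ toQuot Γ z = toQuot Γ y}.ncard := by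
  choose γ hγ h using fun w : {w | RelPos a w z ∧ toQuot Γ w = toQuot Γ x} =>
    toQuot_eq_iff.1 w.2.2
  refine Set.ncard_congr (fun w hw => (γ ⟨w, hw⟩)⁻¹ • z) ?_ ?_ ?_
  · intro w hw
    refine ⟨?_, toQuot_eq_iff.2 ⟨_, hγ ⟨w, hw⟩, smul_inv_smul _ _⟩⟩
    rw [← relPos_smul_iff (γ ⟨w, hw⟩), h, smul_inv_smul]
    exact hw.1
  · intro w w' hw hw' e
    have := eq_of_smul_eq_smul htf (inv_mem (hγ ⟨w, hw⟩)) (inv_mem (hγ ⟨w', hw'⟩)) e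
    have e1 := h ⟨w, hw⟩
    rw [inv_injective this, h ⟨w', hw'⟩] at e1
    exact e1.symm
  · rintro y ⟨hy, hy'⟩
    obtain ⟨δ, hδ, rfl⟩ := toQuot_eq_iff.1 hy'
    have hw : δ • x ∈ {w | RelPos a w (δ • y) ∧ toQuot Γ w = toQuot Γ x} :=
      ⟨hy.smul δ, toQuot_eq_iff.2 ⟨δ, hδ, rfl⟩⟩
    refine ⟨δ • x, hw, ?_⟩
    rw [eq_of_smul_eq_smul htf (hγ ⟨_, hw⟩) hδ (h ⟨_, hw⟩), inv_smul_smul]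

lemma heckeQuot_lmapDomain (htf : ∀ γ ∈ Γ, γ ≠ 1 → ¬ IsOfFinOrder γ) (a : PGL(3, F))
    (v : Vertex F →₀ ℂ) :
    heckeQuot Γ a (Finsupp.lmapDomain ℂ ℂ (toQuot Γ) v) =
      Finsupp.lmapDomain ℂ ℂ (toQuot Γ) (heckeX a v) := by
  classical
  induction v using Finsupp.induction_linear with
  | zero => simp
  | add v w hv hw => rw [map_add, map_add, hv, hw, map_add, map_add]
  | single x c =>
    rw [← mul_one c, ← smul_eq_mul, ← Finsupp.smul_single, map_smul, map_smul, map_smul, map_smul]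
    congr 1
    rw [heckeX_single, correspondence_single (finite_relPos_right a x), map_sum,
      Finsupp.lmapDomain_apply, Finsupp.mapDomain_single]
    ext y
    obtain ⟨z, rfl⟩ := Quotient.exists_rep y
    obtain ⟨g, rfl⟩ := exists_smul_stdLat z
    refine (heckeOperator_apply _ _ a _ g).trans ?_
    refine (convolve_eq_sum a (fun w => Finsupp.single (toQuot Γ x) 1 (toQuot Γ w)) g).trans ?_
    rw [Finsupp.finsetSum_apply]
    simp only [Finsupp.lmapDomain_apply, Finsupp.mapDomain_single, Finsupp.single_apply]
    rw [Finset.sum_boole, Finset.sum_boole, ← Set.ncard_coe_finset, ← Set.ncard_coe_finset]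
    refine congrArg Nat.cast (Eq.trans ?_ ((ncard_relPos_quot htf a x
      (g • (stdLat F).vertex)).trans ?_)) <;> refine congrArg Set.ncard (Set.ext fun w => ?_)
    · rw [Finset.mem_coe, Finset.mem_filter, Set.Finite.mem_toFinset, @eq_comm _ (toQuot Γ x)]
      rfl
    · rw [Finset.mem_coe, Finset.mem_filter, Set.Finite.mem_toFinset, @eq_comm _ (toQuot Γ w)]
      rfl

end Quotient

/-! ### Push-forward from lattices to vertices. -/

section Surjectivity

variable {F : Type*} [Field F] [ValuativeRel F]

lemma vertex_surjective : Function.Surjective (Lat.vertex : Lat F → Vertex F) :=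
  Quotient.exists_rep

lemma vertex_scale (ϖ : Fˣ) (L : Lat F) : (L.scale ϖ).vertex = L.vertex :=
  vertex_eq_iff.2 ⟨ϖ⁻¹, by simp [Lat.scale]⟩

lemma lmapDomain_surjective {α β : Type*} {f : α → β} (hf : Function.Surjective f) :
    Function.Surjective (Finsupp.lmapDomain ℂ ℂ f) :=
  Finsupp.mapDomain_surjective hf

lemma lmapDomain_scaleOp {α : Type*} (ϖ : Fˣ) {f : Lat F → α} (hf : ∀ L, f (L.scale ϖ) = f L)
    (v : Lat F →₀ ℂ) :
    Finsupp.lmapDomain ℂ ℂ f (scaleOp ϖ v) = Finsupp.lmapDomain ℂ ℂ f v := by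
  rw [scaleOp, ← LinearMap.comp_apply, ← Finsupp.lmapDomain_comp]
  congr 2
  exact funext hf

end Surjectivity
end PGLThree

theorem mainTheorem6 (F : Type*) [Field F] [ValuativeRel F] [TopologicalSpace F]
    [IsNonarchimedeanLocalField F]
    (ϖ : Fˣ) (hϖ : (ϖ : F) ∈ 𝒪[F]) (hgen : 𝓂[F] = Ideal.span {(⟨(ϖ : F), hϖ⟩ : 𝒪[F])})
    (q : ℕ) (hq : q = Nat.card 𝓀[F]) :
    -- the relations on `C₀(X)`
    (∀ (A : ℕ → Module.End ℂ (PGLThree.Vertex F →₀ ℂ))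
      (π₁ π₂ : Module.End ℂ (PGLThree.Vertex F →₀ ℂ)),
      A = PGLThree.lineOperator ϖ →
      π₁ = PGLThree.heckeX (PGLThree.diagElt ![1, 1, ϖ]) →
      π₂ = PGLThree.heckeX (PGLThree.diagElt ![1, ϖ, ϖ]) →
        A 1 = π₁ ∧
        A 2 = π₁ ^ 2 - ((q : ℂ) + 1) • π₂ ∧
        A 3 = π₁ ^ 3 - (2 * (q : ℂ) + 1) • (π₁ * π₂) + ((1 + (q : ℂ) + (q : ℂ) ^ 2) * q) • 1 ∧
        ∀ n : ℕ, 3 ≤ n →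
          A (n + 1) = A n * π₁ - (q : ℂ) • (A (n - 1) * π₂) + (q : ℂ) ^ 3 • A (n - 2)) ∧
    -- the relations on `C₀(Γ \ X)`
    (∀ Γ : Subgroup PGL(3, F), DiscreteTopology Γ → CompactSpace (PGL(3, F) ⧸ Γ) →
      (∀ γ ∈ Γ, γ ≠ 1 → ¬ IsOfFinOrder γ) →
      ∀ (A : ℕ → Module.End ℂ (PGLThree.QuotVertex Γ →₀ ℂ))
        (π₁ π₂ : Module.End ℂ (PGLThree.QuotVertex Γ →₀ ℂ)),
        A = PGLThree.quotLineOperator Γ ϖ →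
        π₁ = PGLThree.heckeQuot Γ (PGLThree.diagElt ![1, 1, ϖ]) →
        π₂ = PGLThree.heckeQuot Γ (PGLThree.diagElt ![1, ϖ, ϖ]) →
          A 1 = π₁ ∧
          A 2 = π₁ ^ 2 - ((q : ℂ) + 1) • π₂ ∧
          A 3 = π₁ ^ 3 - (2 * (q : ℂ) + 1) • (π₁ * π₂) + ((1 + (q : ℂ) + (q : ℂ) ^ 2) * q) • 1 ∧
          ∀ n : ℕ, 3 ≤ n →
            A (n + 1) = A n * π₁ - (q : ℂ) • (A (n - 1) * π₂) + (q : ℂ) ^ 3 • A (n - 2)) := by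
  have hu : PGLThree.IsUniformizer ϖ := ⟨hϖ, hgen⟩
  constructor
  · rintro A π₁ π₂ rfl rfl rfl
    exact PGLThree.relations_of_intertwining hu
      (PGLThree.lmapDomain_surjective PGLThree.vertex_surjective)
      (PGLThree.lineOperator_lmapDomain hu) (PGLThree.heckeX_one_lmapDomain hu)
      (PGLThree.heckeX_two_lmapDomain hu)
      (PGLThree.lmapDomain_scaleOp ϖ (PGLThree.vertex_scale ϖ)) hq
  · rintro Γ hΓ - htf A π₁ π₂ rfl rfl rfl
    have hcomp : ∀ v, Finsupp.lmapDomain ℂ ℂ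
        (fun L : PGLThree.Lat F => PGLThree.toQuot Γ L.vertex) v =
        Finsupp.lmapDomain ℂ ℂ (PGLThree.toQuot Γ)
          (Finsupp.lmapDomain ℂ ℂ PGLThree.Lat.vertex v) := fun v => Finsupp.mapDomain_comp
    refine PGLThree.relations_of_intertwining hu
      (PGLThree.lmapDomain_surjective (f := fun L : PGLThree.Lat F => PGLThree.toQuot Γ L.vertex)
        (Function.Surjective.comp (g := PGLThree.toQuot Γ)
          (f := PGLThree.Lat.vertex) Quotient.mk_surjective
          PGLThree.vertex_surjective))
      (PGLThree.quotLineOperator_lmapDomain htf hu) (fun v => ?_) (fun v => ?_)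
      (PGLThree.lmapDomain_scaleOp ϖ fun L => congrArg _ (PGLThree.vertex_scale ϖ L)) hq
    · rw [hcomp, hcomp, PGLThree.heckeQuot_lmapDomain htf, PGLThree.heckeX_one_lmapDomain hu]
    · rw [hcomp, hcomp, PGLThree.heckeQuot_lmapDomain htf, PGLThree.heckeX_two_lmapDomain hu]
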